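/- **Generalised Kolmogorov–Riesz theorem.** Let $M$ be a smooth (Hausdorff, second countable) manifold of dimension $m$, $E\to M$ a smooth complex vector bundle of rank $k$, $r\in\mathbb R$, and $L$ a closed conic subset of $T^*M\setminus 0$ (conic: $(p,\xi)\in L$, $t>0$ imply $(p,t\xi)\in L$). Let $\mathcal D'(M;E)$ be the strong dual of the $(LF)$-space $\Gamma_c(E^\vee)$ of compactly supported smooth sections of $E^\vee=L(E,DM)$, where $DM$ is the complex $1$-density bundle, and let $B$ be a bounded subset of $\mathcal D'(M;E)$. Then $$WF^r_c(B)\subseteq L\quad\Longleftrightarrow\quad B\text{ is a relatively compact subset of }\mathcal D'^r_L(M;E).$$ Here the notation is as follows. For a chart $(O,x)$ of $M$ over which $E$ is trivialised by $\Phi_x$, and $u\in\mathcal D'(M;E)$, let $u^1_{\Phi_x},\dots,u^k_{\Phi_x}\in\mathcal D'(x(O))$ be the components of $u$ in the chart and the trivialisation; write $\langle\xi\rangle=(1+|\xi|^2)^{1/2}$ and $\mathcal F$ for the Fourier transform. * $WF^r_c(B)$, the Sobolev compactness wave front set of order $r$, is the set of $(p,\xi)\in T^*M\setminus0$ for which,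 in a trivialising chart $(O,x)$ about $p$ with $\xi=\sum_i\xi_i\,dx^i|_p$, there is $j\in\{1,\dots,k\}$ such that for every $\varphi\in\mathcal D(x(O))$ with $\varphi(x(p))\ne0$ and every open cone $V\subseteq\mathbb R^m\setminus\{0\}$ containing $(\xi_1,\dots,\xi_m)$, the quantity $\sup_{u\in B}\int_{\eta\in V,\,|\eta|>R}|\mathcal F(\varphi u^j_{\Phi_x})(\eta)|^2\langle\eta\rangle^{2r}\,d\eta$ does not tend to $0$ as $R\to\infty$. (This does not depend on the trivialising chart about $p$.) * $WF^r(u)$, the Sobolev wave front set of order $r$, is defined in the same way, with "does not tend to $0$" replaced by $\int_{V}|\mathcal F(\varphi u^j_{\Phi_x})(\eta)|^2\langle\eta\rangle^{2r}\,d\eta=\infty$. * $\mathcal D'^r_L(M;E)=\{u\in\mathcal D'(M;E) : WF^r(u)\subseteq L\}$, with the locally convex topology given by the continuous seminorms of $\mathcal D'(M;E)$ together with all the seminorms $$u\mapsto\max_{1\le j\le k}\Big(\int_V|\mathcal F((\varphi\circ x^{-1})u^j_{\Phi_x})(\eta)|^2\langle\eta\rangle^{2r}\,d\eta\Big)^{1/2},$$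 for all trivialising charts $(O,x)$, $\varphi\in\mathcal D(O)$ and closed cones $V\subseteq\mathbb R^m$ such that no point of $L$ has the form $(p,\sum_i\eta_i\,dx^i|_p)$ with $p\in\operatorname{supp}\varphi$ and $\eta\in V$. -/

import Mathlib

open Bundle MeasureTheory Set Filter
open scoped Manifold ContDiff Topology ENNReal NNReal

/-! ### Complex vector bundles over real manifolds -/

/-- A complex vector bundle is also a real vector bundle (so that Mathlib's notion of a smooth
vector bundle over a real manifold applies to it). -/
instance vectorBundleReal {M : Type*} [TopologicalSpace M] {k : ℕ} {E : M → Type*}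
    [TopologicalSpace (TotalSpace (Fin k → ℂ) E)] [∀ p, AddCommGroup (E p)]
    [∀ p, Module ℂ (E p)] [∀ p, TopologicalSpace (E p)] [FiberBundle (Fin k → ℂ) E]
    [VectorBundle ℂ (Fin k → ℂ) E] : VectorBundle ℝ (Fin k → ℂ) E := by
  have hl : ∀ (e : Trivialization (Fin k → ℂ) (π (Fin k → ℂ) E)) [MemTrivializationAtlas e],
      e.IsLinear ℝ := fun e _ ↦
    ⟨fun b hb ↦ ⟨fun x y ↦ (e.linear ℂ hb).map_add x y, fun c x ↦ by
      have := (e.linear ℂ hb).map_smul (c : ℂ) x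
      simpa only [Complex.coe_smul] using this⟩⟩
  refine ⟨hl, fun e e' _ _ ↦ ?_⟩
  have h1 := continuousOn_coordChange ℂ e e'
  have h2 := ((ContinuousLinearMap.restrictScalarsL ℂ (Fin k → ℂ) (Fin k → ℂ) ℝ
    ℝ).continuous).comp_continuousOn h1
  refine h2.congr fun b hb ↦ ?_
  ext v i
  have := hl e
  have := hl e'
  change (e.coordChangeL ℝ e' b) v i = (e.coordChangeL ℂ e' b) v i
  rw [Trivialization.coordChangeL_apply e e' hb, Trivialization.coordChangeL_apply e e' hb]

section

variable {m : ℕ} {M : Type*} [TopologicalSpace M] [ChartedSpace (EuclideanSpace ℝ (Fin m)) M]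

/-! ### The cotangent bundle without the zero section -/

variable (m M) in
/-- `T*M ∖ 0`, with the topology induced by the vector bundle topology of
`T*M = Hom(TM, ℝ)`. -/
abbrev CotangentMinusZero [IsManifold (𝓡 m) ∞ M] : Type _ :=
  {q : TotalSpace (EuclideanSpace ℝ (Fin m) →L[ℝ] ℝ)
    (fun p : M ↦ TangentSpace (𝓡 m) p →L[ℝ] ℝ) // q.2 ≠ 0}

/-- `L ⊆ T*M ∖ 0` is conic: `(p, ξ) ∈ L` implies `(p, t ξ) ∈ L` for all `t > 0`. -/
def IsConicSet [IsManifold (𝓡 m) ∞ M] (L : Set (CotangentMinusZero m M)) : Prop :=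
  ∀ q ∈ L, ∀ (t : ℝ) (ht : 0 < t),
    (⟨⟨q.1.1, t • q.1.2⟩, smul_ne_zero ht.ne' q.2⟩ : CotangentMinusZero m M) ∈ L

/-- The coordinate vector field `∂/∂xⁱ` of the chart `x` at `p`. -/
noncomputable def coordVec (x : OpenPartialHomeomorph M (EuclideanSpace ℝ (Fin m))) (p : M)
    (i : Fin m) : TangentSpace (𝓡 m) p :=
  mfderiv (𝓡 m) (𝓡 m) x.symm (x p) (EuclideanSpace.single i (1 : ℝ))

/-- The coordinates `(ξ₁, …, ξₘ)` of a covector `ξ = ∑ ξⱼ dxʲ|ₚ` in the chart `x`. -/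
noncomputable def covectorCoords (x : OpenPartialHomeomorph M (EuclideanSpace ℝ (Fin m))) {p : M}
    (ξ : TangentSpace (𝓡 m) p →L[ℝ] ℝ) : EuclideanSpace ℝ (Fin m) :=
  WithLp.toLp 2 fun i ↦ ξ (coordVec x p i)

/-! ### Densities -/

variable (m) in
/-- The complex `1`-densities on an `m`-dimensional real vector space `V`. -/
def densitySpace (V : Type*) [AddCommGroup V] [Module ℝ V] : Submodule ℂ ((Fin m → V) → ℂ) where
  carrier := {δ | ∀ (A : V →ₗ[ℝ] V) (v : Fin m → V),
    δ (fun i ↦ A (v i)) = ((|LinearMap.det A| : ℝ) : ℂ) * δ v}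
  add_mem' := fun ha hb A v ↦ by
    rw [Pi.add_apply, Pi.add_apply, ha A v, hb A v, mul_add]
  zero_mem' := fun A v ↦ by simp
  smul_mem' := fun c a ha A v ↦ by
    rw [Pi.smul_apply, Pi.smul_apply, ha A v, smul_eq_mul, smul_eq_mul, mul_left_comm]

/-- The density `λˣ` of the chart `x` at a point `p` of its domain; it takes the value `1` on
`(∂/∂x¹, …, ∂/∂xᵐ)`, see `chartDensity_coordVec`. -/
noncomputable def chartDensity (x : OpenPartialHomeomorph M (EuclideanSpace ℝ (Fin m))) (p : M) :
    densitySpace m (TangentSpace (𝓡 m) p) :=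
  ⟨fun v ↦ ((|(EuclideanSpace.basisFun (Fin m) ℝ).toBasis.det
      (fun l ↦ (mfderiv (𝓡 m) (𝓡 m) x p (v l) : EuclideanSpace ℝ (Fin m)))| : ℝ) : ℂ), by
    intro A v
    let b := (EuclideanSpace.basisFun (Fin m) ℝ).toBasis
    let D : EuclideanSpace ℝ (Fin m) →ₗ[ℝ] EuclideanSpace ℝ (Fin m) :=
      (mfderiv (𝓡 m) (𝓡 m) x p).toLinearMap
    let A' : EuclideanSpace ℝ (Fin m) →ₗ[ℝ] EuclideanSpace ℝ (Fin m) := A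
    let v' : Fin m → EuclideanSpace ℝ (Fin m) := v
    have h1 : b.det (D ∘ (A' ∘ v')) = LinearMap.det D * (LinearMap.det A' * b.det v') := by
      rw [Module.Basis.det_comp, Module.Basis.det_comp]
    have h2 : b.det (D ∘ v') = LinearMap.det D * b.det v' := by
      rw [Module.Basis.det_comp]
    change ((|b.det (D ∘ (A' ∘ v'))| : ℝ) : ℂ) =
      ((|LinearMap.det A'| : ℝ) : ℂ) * ((|b.det (D ∘ v')| : ℝ) : ℂ)
    rw [h1, h2, ← Complex.ofReal_mul, ← abs_mul]
    congr 2
    ring⟩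

/-! ### Bundle charts, test sections, distributional sections -/

variable (m) (k : ℕ) (E : M → Type*) [TopologicalSpace (TotalSpace (Fin k → ℂ) E)]
  [∀ p, AddCommGroup (E p)] [∀ p, Module ℂ (E p)] [∀ p, TopologicalSpace (E p)]
  [FiberBundle (Fin k → ℂ) E]

/-- A smooth chart `(O, x)` of `M` together with a smooth complex linear local trivialisation
`Φ : π⁻¹(O) → O × ℂᵏ` of `E` over `O` (given as the restriction of a trivialisation over a set
that contains `O`). -/
structure BundleChart where
  chart : OpenPartialHomeomorph M (EuclideanSpace ℝ (Fin m))
  chart_mem : chart ∈ IsManifold.maximalAtlas (𝓡 m) ∞ M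
  triv : Trivialization (Fin k → ℂ) (π (Fin k → ℂ) E)
  isLinear : triv.IsLinear ℂ
  contMDiffOn_triv : ContMDiffOn ((𝓡 m).prod 𝓘(ℝ, Fin k → ℂ)) ((𝓡 m).prod 𝓘(ℝ, Fin k → ℂ)) ∞
    triv triv.source
  contMDiffOn_symm : ContMDiffOn ((𝓡 m).prod 𝓘(ℝ, Fin k → ℂ)) ((𝓡 m).prod 𝓘(ℝ, Fin k → ℂ)) ∞
    triv.toOpenPartialHomeomorph.symm triv.target
  source_subset : chart.source ⊆ triv.baseSet

variable {m k E}

/-- The open set `x(O) ⊆ ℝᵐ`. -/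
def BundleChart.Ω (Φ : BundleChart m k E) : TopologicalSpace.Opens (EuclideanSpace ℝ (Fin m)) :=
  ⟨Φ.chart.target, Φ.chart.open_target⟩

variable (m E) in
/-- The space of all (not necessarily continuous) sections of `E^∨ = L(E, DM)`. -/
def DualSection : Type _ := ∀ p : M, E p →ₗ[ℂ] densitySpace m (TangentSpace (𝓡 m) p)

noncomputable instance : AddCommGroup (DualSection m E) :=
  inferInstanceAs (AddCommGroup (∀ p : M, E p →ₗ[ℂ] densitySpace m (TangentSpace (𝓡 m) p)))

noncomputable instance : Module ℂ (DualSection m E) :=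
  inferInstanceAs (Module ℂ (∀ p : M, E p →ₗ[ℂ] densitySpace m (TangentSpace (𝓡 m) p)))

/-- The `j`-th component of a section `s` of `E^∨` in a bundle chart, read in the chart:
`s_p (Φ_p⁻¹ e_j) (∂/∂x¹, …, ∂/∂xᵐ)` at `p = x⁻¹(y)`. -/
noncomputable def BundleChart.component (Φ : BundleChart m k E) (s : DualSection m E)
    (j : Fin k) : EuclideanSpace ℝ (Fin m) → ℂ := fun y ↦
  (s (Φ.chart.symm y) (Φ.triv.symm (Φ.chart.symm y) (Pi.single j 1)) :
    (Fin m → TangentSpace (𝓡 m) (Φ.chart.symm y)) → ℂ)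
    (coordVec Φ.chart (Φ.chart.symm y))

variable (m k E)

/-- `Γ_c(E^∨)` as a space of sections: the sections of `E^∨ = L(E, DM)` that are smooth (that is,
their components in all bundle charts are) and vanish outside of a compact set. -/
def testSectionSubmodule : Submodule ℂ (DualSection m E) where
  carrier := {s | (∀ (Φ : BundleChart m k E) (j : Fin k),
      ContDiffOn ℝ ∞ (Φ.component s j) Φ.chart.target) ∧
    ∃ K : Set M, IsCompact K ∧ ∀ p ∉ K, s p = 0}
  add_mem' := by
    rintro s t ⟨hs, K, hK, hsK⟩ ⟨ht, K', hK', htK⟩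
    refine ⟨fun Φ j ↦ (hs Φ j).add (ht Φ j), K ∪ K', hK.union hK', fun p hp ↦ ?_⟩
    rw [mem_union, not_or] at hp
    change s p + t p = 0
    rw [hsK p hp.1, htK p hp.2, add_zero]
  zero_mem' := ⟨fun Φ j ↦ contDiffOn_const (c := 0), ∅, isCompact_empty, fun _ _ ↦ rfl⟩
  smul_mem' := by
    rintro c s ⟨hs, K, hK, hsK⟩
    refine ⟨fun Φ j ↦ (hs Φ j).const_smul c, K, hK, fun p hp ↦ ?_⟩
    change c • s p = 0
    rw [hsK p hp, smul_zero]

/-- The space `Γ_c(E^∨)` of compactly supported smooth sections of `E^∨ = L(E, DM)`. -/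
def TestSection : Type _ := testSectionSubmodule m k E

noncomputable instance : AddCommGroup (TestSection m k E) :=
  inferInstanceAs (AddCommGroup (testSectionSubmodule m k E))

noncomputable instance : Module ℂ (TestSection m k E) :=
  inferInstanceAs (Module ℂ (testSectionSubmodule m k E))

variable {m k E}

/-- `Γ_K(E^∨)`, the test sections supported in `K`. -/
def TestSection.supportedIn (K : Set M) : Set (TestSection m k E) := {s | ∀ p ∉ K, s.1 p = 0}

variable (m k E) in
/-- An index for one of the seminorms that define the topology of `Γ_K(E^∨)`: a bundle chart, a
compact subset of the image of the chart, and an order of differentiation. -/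
structure DerivIndex where
  Φ : BundleChart m k E
  C : Set (EuclideanSpace ℝ (Fin m))
  isCompact_C : IsCompact C
  C_subset : C ⊆ Φ.chart.target
  n : ℕ

/-- The supremum over `C` and over all components of the `n`-th derivative of a test section in a
bundle chart. -/
noncomputable def DerivIndex.supNorm (ι : DerivIndex m k E) (s : TestSection m k E) : ℝ≥0∞ :=
  ⨆ (j : Fin k) (y ∈ ι.C), ‖iteratedFDeriv ℝ ι.n (ι.Φ.component s.1 j) y‖ₑ

/-- The restriction of the seminorm `q` to each of the Fréchet spaces `Γ_K(E^∨)`, `K ⊆ M` compact,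
is continuous. -/
def IsLFSeminorm (q : Seminorm ℂ (TestSection m k E)) : Prop :=
  ∀ K : Set M, IsCompact K → ∃ (S : Finset (DerivIndex m k E)) (A : ℝ≥0),
    ∀ s ∈ TestSection.supportedIn K, ENNReal.ofReal (q s) ≤ A * ⨆ ι ∈ S, ι.supNorm s

variable (m k E) in
/-- The family of all seminorms on `Γ_c(E^∨)` whose restrictions to all `Γ_K(E^∨)` are
continuous. -/
def lfSeminorms : SeminormFamily ℂ (TestSection m k E)
    {q : Seminorm ℂ (TestSection m k E) // IsLFSeminorm q} := fun q ↦ q.1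

instance : Nonempty {q : Seminorm ℂ (TestSection m k E) // IsLFSeminorm q} :=
  ⟨⟨0, fun _ _ ↦ ⟨∅, 0, fun s _ ↦ by simp⟩⟩⟩

/-- The `(LF)`-topology of `Γ_c(E^∨)`, the locally convex inductive limit of the spaces
`Γ_K(E^∨)`: the locally convex topology that is given by all seminorms whose restrictions to all
`Γ_K(E^∨)` are continuous. -/
noncomputable instance : TopologicalSpace (TestSection m k E) :=
  (lfSeminorms m k E).moduleFilterBasis.topology

theorem TestSection.withSeminorms : WithSeminorms (lfSeminorms m k E) := ⟨rfl⟩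

variable (m k E) in
/-- `D'(M; E)`, the dual of `Γ_c(E^∨)`. Its topology is the strong one: Mathlib's topology on
continuous linear maps is that of uniform convergence on bounded sets. -/
abbrev DistSection : Type _ := TestSection m k E →L[ℂ] ℂ

/-! ### Localisation of distributional sections in bundle charts -/

instance (Φ : BundleChart m k E) : Φ.triv.IsLinear ℂ := Φ.isLinear

open Classical in
/-- For `φ ∈ D(x(O))` the section `(φ ∘ x) σʲ` of `E^∨`, where `σʲ = λˣ ∘ εʲ ∘ Φ` is the `j`-th
member of the frame of `E^∨` over `O` that is induced by the bundle chart (extended by zero). -/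
noncomputable def BundleChart.localSectionFun (Φ : BundleChart m k E) (j : Fin k)
    (φ : TestFunction Φ.Ω ℂ ⊤) : DualSection m E := fun p ↦
  if p ∈ Φ.chart.source then
    φ (Φ.chart p) • ((LinearMap.proj j : (Fin k → ℂ) →ₗ[ℂ] ℂ) ∘ₗ
      Φ.triv.linearMapAt ℂ p).smulRight (chartDensity Φ.chart p)
  else 0

theorem contDiffAt_coordChange {x x' : OpenPartialHomeomorph M (EuclideanSpace ℝ (Fin m))}
    (hx : x ∈ IsManifold.maximalAtlas (𝓡 m) ∞ M) (hx' : x' ∈ IsManifold.maximalAtlas (𝓡 m) ∞ M)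
    {y : EuclideanSpace ℝ (Fin m)} (hy : y ∈ x'.target) (hp : x'.symm y ∈ x.source) :
    ContDiffAt ℝ ∞ (x ∘ x'.symm) y := by
  rw [← contMDiffAt_iff_contDiffAt]
  exact (contMDiffAt_of_mem_maximalAtlas hx hp).comp y
    (contMDiffAt_symm_of_mem_maximalAtlas hx' hy)

theorem mfderiv_coordVec {x x' : OpenPartialHomeomorph M (EuclideanSpace ℝ (Fin m))}
    (hx : x ∈ IsManifold.maximalAtlas (𝓡 m) ∞ M) (hx' : x' ∈ IsManifold.maximalAtlas (𝓡 m) ∞ M)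
    {y : EuclideanSpace ℝ (Fin m)} (hy : y ∈ x'.target) (hp : x'.symm y ∈ x.source) (i : Fin m) :
    (mfderiv (𝓡 m) (𝓡 m) x (x'.symm y) (coordVec x' (x'.symm y) i) : EuclideanSpace ℝ (Fin m)) =
      fderiv ℝ (x ∘ x'.symm) y (EuclideanSpace.single i (1 : ℝ)) := by
  have h1 : MDifferentiableAt (𝓡 m) (𝓡 m) x (x'.symm y) :=
    (contMDiffAt_of_mem_maximalAtlas hx hp).mdifferentiableAt (by simp)
  have h2 : MDifferentiableAt (𝓡 m) (𝓡 m) x'.symm y :=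
    (contMDiffAt_symm_of_mem_maximalAtlas hx' hy).mdifferentiableAt (by simp)
  have h3 := mfderiv_comp y h1 h2
  rw [mfderiv_eq_fderiv] at h3
  rw [h3]
  unfold coordVec
  rw [x'.right_inv hy]
  rfl

/-- The value of `λˣ` on the coordinate frame of the chart `x'` is the absolute value of the
Jacobian determinant of `x ∘ x'⁻¹`. -/
theorem chartDensity_coordVec' {x x' : OpenPartialHomeomorph M (EuclideanSpace ℝ (Fin m))}
    (hx : x ∈ IsManifold.maximalAtlas (𝓡 m) ∞ M) (hx' : x' ∈ IsManifold.maximalAtlas (𝓡 m) ∞ M)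
    {y : EuclideanSpace ℝ (Fin m)} (hy : y ∈ x'.target) (hp : x'.symm y ∈ x.source) :
    (chartDensity x (x'.symm y)).1 (coordVec x' (x'.symm y)) =
      ((|LinearMap.det (fderiv ℝ (x ∘ x'.symm) y).toLinearMap| : ℝ) : ℂ) := by
  let b := (EuclideanSpace.basisFun (Fin m) ℝ).toBasis
  change ((|b.det (fun l ↦ (mfderiv (𝓡 m) (𝓡 m) x (x'.symm y) (coordVec x' (x'.symm y) l) :
    EuclideanSpace ℝ (Fin m)))| : ℝ) : ℂ) = _
  have h : (fun l ↦ (mfderiv (𝓡 m) (𝓡 m) x (x'.symm y) (coordVec x' (x'.symm y) l) :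
      EuclideanSpace ℝ (Fin m))) = (fderiv ℝ (x ∘ x'.symm) y).toLinearMap ∘ b := by
    funext l
    rw [mfderiv_coordVec hx hx' hy hp]
    simp only [b, Function.comp, OrthonormalBasis.coe_toBasis, EuclideanSpace.basisFun_apply]
    rfl
  rw [h, Module.Basis.det_comp, Module.Basis.det_self, mul_one]

theorem chartDensity_coordVec {x : OpenPartialHomeomorph M (EuclideanSpace ℝ (Fin m))}
    (hx : x ∈ IsManifold.maximalAtlas (𝓡 m) ∞ M) {p : M} (hp : p ∈ x.source) :
    (chartDensity x p).1 (coordVec x p) = 1 := by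
  have hy := x.map_source hp
  have hp' : x.symm (x p) ∈ x.source := by rwa [x.left_inv hp]
  have h := chartDensity_coordVec' hx hx hy hp'
  rw [x.left_inv hp] at h
  rw [h]
  have h2 : x ∘ x.symm =ᶠ[𝓝 (x p)] id := by
    filter_upwards [x.open_target.mem_nhds hy] with z hz
    exact x.right_inv hz
  rw [h2.fderiv_eq, fderiv_id]
  change ((|LinearMap.det (LinearMap.id : EuclideanSpace ℝ (Fin m) →ₗ[ℝ] _)| : ℝ) : ℂ) = 1
  simp

theorem det_fderiv_coordChange_ne_zero
    {x x' : OpenPartialHomeomorph M (EuclideanSpace ℝ (Fin m))}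
    (hx : x ∈ IsManifold.maximalAtlas (𝓡 m) ∞ M) (hx' : x' ∈ IsManifold.maximalAtlas (𝓡 m) ∞ M)
    {y : EuclideanSpace ℝ (Fin m)} (hy : y ∈ x'.target) (hp : x'.symm y ∈ x.source) :
    LinearMap.det (fderiv ℝ (x ∘ x'.symm) y).toLinearMap ≠ 0 := by
  have hz : x (x'.symm y) ∈ x.target := x.map_source hp
  have hz' : x.symm (x (x'.symm y)) ∈ x'.source := by
    rw [x.left_inv hp]; exact x'.map_target hy
  have h1 := (contDiffAt_coordChange hx hx' hy hp).differentiableAt (by simp)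
  have h2 := (contDiffAt_coordChange hx' hx hz hz').differentiableAt (by simp)
  have h3 : (x' ∘ x.symm) ∘ (x ∘ x'.symm) =ᶠ[𝓝 y] id := by
    have hc : ContinuousAt x'.symm y := x'.continuousAt_symm hy
    filter_upwards [x'.open_target.mem_nhds hy, hc (x.open_source.mem_nhds hp)] with w hw hw'
    change x' (x.symm (x (x'.symm w))) = w
    rw [x.left_inv hw', x'.right_inv hw]
  have h4 := fderiv_comp y (g := x' ∘ x.symm) (f := x ∘ x'.symm) h2 h1
  rw [h3.fderiv_eq, fderiv_id] at h4
  intro h0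
  have h5 := congrArg (fun f : EuclideanSpace ℝ (Fin m) →L[ℝ] EuclideanSpace ℝ (Fin m) ↦
    LinearMap.det f.toLinearMap) h4
  simp only [ContinuousLinearMap.toLinearMap_comp, LinearMap.det_comp] at h5
  rw [h0, mul_zero] at h5
  change LinearMap.det (LinearMap.id : EuclideanSpace ℝ (Fin m) →ₗ[ℝ] _) = 0 at h5
  simp at h5

theorem contDiffAt_abs_det_coordChange
    {x x' : OpenPartialHomeomorph M (EuclideanSpace ℝ (Fin m))}
    (hx : x ∈ IsManifold.maximalAtlas (𝓡 m) ∞ M) (hx' : x' ∈ IsManifold.maximalAtlas (𝓡 m) ∞ M)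
    {y : EuclideanSpace ℝ (Fin m)} (hy : y ∈ x'.target) (hp : x'.symm y ∈ x.source) :
    ContDiffAt ℝ ∞
      (fun z ↦ ((|LinearMap.det (fderiv ℝ (x ∘ x'.symm) z).toLinearMap| : ℝ) : ℂ)) y := by
  have h1 : ContDiffAt ℝ ∞ (fderiv ℝ (x ∘ x'.symm)) y :=
    (contDiffAt_coordChange hx hx' hy hp).fderiv_right (m := ∞) (by simp)
  have h2 : ContDiffAt ℝ ∞
      (fun z ↦ LinearMap.det (fderiv ℝ (x ∘ x'.symm) z).toLinearMap) y := by
    let b := (EuclideanSpace.basisFun (Fin m) ℝ).toBasis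
    have h3 : (fun z ↦ LinearMap.det (fderiv ℝ (x ∘ x'.symm) z).toLinearMap) =
        fun z ↦ ∑ σ : Equiv.Perm (Fin m), ((Equiv.Perm.sign σ : ℤ) : ℝ) *
          ∏ i, (fderiv ℝ (x ∘ x'.symm) z (b i)).ofLp (σ i) := by
      funext z
      rw [← LinearMap.det_toMatrix b, Matrix.det_apply']
      simp [LinearMap.toMatrix_apply, b]
    rw [h3]
    refine ContDiffAt.sum fun σ _ ↦ contDiffAt_const.mul (contDiffAt_prod fun i _ ↦ ?_)
    exact (EuclideanSpace.proj (𝕜 := ℝ) (σ i)).contDiff.contDiffAt.comp y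
      (h1.clm_apply contDiffAt_const)
  exact Complex.ofRealCLM.contDiff.contDiffAt.comp y
    (h2.abs (det_fderiv_coordChange_ne_zero hx hx' hy hp))

theorem contDiffAt_transition (Φ Φ' : BundleChart m k E) (j j' : Fin k)
    {y : EuclideanSpace ℝ (Fin m)} (hy : y ∈ Φ'.chart.target)
    (hp : Φ'.chart.symm y ∈ Φ.chart.source) :
    ContDiffAt ℝ ∞ (fun z ↦ Φ.triv.linearMapAt ℂ (Φ'.chart.symm z)
      (Φ'.triv.symm (Φ'.chart.symm z) (Pi.single j' 1)) j) y := by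
  rw [← contMDiffAt_iff_contDiffAt]
  have hb : Φ'.chart.symm y ∈ Φ'.triv.baseSet := Φ'.source_subset (Φ'.chart.map_target hy)
  have hb' : Φ'.chart.symm y ∈ Φ.triv.baseSet := Φ.source_subset hp
  have hc : ContinuousAt Φ'.chart.symm y := Φ'.chart.continuousAt_symm hy
  let c : Fin k → ℂ := Pi.single j' 1
  have h1 : ContMDiffAt (𝓡 m) ((𝓡 m).prod 𝓘(ℝ, Fin k → ℂ)) ∞
      (fun z ↦ (Φ'.chart.symm z, c)) y :=
    (contMDiffAt_symm_of_mem_maximalAtlas Φ'.chart_mem hy).prodMk contMDiffAt_const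
  have ht : (Φ'.chart.symm y, c) ∈ Φ'.triv.target := Φ'.triv.mem_target.2 hb
  have h2 : ContMDiffAt ((𝓡 m).prod 𝓘(ℝ, Fin k → ℂ)) ((𝓡 m).prod 𝓘(ℝ, Fin k → ℂ)) ∞
      Φ'.triv.toOpenPartialHomeomorph.symm (Φ'.chart.symm y, c) :=
    Φ'.contMDiffOn_symm.contMDiffAt (Φ'.triv.open_target.mem_nhds ht)
  have h3 : ContMDiffAt ((𝓡 m).prod 𝓘(ℝ, Fin k → ℂ)) ((𝓡 m).prod 𝓘(ℝ, Fin k → ℂ)) ∞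
      Φ.triv (Φ'.triv.toOpenPartialHomeomorph.symm (Φ'.chart.symm y, c)) := by
    refine Φ.contMDiffOn_triv.contMDiffAt (Φ.triv.open_source.mem_nhds ?_)
    rw [Φ.triv.mem_source, Φ'.triv.proj_symm_apply ht]
    exact hb'
  have h4 := h3.comp y (h2.comp y h1)
  have h5 : ContMDiffAt (𝓡 m) 𝓘(ℝ, Fin k → ℂ) ∞ (fun z ↦
      (Φ.triv (Φ'.triv.toOpenPartialHomeomorph.symm (Φ'.chart.symm z, c))).2) y :=
    contMDiffAt_snd.comp y h4
  have h6 : ContMDiffAt (𝓡 m) 𝓘(ℝ, ℂ) ∞ (fun z ↦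
      (Φ.triv (Φ'.triv.toOpenPartialHomeomorph.symm (Φ'.chart.symm z, c))).2 j) y :=
    (ContinuousLinearMap.proj (R := ℝ) (φ := fun _ : Fin k ↦ ℂ) j).contMDiff.contMDiffAt.comp y h5
  refine h6.congr_of_eventuallyEq ?_
  filter_upwards [hc (Φ'.triv.open_baseSet.mem_nhds hb),
    hc (Φ.triv.open_baseSet.mem_nhds hb')] with z hz hz'
  rw [Trivialization.coe_linearMapAt_of_mem _ hz']
  change (Φ.triv ⟨_, Φ'.triv.symm (Φ'.chart.symm z) c⟩).2 j = _
  rw [← Φ'.triv.mk_symm hz]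

variable [T2Space M]

theorem BundleChart.localSectionFun_mem (Φ : BundleChart m k E) (j : Fin k)
    (φ : TestFunction Φ.Ω ℂ ⊤) : Φ.localSectionFun j φ ∈ testSectionSubmodule m k E := by
  let K : Set M := Φ.chart.symm '' tsupport φ
  have hφ : tsupport φ ⊆ Φ.chart.target := φ.tsupport_subset
  have hK : IsCompact K := φ.hasCompactSupport.isCompact.image_of_continuousOn
    (Φ.chart.continuousOn_symm.mono hφ)
  have h0 : ∀ p ∉ K, Φ.localSectionFun j φ p = 0 := by
    intro p hp
    unfold BundleChart.localSectionFun
    split_ifs with h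
    · rw [image_eq_zero_of_notMem_tsupport (f := φ), zero_smul]
      exact fun h' ↦ hp ⟨_, h', Φ.chart.left_inv h⟩
    · rfl
  refine ⟨fun Φ' j' y hy ↦ ContDiffAt.contDiffWithinAt ?_, K, hK, h0⟩
  have hc : ContinuousAt Φ'.chart.symm y := Φ'.chart.continuousAt_symm hy
  by_cases hp : Φ'.chart.symm y ∈ Φ.chart.source
  · have h1 : Φ'.component (Φ.localSectionFun j φ) j' =ᶠ[𝓝 y] fun z ↦
        φ ((Φ.chart ∘ Φ'.chart.symm) z) * (Φ.triv.linearMapAt ℂ (Φ'.chart.symm z)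
          (Φ'.triv.symm (Φ'.chart.symm z) (Pi.single j' 1)) j *
        ((|LinearMap.det (fderiv ℝ (Φ.chart ∘ Φ'.chart.symm) z).toLinearMap| : ℝ) : ℂ)) := by
      filter_upwards [Φ'.chart.open_target.mem_nhds hy,
        hc (Φ.chart.open_source.mem_nhds hp)] with z hz hz'
      rw [← chartDensity_coordVec' Φ.chart_mem Φ'.chart_mem hz hz']
      unfold BundleChart.component BundleChart.localSectionFun
      rw [if_pos (show Φ'.chart.symm z ∈ Φ.chart.source from hz')]
      rfl
    refine ContDiffAt.congr_of_eventuallyEq ?_ h1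
    refine ContDiffAt.mul ?_ (ContDiffAt.mul (contDiffAt_transition Φ Φ' j j' hy hp)
      (contDiffAt_abs_det_coordChange Φ.chart_mem Φ'.chart_mem hy hp))
    exact φ.contDiff.contDiffAt.comp y (contDiffAt_coordChange Φ.chart_mem Φ'.chart_mem hy hp)
  · have hpK : Φ'.chart.symm y ∉ K := by
      rintro ⟨z, hz, hz'⟩
      exact hp (hz' ▸ Φ.chart.map_target (hφ hz))
    refine ContDiffAt.congr_of_eventuallyEq (contDiffAt_const (c := 0)) ?_
    filter_upwards [hc (hK.isClosed.isOpen_compl.mem_nhds hpK)] with z hz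
    unfold BundleChart.component
    rw [h0 _ hz]
    rfl

/-- The linear map `φ ↦ (φ ∘ x) σʲ` from `D(x(O))` to `Γ_c(E^∨)`. -/
noncomputable def BundleChart.localSection
    (Φ : BundleChart m k E) (j : Fin k) :
    TestFunction Φ.Ω ℂ ⊤ →ₗ[ℂ] TestSection m k E where
  toFun φ := ⟨Φ.localSectionFun j φ, Φ.localSectionFun_mem j φ⟩
  map_add' φ ψ := Subtype.ext <| funext fun p ↦ by
    change Φ.localSectionFun j (φ + ψ) p = Φ.localSectionFun j φ p + Φ.localSectionFun j ψ p
    unfold BundleChart.localSectionFun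
    split_ifs
    · rw [← add_smul]; rfl
    · rw [add_zero]
  map_smul' c φ := Subtype.ext <| funext fun p ↦ by
    change Φ.localSectionFun j (c • φ) p = c • Φ.localSectionFun j φ p
    unfold BundleChart.localSectionFun
    split_ifs
    · rw [smul_smul]; rfl
    · rw [smul_zero]

/-- The `j`-th local representative `u_Φʲ` of `u ∈ D'(M; E)` in a bundle chart, as a linear form on
`D(x(O))`: `⟨u_Φʲ, φ⟩ = ⟨u, (φ ∘ x) σʲ⟩`. -/
noncomputable def DistSection.localize (u : DistSection m k E) (Φ : BundleChart m k E)
    (j : Fin k) : TestFunction Φ.Ω ℂ ⊤ →ₗ[ℂ] ℂ :=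
  u.toLinearMap ∘ₗ Φ.localSection j

end

/-! ### Microlocal notions on open subsets of `ℝᵐ` -/

section

variable {m : ℕ} {Ω : TopologicalSpace.Opens (EuclideanSpace ℝ (Fin m))}

/-- `V ⊆ ℝᵐ` is a cone. -/
def IsConeSet (V : Set (EuclideanSpace ℝ (Fin m))) : Prop :=
  ∀ ξ ∈ V, ∀ t : ℝ, 0 < t → t • ξ ∈ V

/-- The test function `x ↦ e^{-i x·ξ} φ(x)`. -/
noncomputable def modulate (φ : TestFunction Ω ℂ ⊤) (ξ : EuclideanSpace ℝ (Fin m)) :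
    TestFunction Ω ℂ ⊤ where
  toFun x := Complex.exp (-(Complex.I * ((inner ℝ x ξ : ℝ) : ℂ))) * φ x
  contDiff' := by
    refine ContDiff.mul ?_ φ.contDiff
    refine (contDiff_const.mul ?_).neg.cexp
    exact Complex.ofRealCLM.contDiff.comp (contDiff_id.inner ℝ contDiff_const)
  hasCompactSupport' := φ.hasCompactSupport.mul_left
  tsupport_subset' := (tsupport_mul_subset_right).trans φ.tsupport_subset

/-- The Fourier transform `ξ ↦ F(φT)(ξ) = ⟨T, e^{-i ⟨·, ξ⟩} φ⟩` of the compactly supported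
distribution `φT`. -/
noncomputable def localFourier (T : TestFunction Ω ℂ ⊤ →ₗ[ℂ] ℂ) (φ : TestFunction Ω ℂ ⊤) :
    EuclideanSpace ℝ (Fin m) → ℂ := fun ξ ↦ T (modulate φ ξ)

/-- `∫_V |f(ξ)|² ⟨ξ⟩^{2r} dξ`, where `⟨ξ⟩ = (1 + |ξ|²)^{1/2}`. -/
noncomputable def weightedEnergy (r : ℝ) (V : Set (EuclideanSpace ℝ (Fin m)))
    (f : EuclideanSpace ℝ (Fin m) → ℂ) : ℝ≥0∞ :=
  ∫⁻ ξ in V, ENNReal.ofReal (‖f ξ‖ ^ 2 * (1 + ‖ξ‖ ^ 2) ^ r)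

/-- `Σ^r_c` of a set of compactly supported distributions, in terms of the set `G` of their Fourier
transforms: `η ≠ 0` is not in it if there is an open cone `V ⊆ ℝᵐ ∖ {0}` that contains `η` with
`sup_{f ∈ G} ∫_{V, |ξ| > R} |f(ξ)|² ⟨ξ⟩^{2r} dξ → 0` as `R → ∞`. -/
def sigmaCompact (r : ℝ) (G : Set (EuclideanSpace ℝ (Fin m) → ℂ)) :
    Set (EuclideanSpace ℝ (Fin m)) :=
  {η | η ≠ 0 ∧ ¬ ∃ V : Set (EuclideanSpace ℝ (Fin m)), IsOpen V ∧ IsConeSet V ∧ 0 ∉ V ∧ η ∈ V ∧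
    Tendsto (fun R : ℝ ↦ ⨆ f ∈ G, weightedEnergy r (V ∩ {ξ | R < ‖ξ‖}) f) atTop (𝓝 0)}

/-- `Σ^r_{c,x}(B)`, the intersection of all `Σ^r_c(φB)` with `φ ∈ D(Ω)`, `φ(x) ≠ 0`. -/
def sigmaCompactAt (r : ℝ) (B : Set (TestFunction Ω ℂ ⊤ →ₗ[ℂ] ℂ))
    (x : EuclideanSpace ℝ (Fin m)) : Set (EuclideanSpace ℝ (Fin m)) :=
  ⋂ (φ : TestFunction Ω ℂ ⊤) (_ : φ x ≠ 0), sigmaCompact r ((fun T ↦ localFourier T φ) '' B)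

/-- `Σ^r_x(T)`, the fibre at `x` of the Sobolev wave front set of order `r` of `T`: `η ≠ 0` is not
in it if there are an open cone `V` that contains `η` and `φ ∈ D(Ω)` with `φ(x) ≠ 0` such that
`⟨·⟩^r F(φT)` is in `L²(V)`. -/
def sigmaAt (r : ℝ) (T : TestFunction Ω ℂ ⊤ →ₗ[ℂ] ℂ) (x : EuclideanSpace ℝ (Fin m)) :
    Set (EuclideanSpace ℝ (Fin m)) :=
  {η | η ≠ 0 ∧ ¬ ∃ (V : Set (EuclideanSpace ℝ (Fin m))) (φ : TestFunction Ω ℂ ⊤),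
    IsOpen V ∧ IsConeSet V ∧ η ∈ V ∧ φ x ≠ 0 ∧ weightedEnergy r V (localFourier T φ) < (⊤ : ℝ≥0∞)}

end

/-! ### Wave front sets on manifolds and the space `D'^r_L(M; E)` -/

section

variable {m : ℕ} {M : Type*} [TopologicalSpace M] [ChartedSpace (EuclideanSpace ℝ (Fin m)) M]
  [IsManifold (𝓡 m) ∞ M] [T2Space M]
  {k : ℕ} {E : M → Type*} [TopologicalSpace (TotalSpace (Fin k → ℂ) E)]
  [∀ p, AddCommGroup (E p)] [∀ p, Module ℂ (E p)] [∀ p, TopologicalSpace (E p)]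
  [FiberBundle (Fin k → ℂ) E]

/-- The Sobolev compactness wave front set `WF^r_c(B)` of order `r` of `B ⊆ D'(M; E)`: the set of
all `(p, ξ) ∈ T*M ∖ 0` such that in a bundle chart about `p` the coordinates of `ξ` belong to
`⋃ⱼ Σ^r_{c,x(p)}(B_Φʲ)`. (This condition does not depend on the bundle chart about `p`.) -/
def WFc (r : ℝ) (B : Set (DistSection m k E)) : Set (CotangentMinusZero m M) :=
  {q | ∃ Φ : BundleChart m k E, q.1.1 ∈ Φ.chart.source ∧
    covectorCoords Φ.chart q.1.2 ∈
      ⋃ j : Fin k, sigmaCompactAt r ((fun u ↦ u.localize Φ j) '' B) (Φ.chart q.1.1)}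

/-- The Sobolev wave front set `WF^r(u)` of order `r` of `u ∈ D'(M; E)`: the set of all
`(p, ξ) ∈ T*M ∖ 0` such that in a bundle chart about `p` the coordinates of `ξ` belong to
`⋃ⱼ Σ^r_{x(p)}(u_Φʲ)`. (This condition does not depend on the bundle chart about `p`.) -/
def WF (r : ℝ) (u : DistSection m k E) : Set (CotangentMinusZero m M) :=
  {q | ∃ Φ : BundleChart m k E, q.1.1 ∈ Φ.chart.source ∧
    covectorCoords Φ.chart q.1.2 ∈ ⋃ j : Fin k, sigmaAt r (u.localize Φ j) (Φ.chart q.1.1)}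

/-- The seminorm `u ↦ max_j (∫_V |F((φ ∘ x⁻¹) u_Φʲ)(ξ)|² ⟨ξ⟩^{2r} dξ)^{1/2}`. The test function `φ`
on `O` is given by its coordinate expression on `x(O)`. -/
noncomputable def sobolevSeminorm (r : ℝ) (Φ : BundleChart m k E) (φ : TestFunction Φ.Ω ℂ ⊤)
    (V : Set (EuclideanSpace ℝ (Fin m))) (u : DistSection m k E) : ℝ≥0∞ :=
  ⨆ j : Fin k, weightedEnergy r V (localFourier (u.localize Φ j) φ) ^ (1 / 2 : ℝ)

/-- `{(p, ξⱼ dxʲ|ₚ) | p ∈ supp φ, (ξ₁, …, ξₘ) ∈ V} ∩ L = ∅`. -/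
def SupportConeDisjoint (Φ : BundleChart m k E) (φ : TestFunction Φ.Ω ℂ ⊤)
    (V : Set (EuclideanSpace ℝ (Fin m))) (L : Set (CotangentMinusZero m M)) : Prop :=
  ∀ q ∈ L, q.1.1 ∈ Φ.chart.source → Φ.chart q.1.1 ∈ tsupport φ →
    covectorCoords Φ.chart q.1.2 ∉ V

variable (k E) in
/-- `D'^r_L(M; E)`, the space of all `u ∈ D'(M; E)` with `WF^r(u) ⊆ L`. -/
def SobolevDist (r : ℝ) (L : Set (CotangentMinusZero m M)) : Type _ :=
  {u : DistSection m k E // WF r u ⊆ L}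

/-- The topology of `D'^r_L(M; E)`: it is generated by the topology induced by `D'(M; E)` and by the
open balls of all the seminorms `sobolevSeminorm r Φ φ V` (which are finite on `D'^r_L(M; E)`), where
`Φ` is a bundle chart, `φ` a test function on its domain and `V` a closed cone such that
`supp φ × V` is disjoint from `L`. -/
instance (r : ℝ) (L : Set (CotangentMinusZero m M)) : TopologicalSpace (SobolevDist k E r L) :=
  TopologicalSpace.induced Subtype.val
      (inferInstanceAs (TopologicalSpace (DistSection m k E))) ⊓
    TopologicalSpace.generateFrom {S | ∃ (Φ : BundleChart m k E) (φ : TestFunction Φ.Ω ℂ ⊤)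
      (V : Set (EuclideanSpace ℝ (Fin m))), IsClosed V ∧ IsConeSet V ∧
        SupportConeDisjoint Φ φ V L ∧ ∃ (u : SobolevDist k E r L) (ε : ℝ), 0 < ε ∧
          S = {v | sobolevSeminorm r Φ φ V (v.1 - u.1) < ENNReal.ofReal ε}}

/-- `B ⊆ D'(M; E)` is a relatively compact subset of `D'^r_L(M; E)`: it is contained in this space
and its closure there is compact. -/
def IsRelativelyCompactIn (r : ℝ) (L : Set (CotangentMinusZero m M))
    (B : Set (DistSection m k E)) : Prop :=
  (∀ u ∈ B, WF r u ⊆ L) ∧ IsCompact (closure {u : SobolevDist k E r L | u.1 ∈ B})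

end

/-! ### Weighted L² energies in cones, and convolution with rapidly decreasing kernels. -/

section EuclideanAnalysis

variable {m : ℕ}

local notation "𝔼" => EuclideanSpace ℝ (Fin m)

/-! ### Weighted energies -/

/-! Boundedness already gives compactness in D'(M; E); what can fail in D'^r_L is that Sobolev
energy escapes to high frequencies away from L. Both directions therefore pass through one
condition, `UniformTails`: for a test function φ and a closed cone V with supp φ × V disjoint from
L, the energies of F(φu) in V ∩ {|ξ| > R} tend to 0 as R → ∞, uniformly in u ∈ B.

The inclusion WF^r_c(B) ⊆ L gives uniform tails (`uniformTails_of_WFc_subset`). It provides, near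
each point of supp φ and each direction in V, some test function and some cone with uniform tails.
Compactness of supp φ makes φ a finite sum of products ψ_l φ_l. Multiplication by ψ_l is convolution
in frequency with a rapidly decreasing kernel, which preserves uniform tails up to shrinking the
cone (`UniformTails.conv`), provided that the transforms F(φ_l u) have a common polynomial bound.
Such a bound exists because a bounded B is dominated by a single continuous seminorm q
(`exists_isLFSeminorm_of_isVonNBounded`). Compactness of V ∩ {|ξ| = 1} then reaches the whole cone.

Uniform tails give compactness (`isCompact_tailPolar`). Consider all elements of D'^r_L that are
dominated by q and whose tails are dominated by those of B. An ultrafilter on this set converges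
strongly in D'(M; E), by Alaoglu's argument and the Montel property of Γ_c(E^∨). Energies are lower
semicontinuous, so the limit obeys the same tail bounds and lies in D'^r_L. Each Sobolev seminorm of
the difference tends to 0: low frequencies by strong convergence, high frequencies by the tail
bounds.

Conversely, if the closure of B is compact, finitely many small balls of a Sobolev seminorm cover B.
The tails of each centre tend to 0 by the first step applied to one distribution, so B has uniform
tails. Since L is closed and conic, a covector outside L has a neighbourhood of the form supp φ × V
disjoint from L (`exists_supportConeDisjoint`), and uniform tails there exclude it from WF^r_c(B).

Wave front sets and seminorms range over all bundle charts, so their invariance under changes of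
chart is never needed. Charts are compared only through derivatives of test sections. -/

theorem one_add_norm_sq_pos (ξ : 𝔼) : 0 < 1 + ‖ξ‖ ^ 2 := by positivity

theorem continuous_one_add_norm_sq_rpow (r : ℝ) :
    Continuous fun ξ : 𝔼 ↦ (1 + ‖ξ‖ ^ 2) ^ r :=
  (by fun_prop : Continuous fun ξ : 𝔼 ↦ 1 + ‖ξ‖ ^ 2).rpow_const
    fun ξ ↦ Or.inl (one_add_norm_sq_pos ξ).ne'

theorem measurable_weight (r : ℝ) :
    Measurable fun ξ : 𝔼 ↦ ENNReal.ofReal ((1 + ‖ξ‖ ^ 2) ^ r) :=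
  (continuous_one_add_norm_sq_rpow r).measurable.ennreal_ofReal

theorem weightedEnergy_eq (r : ℝ) (V : Set 𝔼) (f : 𝔼 → ℂ) :
    weightedEnergy r V f = ∫⁻ ξ in V, ‖f ξ‖ₑ ^ 2 * ENNReal.ofReal ((1 + ‖ξ‖ ^ 2) ^ r) := by
  unfold weightedEnergy
  congr 1 with ξ
  rw [ENNReal.ofReal_mul (by positivity), ENNReal.ofReal_pow (norm_nonneg _), ofReal_norm]

theorem weightedEnergy_mono (r : ℝ) {V W : Set 𝔼} (h : V ⊆ W) (f : 𝔼 → ℂ) :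
    weightedEnergy r V f ≤ weightedEnergy r W f := lintegral_mono_set h

theorem weightedEnergy_union_le (r : ℝ) (V W : Set 𝔼) (f : 𝔼 → ℂ) :
    weightedEnergy r (V ∪ W) f ≤ weightedEnergy r V f + weightedEnergy r W f :=
  lintegral_union_le _ _ _

theorem ENNReal.add_sq_le (a b : ℝ≥0∞) : (a + b) ^ 2 ≤ 2 * a ^ 2 + 2 * b ^ 2 := by
  have := ENNReal.rpow_add_le_mul_rpow_add_rpow a b (p := 2) (by norm_num)
  norm_num at this
  rwa [mul_add] at this

/-- The factor 2 is harmless for tails, which are only compared with 0, and measurability of one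
summand suffices. Where the constant matters, Minkowski's inequality is used instead. -/
theorem weightedEnergy_add_le (r : ℝ) (V : Set 𝔼) {f : 𝔼 → ℂ} (hf : Measurable f) (g : 𝔼 → ℂ) :
    weightedEnergy r V (f + g) ≤ 2 * weightedEnergy r V f + 2 * weightedEnergy r V g := by
  simp only [weightedEnergy_eq]
  rw [← lintegral_const_mul' _ _ (by simp), ← lintegral_const_mul' _ _ (by simp),
    ← lintegral_add_left]
  · refine lintegral_mono fun ξ ↦ ?_
    calc ‖(f + g) ξ‖ₑ ^ 2 * ENNReal.ofReal ((1 + ‖ξ‖ ^ 2) ^ r)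
        ≤ (‖f ξ‖ₑ + ‖g ξ‖ₑ) ^ 2 * ENNReal.ofReal ((1 + ‖ξ‖ ^ 2) ^ r) := by
          gcongr; exact enorm_add_le _ _
      _ ≤ (2 * ‖f ξ‖ₑ ^ 2 + 2 * ‖g ξ‖ₑ ^ 2) * ENNReal.ofReal ((1 + ‖ξ‖ ^ 2) ^ r) := by
          gcongr; exact ENNReal.add_sq_le _ _
      _ = _ := by ring
  · exact ((hf.enorm.pow_const 2).mul (measurable_weight r)).const_mul _

/-- Minkowski's inequality for the weighted `L²` norm. -/
theorem weightedEnergy_rpow_add_le (r : ℝ) (V : Set 𝔼) {f g : 𝔼 → ℂ} (hf : Measurable f)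
    (hg : Measurable g) : weightedEnergy r V (f + g) ^ (1 / 2 : ℝ) ≤
      weightedEnergy r V f ^ (1 / 2 : ℝ) + weightedEnergy r V g ^ (1 / 2 : ℝ) := by
  have key : ∀ h : 𝔼 → ℂ, weightedEnergy r V h = ∫⁻ ξ in V,
      (‖h ξ‖ₑ * ENNReal.ofReal ((1 + ‖ξ‖ ^ 2) ^ r) ^ (1 / 2 : ℝ)) ^ (2 : ℝ) := by
    intro h
    rw [weightedEnergy_eq]
    congr 1 with ξ
    rw [ENNReal.mul_rpow_of_nonneg _ _ (by norm_num), ← ENNReal.rpow_mul]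
    norm_num
  have hw := (measurable_weight (m := m) r).pow_const (1 / 2 : ℝ)
  have := ENNReal.lintegral_Lp_add_le (μ := volume.restrict V)
    ((hf.enorm.mul hw).aemeasurable) ((hg.enorm.mul hw).aemeasurable) (p := 2) (by norm_num)
  rw [key f, key g, key (f + g)]
  refine le_trans ?_ this
  gcongr with ξ
  simp only [Pi.add_apply, Pi.mul_apply, ← add_mul]
  gcongr
  exact enorm_add_le _ _

/-- The tails of a finite integral tend to zero. -/
theorem tendsto_lintegral_norm_gt {g : 𝔼 → ℝ≥0∞} {V : Set 𝔼} (hV : MeasurableSet V)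
    (hg : ∫⁻ ξ in V, g ξ ≠ ⊤) :
    Tendsto (fun R : ℝ ↦ ∫⁻ ξ in V ∩ {ξ | R < ‖ξ‖}, g ξ) atTop (𝓝 0) := by
  have hm : ∀ R : ℝ, MeasurableSet (V ∩ {ξ : 𝔼 | R < ‖ξ‖}) := fun R ↦
    hV.inter (measurableSet_lt measurable_const measurable_norm)
  -- Continuity from above of the measure with density g: the sets V ∩ {|ξ| > R} decrease to ∅, and
  -- the one for R = 0 has finite measure.
  have h := tendsto_measure_iInter_atTop (μ := volume.withDensity g)
    (s := fun R : ℝ ↦ V ∩ {ξ : 𝔼 | R < ‖ξ‖}) (fun R ↦ (hm R).nullMeasurableSet)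
    (fun R R' h ξ hξ ↦ ⟨hξ.1, h.trans_lt hξ.2⟩) ⟨0, by
      rw [withDensity_apply _ (hm 0)]
      exact ne_top_of_le_ne_top hg (lintegral_mono_set inter_subset_left)⟩
  have h0 : (⋂ R : ℝ, V ∩ {ξ : 𝔼 | R < ‖ξ‖}) = ∅ := by
    ext ξ
    simp only [mem_iInter, mem_inter_iff, mem_ofPred_eq, mem_empty_iff_false, iff_false, not_forall]
    exact ⟨‖ξ‖, fun h ↦ lt_irrefl _ h.2⟩
  rw [h0, measure_empty] at h
  simpa only [Function.comp_def, withDensity_apply _ (hm _)] using h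

/-- The tails in `V` of the weighted energies of a family of functions tend to zero uniformly. -/
def UniformTails {ι : Sort*} (r : ℝ) (V : Set 𝔼) (f : ι → 𝔼 → ℂ) : Prop :=
  Tendsto (fun R : ℝ ↦ ⨆ i, weightedEnergy r (V ∩ {ξ | R < ‖ξ‖}) (f i)) atTop (𝓝 0)

theorem UniformTails.of_le {ι : Sort*} {r : ℝ} {V : Set 𝔼} {f : ι → 𝔼 → ℂ} {a : ℝ → ℝ≥0∞}
    (ha : Tendsto a atTop (𝓝 0))
    (h : ∀ᶠ R in atTop, ∀ i, weightedEnergy r (V ∩ {ξ | R < ‖ξ‖}) (f i) ≤ a R) :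
    UniformTails r V f :=
  tendsto_of_tendsto_of_tendsto_of_le_of_le' tendsto_const_nhds ha
    (Eventually.of_forall fun _ ↦ zero_le) (h.mono fun _ hR ↦ iSup_le hR)

theorem UniformTails.mono {ι : Sort*} {r : ℝ} {V W : Set 𝔼} {f : ι → 𝔼 → ℂ}
    (h : UniformTails r V f) (hW : W ⊆ V) : UniformTails r W f :=
  .of_le h <| Eventually.of_forall fun R i ↦
    (weightedEnergy_mono r (inter_subset_inter_left _ hW) _).trans
      (le_iSup (fun i ↦ weightedEnergy r (V ∩ {ξ | R < ‖ξ‖}) (f i)) i)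

theorem UniformTails.biUnion {ι κ : Type*} {r : ℝ} {W : κ → Set 𝔼} {f : ι → 𝔼 → ℂ}
    (s : Finset κ) (h : ∀ a ∈ s, UniformTails r (W a) f) :
    UniformTails r (⋃ a ∈ s, W a) f := by
  classical
  induction s using Finset.induction_on with
  | empty => exact .of_le tendsto_const_nhds (Eventually.of_forall fun R i ↦ by
      simp [weightedEnergy])
  | insert a s _ ih =>
    have h1 := h a (Finset.mem_insert_self _ _)
    have h2 := ih fun b hb ↦ h b (Finset.mem_insert_of_mem hb)
    refine .of_le (by simpa using Tendsto.add h1 h2) (Eventually.of_forall fun R i ↦ ?_)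
    rw [Finset.set_biUnion_insert, union_inter_distrib_right]
    refine (weightedEnergy_union_le _ _ _ _).trans (add_le_add ?_ ?_)
    · exact le_iSup (fun i ↦ weightedEnergy r (W a ∩ {ξ | R < ‖ξ‖}) (f i)) i
    · exact le_iSup (fun i ↦ weightedEnergy r ((⋃ a ∈ s, W a) ∩ {ξ | R < ‖ξ‖}) (f i)) i

theorem UniformTails.add {ι : Type*} {r : ℝ} {V : Set 𝔼} {f g : ι → 𝔼 → ℂ}
    (hm : ∀ i, Measurable (f i)) (hf : UniformTails r V f) (hg : UniformTails r V g) :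
    UniformTails r V (f + g) := by
  refine .of_le (a := fun R ↦ 2 * (⨆ i, weightedEnergy r (V ∩ {ξ | R < ‖ξ‖}) (f i)) +
    2 * (⨆ i, weightedEnergy r (V ∩ {ξ | R < ‖ξ‖}) (g i))) ?_ (Eventually.of_forall fun R i ↦ ?_)
  · have h1 := ENNReal.Tendsto.const_mul (a := 2) hf (Or.inr (by simp))
    have h2 := ENNReal.Tendsto.const_mul (a := 2) hg (Or.inr (by simp))
    simpa using h1.add h2
  · refine (weightedEnergy_add_le r _ (hm i) _).trans (add_le_add ?_ ?_) <;> gcongr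
    · exact le_iSup (fun i ↦ weightedEnergy r (V ∩ {ξ | R < ‖ξ‖}) (f i)) i
    · exact le_iSup (fun i ↦ weightedEnergy r (V ∩ {ξ | R < ‖ξ‖}) (g i)) i

theorem UniformTails.sum {ι κ : Type*} {r : ℝ} {V : Set 𝔼} {f : κ → ι → 𝔼 → ℂ} (s : Finset κ)
    (hm : ∀ a i, Measurable (f a i)) (h : ∀ a ∈ s, UniformTails r V (f a)) :
    UniformTails r V (∑ a ∈ s, f a) := by
  classical
  induction s using Finset.induction_on with
  | empty => exact .of_le tendsto_const_nhds (Eventually.of_forall fun R i ↦ by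
      simp [weightedEnergy])
  | insert a s ha ih =>
    rw [Finset.sum_insert ha]
    exact UniformTails.add (hm a) (h a (Finset.mem_insert_self _ _))
      (ih fun b hb ↦ h b (Finset.mem_insert_of_mem hb))

/-! ### Cones -/

/-- The closed cone of all `ξ` whose direction is within `ε` of the unit vector `ν`. -/
def unitCone (ν : 𝔼) (ε : ℝ) : Set 𝔼 := {ξ | ‖ξ - ‖ξ‖ • ν‖ ≤ ε * ‖ξ‖}

theorem isClosed_unitCone (ν : 𝔼) (ε : ℝ) : IsClosed (unitCone ν ε) :=
  isClosed_le (by fun_prop) (by fun_prop)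

theorem isConeSet_unitCone (ν : 𝔼) (ε : ℝ) : IsConeSet (unitCone ν ε) := by
  intro ξ hξ t ht
  simp only [unitCone, mem_ofPred_eq, norm_smul, Real.norm_of_nonneg ht.le] at hξ ⊢
  rw [mul_smul, ← smul_sub, norm_smul, Real.norm_of_nonneg ht.le]
  nlinarith

theorem smul_unitCone_mem_closedBall {ν ξ : 𝔼} {ε : ℝ} (hξ : ξ ∈ unitCone ν ε) (h0 : ξ ≠ 0) :
    ‖ξ‖⁻¹ • ξ ∈ Metric.closedBall ν ε := by
  have h : 0 < ‖ξ‖ := norm_pos_iff.2 h0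
  rw [mem_closedBall_iff_norm]
  have : ‖ξ‖⁻¹ • ξ - ν = ‖ξ‖⁻¹ • (ξ - ‖ξ‖ • ν) := by
    rw [smul_sub, smul_smul, inv_mul_cancel₀ h.ne', one_smul]
  rw [this, norm_smul, norm_inv, norm_norm, inv_mul_le_iff₀ h, mul_comm]
  exact hξ

/-- By homogeneity one may divide by |ξ|: the direction of ξ is then within ε of ν, while ζ/|ξ|
stays outside the ball of radius 2ε. Separation proportional to |ξ| is what the convolution estimate
turns into decay in ξ. -/
theorem unitCone_separated {V : Set 𝔼} (hV : IsConeSet V) {ν : 𝔼} {ε : ℝ} (hε : 0 < ε)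
    (h : Metric.ball ν (2 * ε) ⊆ V) {ξ ζ : 𝔼} (hξ : ξ ∈ unitCone ν ε) (hζ : ζ ∉ V) :
    ε * ‖ξ‖ ≤ ‖ξ - ζ‖ := by
  by_contra! hlt
  have h0 : 0 < ‖ξ‖ := by
    by_contra! h0
    nlinarith [norm_nonneg (ξ - ζ)]
  apply hζ
  have h1 : ‖ξ‖⁻¹ • ζ ∈ V := by
    apply h
    rw [mem_ball_iff_norm]
    have e : ‖ξ‖⁻¹ • ζ - ν = ‖ξ‖⁻¹ • ((ξ - ‖ξ‖ • ν) - (ξ - ζ)) := by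
      rw [sub_sub_sub_cancel_left, smul_sub, smul_smul, inv_mul_cancel₀ h0.ne', one_smul]
    rw [e, norm_smul, norm_inv, norm_norm, inv_mul_lt_iff₀ h0]
    have := norm_sub_le (ξ - ‖ξ‖ • ν) (ξ - ζ)
    have h2 : ‖ξ - ‖ξ‖ • ν‖ ≤ ε * ‖ξ‖ := hξ
    nlinarith
  have h2 := hV _ h1 ‖ξ‖ h0
  rwa [smul_smul, mul_inv_cancel₀ h0.ne', one_smul] at h2

/-! ### Convolution with a rapidly decreasing kernel -/

theorem lintegral_one_add_norm_inv_pow_lt_top :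
    ∫⁻ η : 𝔼, ENNReal.ofReal (((1 + ‖η‖) ^ (m + 1))⁻¹) < ⊤ := by
  have h := finite_integral_one_add_norm (E := 𝔼) (μ := volume) (r := ((m + 1 : ℕ) : ℝ))
    (by rw [finrank_euclideanSpace_fin]; push_cast; linarith)
  refine lt_of_le_of_lt (lintegral_mono fun η ↦ ?_) h
  rw [Real.rpow_neg (by positivity), Real.rpow_natCast]

/-- Replaces the real weight by an integer power, so that decay of integer orders can absorb it. -/
theorem one_add_norm_sq_rpow_le (r : ℝ) (ξ : 𝔼) :
    (1 + ‖ξ‖ ^ 2) ^ r ≤ ((1 + ‖ξ‖) ^ ⌈|r|⌉₊) ^ 2 := by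
  have h1 : (1 : ℝ) ≤ 1 + ‖ξ‖ ^ 2 := by nlinarith [sq_nonneg ‖ξ‖]
  calc (1 + ‖ξ‖ ^ 2) ^ r ≤ (1 + ‖ξ‖ ^ 2) ^ (⌈|r|⌉₊ : ℝ) :=
        Real.rpow_le_rpow_of_exponent_le h1 ((le_abs_self r).trans (Nat.le_ceil _))
    _ = (1 + ‖ξ‖ ^ 2) ^ ⌈|r|⌉₊ := Real.rpow_natCast _ _
    _ ≤ ((1 + ‖ξ‖) ^ 2) ^ ⌈|r|⌉₊ := by
        gcongr
        nlinarith [norm_nonneg ξ]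
    _ = _ := by rw [← pow_mul, ← pow_mul, mul_comm]

/-- Peetre's inequality. -/
theorem peetre (r : ℝ) (ξ η : 𝔼) : (1 + ‖ξ‖ ^ 2) ^ r ≤
    2 ^ |r| * (1 + ‖η - ξ‖ ^ 2) ^ |r| * (1 + ‖η‖ ^ 2) ^ r := by
  have key : ∀ x y : 𝔼, 1 + ‖x‖ ^ 2 ≤ 2 * (1 + ‖y - x‖ ^ 2) * (1 + ‖y‖ ^ 2) := by
    intro x y
    have h : ‖x‖ ≤ ‖y‖ + ‖y - x‖ := by
      calc ‖x‖ = ‖y - (y - x)‖ := by rw [sub_sub_cancel]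
        _ ≤ _ := norm_sub_le _ _
    nlinarith [norm_nonneg x, norm_nonneg y, norm_nonneg (y - x), sq_nonneg (‖y‖ - ‖y - x‖),
      mul_nonneg (sq_nonneg ‖y‖) (sq_nonneg ‖y - x‖)]
  have pξ := one_add_norm_sq_pos ξ
  have pη := one_add_norm_sq_pos η
  have pd := one_add_norm_sq_pos (η - ξ)
  rcases le_total 0 r with hr | hr
  · rw [abs_of_nonneg hr, ← Real.mul_rpow (by norm_num) pd.le, ← Real.mul_rpow (by positivity) pη.le]
    exact Real.rpow_le_rpow pξ.le (key ξ η) hr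
  -- For r ≤ 0 the basic inequality is used with ξ and η exchanged, raised to the power -r, and then
  -- inverted.
  · rw [abs_of_nonpos hr, ← Real.mul_rpow (by norm_num) pd.le]
    have h := key η ξ
    rw [norm_sub_rev ξ η] at h
    have h2 : (1 + ‖η‖ ^ 2) ^ (-r) ≤ (2 * (1 + ‖η - ξ‖ ^ 2)) ^ (-r) * (1 + ‖ξ‖ ^ 2) ^ (-r) := by
      rw [← Real.mul_rpow (by positivity) pξ.le]
      exact Real.rpow_le_rpow pη.le h (by linarith)
    rw [Real.rpow_neg pη.le, Real.rpow_neg pξ.le] at h2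
    have qξ := Real.rpow_pos_of_pos pξ r
    have qη := Real.rpow_pos_of_pos pη r
    rw [← div_eq_mul_inv, le_div_iff₀ qξ, inv_mul_le_iff₀ qη] at h2
    linarith [h2]

/-- Cauchy–Schwarz for the factorisation kF = k^{1/2} · k^{1/2}F. -/
theorem lintegral_mul_sq_le {μ : Measure 𝔼} {k F : 𝔼 → ℝ≥0∞} (hk : Measurable k)
    (hF : Measurable F) :
    (∫⁻ η, k η * F η ∂μ) ^ 2 ≤ (∫⁻ η, k η ∂μ) * ∫⁻ η, k η * F η ^ 2 ∂μ := by
  have h := ENNReal.lintegral_mul_le_Lp_mul_Lq μ (p := 2) (q := 2) ⟨by norm_num, by norm_num, by norm_num⟩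
    (f := fun η ↦ k η ^ (1 / 2 : ℝ)) (g := fun η ↦ k η ^ (1 / 2 : ℝ) * F η)
    (hk.pow_const _).aemeasurable ((hk.pow_const _).mul hF).aemeasurable
  have e1 : ∀ η, k η ^ (1 / 2 : ℝ) * (k η ^ (1 / 2 : ℝ) * F η) = k η * F η := fun η ↦ by
    rw [← mul_assoc, ← ENNReal.rpow_add_of_nonneg _ _ (by norm_num) (by norm_num)]; norm_num
  have e2 : ∀ η, (k η ^ (1 / 2 : ℝ)) ^ (2 : ℝ) = k η := fun η ↦ by
    rw [← ENNReal.rpow_mul]; norm_num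
  have e3 : ∀ η, (k η ^ (1 / 2 : ℝ) * F η) ^ (2 : ℝ) = k η * F η ^ 2 := fun η ↦ by
    rw [ENNReal.mul_rpow_of_nonneg _ _ (by norm_num), e2]; norm_num
  simp only [Pi.mul_apply, e1, e2, e3] at h
  calc _ ≤ ((∫⁻ η, k η ∂μ) ^ (1 / 2 : ℝ) * (∫⁻ η, k η * F η ^ 2 ∂μ) ^ (1 / 2 : ℝ)) ^ 2 := by gcongr
    _ = _ := by
      rw [mul_pow, ← ENNReal.rpow_natCast, ← ENNReal.rpow_natCast, ← ENNReal.rpow_mul,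
        ← ENNReal.rpow_mul]
      norm_num

/-- A nonnegative measurable function that decreases rapidly. -/
structure IsRapidKernel (κ : 𝔼 → ℝ) : Prop where
  nonneg : ∀ ζ, 0 ≤ κ ζ
  measurable : Measurable κ
  decay : ∀ n : ℕ, ∃ D : ℝ, ∀ ζ, κ ζ * (1 + ‖ζ‖) ^ n ≤ D

theorem IsRapidKernel.lintegral_mul_weight_lt_top {κ : 𝔼 → ℝ} (hκ : IsRapidKernel κ) (r : ℝ) :
    ∫⁻ ζ, ENNReal.ofReal (κ ζ * (1 + ‖ζ‖ ^ 2) ^ r) < ⊤ := by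
  -- The first 2⌈|r|⌉ orders of decay absorb the weight, the other m + 1 give integrability on ℝᵐ.
  obtain ⟨D, hD⟩ := hκ.decay (⌈|r|⌉₊ * 2 + (m + 1))
  have h : ∀ ζ : 𝔼, κ ζ * (1 + ‖ζ‖ ^ 2) ^ r ≤ D * ((1 + ‖ζ‖) ^ (m + 1))⁻¹ := by
    intro ζ
    have h1 := one_add_norm_sq_rpow_le r ζ
    rw [← div_eq_mul_inv, le_div_iff₀ (by positivity)]
    refine le_trans ?_ (hD ζ)
    rw [pow_add _ (_ * 2), pow_mul, ← mul_assoc]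
    gcongr
    exact hκ.nonneg ζ
  calc ∫⁻ ζ, ENNReal.ofReal (κ ζ * (1 + ‖ζ‖ ^ 2) ^ r)
      ≤ ∫⁻ ζ : 𝔼, ENNReal.ofReal D * ENNReal.ofReal (((1 + ‖ζ‖) ^ (m + 1))⁻¹) := by
        refine lintegral_mono fun ζ ↦ ?_
        rw [← ENNReal.ofReal_mul' (by positivity)]
        exact ENNReal.ofReal_le_ofReal (h ζ)
    _ = ENNReal.ofReal D * ∫⁻ ζ : 𝔼, ENNReal.ofReal (((1 + ‖ζ‖) ^ (m + 1))⁻¹) :=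
        lintegral_const_mul' _ _ ENNReal.ofReal_ne_top
    _ < ⊤ := ENNReal.mul_lt_top ENNReal.ofReal_lt_top lintegral_one_add_norm_inv_pow_lt_top

theorem IsRapidKernel.lintegral_lt_top {κ : 𝔼 → ℝ} (hκ : IsRapidKernel κ) :
    ∫⁻ ζ, ENNReal.ofReal (κ ζ) < ⊤ := by
  simpa using hκ.lintegral_mul_weight_lt_top 0

/-- The contribution to a convolution of the points far away. -/
theorem IsRapidKernel.far_bound {κ : 𝔼 → ℝ} (hκ : IsRapidKernel κ) {c C : ℝ} (hc : 0 < c) {N : ℕ}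
    (n : ℕ) : ∃ D : ℝ≥0, ∀ (f : 𝔼 → ℂ), (∀ ξ, ‖f ξ‖ ≤ C * (1 + ‖ξ‖) ^ N) →
      ∀ (ξ : 𝔼) (A : Set 𝔼), MeasurableSet A → (∀ η ∈ A, c * ‖ξ‖ ≤ ‖η - ξ‖) →
      ∫⁻ η in A, ENNReal.ofReal (κ (η - ξ)) * ‖f η‖ₑ ≤ D * ENNReal.ofReal (((1 + ‖ξ‖) ^ n)⁻¹) := by
  -- Decay of the kernel has to pay for the growth of f (N), the decay asked for in ξ (n) and
  -- integrability in η (m + 1).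
  set K := N + n + (m + 1)
  obtain ⟨D, hD⟩ := hκ.decay K
  -- On A one has |ξ| ≤ c⁻¹|η - ξ|, so both 1 + |ξ| and 1 + |η| are at most a(1 + |η - ξ|); every
  -- factor can be charged to the kernel.
  set a : ℝ := 2 + c⁻¹
  have ha : 0 < a := by positivity
  have hD0 : 0 ≤ D := (mul_nonneg (hκ.nonneg 0) (by positivity)).trans (hD 0)
  set I := ∫⁻ η : 𝔼, ENNReal.ofReal (((1 + ‖η‖) ^ (m + 1))⁻¹)
  refine ⟨(ENNReal.ofReal (C * a ^ K * D) * I).toNNReal, fun f hf ξ A hA hsep ↦ ?_⟩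
  rw [ENNReal.coe_toNNReal (ENNReal.mul_lt_top ENNReal.ofReal_lt_top
    lintegral_one_add_norm_inv_pow_lt_top).ne]
  have hC : 0 ≤ C := by
    have := (norm_nonneg _).trans (hf 0)
    simpa using this
  have hpt : ∀ η ∈ A, ENNReal.ofReal (κ (η - ξ)) * ‖f η‖ₑ ≤
      ENNReal.ofReal (C * a ^ K * D) * ENNReal.ofReal (((1 + ‖ξ‖) ^ n)⁻¹) *
        ENNReal.ofReal (((1 + ‖η‖) ^ (m + 1))⁻¹) := by
    intro η hη
    rw [← ofReal_norm, ← ENNReal.ofReal_mul (hκ.nonneg _), ← ENNReal.ofReal_mul (by positivity),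
      ← ENNReal.ofReal_mul (by positivity)]
    refine ENNReal.ofReal_le_ofReal ?_
    have h1 : ‖ξ‖ ≤ c⁻¹ * ‖η - ξ‖ := by
      rw [le_inv_mul_iff₀ hc]; exact hsep η hη
    have h2 : ‖η‖ ≤ ‖ξ‖ + ‖η - ξ‖ := by
      calc ‖η‖ = ‖ξ + (η - ξ)‖ := by rw [add_sub_cancel]
        _ ≤ _ := norm_add_le _ _
    have hci : 0 < c⁻¹ := by positivity
    have h3 : 1 + ‖ξ‖ ≤ a * (1 + ‖η - ξ‖) := by
      simp only [a]; nlinarith [norm_nonneg (η - ξ)]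
    have h4 : 1 + ‖η‖ ≤ a * (1 + ‖η - ξ‖) := by
      simp only [a]; nlinarith [norm_nonneg (η - ξ)]
    rw [← div_eq_mul_inv, ← div_eq_mul_inv, le_div_iff₀ (by positivity), le_div_iff₀ (by positivity)]
    have hk := hκ.nonneg (η - ξ)
    calc κ (η - ξ) * ‖f η‖ * (1 + ‖η‖) ^ (m + 1) * (1 + ‖ξ‖) ^ n
        ≤ κ (η - ξ) * (C * (1 + ‖η‖) ^ N) * (1 + ‖η‖) ^ (m + 1) * (1 + ‖ξ‖) ^ n := by
          gcongr; exact hf η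
      _ ≤ κ (η - ξ) * (C * (a * (1 + ‖η - ξ‖)) ^ N) * (a * (1 + ‖η - ξ‖)) ^ (m + 1) *
            (a * (1 + ‖η - ξ‖)) ^ n := by gcongr
      _ = C * a ^ K * (κ (η - ξ) * (1 + ‖η - ξ‖) ^ K) := by
          simp only [mul_pow, K, pow_add]; ring
      _ ≤ C * a ^ K * D := by gcongr; exact hD _
  calc ∫⁻ η in A, ENNReal.ofReal (κ (η - ξ)) * ‖f η‖ₑ
      ≤ ∫⁻ η in A, ENNReal.ofReal (C * a ^ K * D) * ENNReal.ofReal (((1 + ‖ξ‖) ^ n)⁻¹) *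
        ENNReal.ofReal (((1 + ‖η‖) ^ (m + 1))⁻¹) := setLIntegral_mono' hA hpt
    _ ≤ ∫⁻ η, ENNReal.ofReal (C * a ^ K * D) * ENNReal.ofReal (((1 + ‖ξ‖) ^ n)⁻¹) *
        ENNReal.ofReal (((1 + ‖η‖) ^ (m + 1))⁻¹) := setLIntegral_le_lintegral _ _
    _ = ENNReal.ofReal (C * a ^ K * D) * ENNReal.ofReal (((1 + ‖ξ‖) ^ n)⁻¹) * I :=
        lintegral_const_mul' _ _ (ENNReal.mul_ne_top ENNReal.ofReal_ne_top ENNReal.ofReal_ne_top)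
    _ = _ := by ring

/-- A weighted form of Young's inequality. -/
theorem IsRapidKernel.near_bound {κ : 𝔼 → ℝ} (hκ : IsRapidKernel κ) (r : ℝ) :
    ∃ D : ℝ≥0, ∀ (F : 𝔼 → ℝ≥0∞), Measurable F →
      ∫⁻ ξ, (∫⁻ η, ENNReal.ofReal (κ (η - ξ)) * F η) ^ 2 * ENNReal.ofReal ((1 + ‖ξ‖ ^ 2) ^ r) ≤
        D * ∫⁻ η, F η ^ 2 * ENNReal.ofReal ((1 + ‖η‖ ^ 2) ^ r) := by
  set I := ∫⁻ ζ, ENNReal.ofReal (κ ζ)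
  set J := ∫⁻ ζ, ENNReal.ofReal (κ ζ * (1 + ‖ζ‖ ^ 2) ^ |r|)
  have hI : I ≠ ⊤ := hκ.lintegral_lt_top.ne
  have hJ : J ≠ ⊤ := (hκ.lintegral_mul_weight_lt_top |r|).ne
  set c := ENNReal.ofReal (2 ^ |r|)
  have hc : c ≠ ⊤ := ENNReal.ofReal_ne_top
  refine ⟨(I * c * J).toNNReal, fun F hF ↦ ?_⟩
  rw [ENNReal.coe_toNNReal (ENNReal.mul_ne_top (ENNReal.mul_ne_top hI hc) hJ)]
  have hk : Measurable fun ζ ↦ ENNReal.ofReal (κ ζ) := hκ.measurable.ennreal_ofReal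
  have hkw : Measurable fun ζ ↦ ENNReal.ofReal (κ ζ * (1 + ‖ζ‖ ^ 2) ^ |r|) :=
    (hκ.measurable.mul (continuous_one_add_norm_sq_rpow _).measurable).ennreal_ofReal
  have hFw : Measurable fun η ↦ F η ^ 2 * ENNReal.ofReal ((1 + ‖η‖ ^ 2) ^ r) :=
    (hF.pow_const 2).mul (measurable_weight r)
  -- Cauchy–Schwarz with respect to the kernel, then Peetre's inequality moves the weight from ξ to
  -- η at the price of a weight of order |r| on the kernel. What remains is Tonelli.
  have h1 : ∀ ξ, (∫⁻ η, ENNReal.ofReal (κ (η - ξ)) * F η) ^ 2 *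
      ENNReal.ofReal ((1 + ‖ξ‖ ^ 2) ^ r) ≤ I * c *
      ∫⁻ η, ENNReal.ofReal (κ (η - ξ) * (1 + ‖η - ξ‖ ^ 2) ^ |r|) *
        (F η ^ 2 * ENNReal.ofReal ((1 + ‖η‖ ^ 2) ^ r)) := by
    intro ξ
    have hkξ : Measurable fun η ↦ ENNReal.ofReal (κ (η - ξ)) :=
      hk.comp (measurable_id.sub_const ξ)
    have hs := lintegral_mul_sq_le (μ := volume) hkξ hF
    have hi : ∫⁻ η, ENNReal.ofReal (κ (η - ξ)) = I :=
      lintegral_sub_right_eq_self (fun ζ ↦ ENNReal.ofReal (κ ζ)) ξ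
    rw [hi] at hs
    calc _ ≤ I * (∫⁻ η, ENNReal.ofReal (κ (η - ξ)) * F η ^ 2) *
          ENNReal.ofReal ((1 + ‖ξ‖ ^ 2) ^ r) := by gcongr
      _ = I * ∫⁻ η, ENNReal.ofReal (κ (η - ξ)) * F η ^ 2 * ENNReal.ofReal ((1 + ‖ξ‖ ^ 2) ^ r) := by
          rw [mul_assoc, lintegral_mul_const' _ _ ENNReal.ofReal_ne_top]
      _ ≤ I * ∫⁻ η, c * (ENNReal.ofReal (κ (η - ξ) * (1 + ‖η - ξ‖ ^ 2) ^ |r|) *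
          (F η ^ 2 * ENNReal.ofReal ((1 + ‖η‖ ^ 2) ^ r))) := by
          refine mul_le_mul_right (lintegral_mono fun η ↦ ?_) _
          have hp := ENNReal.ofReal_le_ofReal (peetre r ξ η)
          rw [ENNReal.ofReal_mul (by positivity), ENNReal.ofReal_mul (by positivity)] at hp
          rw [ENNReal.ofReal_mul (hκ.nonneg _)]
          calc _ ≤ ENNReal.ofReal (κ (η - ξ)) * F η ^ 2 * (ENNReal.ofReal (2 ^ |r|) *
              ENNReal.ofReal ((1 + ‖η - ξ‖ ^ 2) ^ |r|) * ENNReal.ofReal ((1 + ‖η‖ ^ 2) ^ r)) := by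
                gcongr
            _ = _ := by ring
      _ = _ := by rw [lintegral_const_mul' _ _ hc, mul_assoc]
  calc _ ≤ ∫⁻ ξ, I * c * ∫⁻ η, ENNReal.ofReal (κ (η - ξ) * (1 + ‖η - ξ‖ ^ 2) ^ |r|) *
        (F η ^ 2 * ENNReal.ofReal ((1 + ‖η‖ ^ 2) ^ r)) := lintegral_mono h1
    _ = I * c * ∫⁻ ξ, ∫⁻ η, ENNReal.ofReal (κ (η - ξ) * (1 + ‖η - ξ‖ ^ 2) ^ |r|) *
        (F η ^ 2 * ENNReal.ofReal ((1 + ‖η‖ ^ 2) ^ r)) :=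
        lintegral_const_mul' _ _ (ENNReal.mul_ne_top hI hc)
    _ = I * c * ∫⁻ η, ∫⁻ ξ, ENNReal.ofReal (κ (η - ξ) * (1 + ‖η - ξ‖ ^ 2) ^ |r|) *
        (F η ^ 2 * ENNReal.ofReal ((1 + ‖η‖ ^ 2) ^ r)) := by
        rw [lintegral_lintegral_swap]
        exact ((hkw.comp (measurable_snd.sub measurable_fst)).mul
          (hFw.comp measurable_snd)).aemeasurable
    _ = I * c * ∫⁻ η, J * (F η ^ 2 * ENNReal.ofReal ((1 + ‖η‖ ^ 2) ^ r)) := by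
        congr 2 with η
        have hkη : Measurable fun ξ ↦ ENNReal.ofReal (κ (η - ξ) * (1 + ‖η - ξ‖ ^ 2) ^ |r|) :=
          hkw.comp (measurable_id.const_sub η)
        rw [lintegral_mul_const _ hkη]
        congr 1
        exact lintegral_sub_left_eq_self (fun ζ ↦ ENNReal.ofReal (κ ζ * (1 + ‖ζ‖ ^ 2) ^ |r|)) η
    _ = _ := by rw [lintegral_const_mul' _ _ hJ]; ring

/-- Convolution with a rapidly decreasing kernel preserves uniformly small tails, up to shrinking
the cone. -/
theorem UniformTails.conv {ι : Type*} {r : ℝ} {V W : Set 𝔼} (hV : MeasurableSet V)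
    (hW : MeasurableSet W) {ε : ℝ} (hε : 0 < ε) (hsep : ∀ ξ ∈ W, ∀ ζ ∉ V, ε * ‖ξ‖ ≤ ‖ξ - ζ‖)
    {f h : ι → 𝔼 → ℂ} (hf : ∀ i, Measurable (f i)) {C : ℝ} {N : ℕ}
    (hfb : ∀ i ξ, ‖f i ξ‖ ≤ C * (1 + ‖ξ‖) ^ N) {κ : 𝔼 → ℝ} (hκ : IsRapidKernel κ)
    (hh : ∀ i ξ, ‖h i ξ‖ₑ ≤ ∫⁻ η, ENNReal.ofReal (κ (η - ξ)) * ‖f i η‖ₑ)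
    (ht : UniformTails r V f) : UniformTails r W h := by
  -- A frequency η in the far part lies either outside V, at distance at least ε|ξ| from ξ, or in
  -- {|η| ≤ R/2}, at distance at least |ξ|/2 since |ξ| > R.
  set c := min ε (1 / 2)
  have hc : 0 < c := by positivity
  -- Chosen so that (1 + |ξ|)^{-2n} times the weight is integrable.
  set n := ⌈|r|⌉₊ + (m + 1)
  obtain ⟨D₁, hD₁⟩ := hκ.far_bound (C := C) hc (N := N) n
  obtain ⟨D₂, hD₂⟩ := hκ.near_bound r
  set g : 𝔼 → ℝ≥0∞ := fun ξ ↦ ENNReal.ofReal (((1 + ‖ξ‖) ^ n)⁻¹) ^ 2 *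
    ENNReal.ofReal ((1 + ‖ξ‖ ^ 2) ^ r)
  have hgm : Measurable g := by
    refine Measurable.mul (Measurable.pow_const (Measurable.ennreal_ofReal ?_) 2) (measurable_weight r)
    exact ((measurable_norm.const_add 1).pow_const n).inv
  have hgfin : ∫⁻ ξ in univ, g ξ ≠ ⊤ := by
    rw [Measure.restrict_univ]
    refine (lt_of_le_of_lt (lintegral_mono fun ξ ↦ ?_) lintegral_one_add_norm_inv_pow_lt_top).ne
    simp only [g]
    rw [← ENNReal.ofReal_pow (by positivity), ← ENNReal.ofReal_mul (by positivity)]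
    refine ENNReal.ofReal_le_ofReal ?_
    have h1 := one_add_norm_sq_rpow_le r ξ
    rw [inv_pow, inv_mul_le_iff₀ (by positivity)]
    refine h1.trans ?_
    rw [← div_eq_mul_inv, le_div_iff₀ (by positivity)]
    have h2 : (1 : ℝ) ≤ (1 + ‖ξ‖) ^ (m + 1) := one_le_pow₀ (by linarith [norm_nonneg ξ])
    calc ((1 + ‖ξ‖) ^ ⌈|r|⌉₊) ^ 2 * (1 + ‖ξ‖) ^ (m + 1)
        ≤ ((1 + ‖ξ‖) ^ ⌈|r|⌉₊) ^ 2 * ((1 + ‖ξ‖) ^ (m + 1)) ^ 2 := by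
          gcongr
          exact le_self_pow₀ h2 (by norm_num)
      _ = _ := by simp only [n, pow_add]; ring
  have hgt := tendsto_lintegral_norm_gt MeasurableSet.univ hgfin
  simp only [univ_inter] at hgt
  -- The far part contributes the tail of the fixed integrable function g, the near part the
  -- energies of f in V beyond R/2.
  refine .of_le (a := fun R ↦ 2 * (D₁ ^ 2 * ∫⁻ ξ in {ξ | R < ‖ξ‖}, g ξ) +
    2 * (D₂ * ⨆ i, weightedEnergy r (V ∩ {ξ | R / 2 < ‖ξ‖}) (f i))) ?_ ?_
  · have h1 := ENNReal.Tendsto.const_mul (a := 2) (ENNReal.Tendsto.const_mul (a := (D₁ : ℝ≥0∞) ^ 2) hgt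
      (Or.inr (by simp))) (Or.inr (by simp))
    have h2 := ENNReal.Tendsto.const_mul (a := 2) (ENNReal.Tendsto.const_mul (a := (D₂ : ℝ≥0∞))
      (Tendsto.comp ht (tendsto_id.atTop_div_const (two_pos : (0 : ℝ) < 2))) (Or.inr (by simp)))
      (Or.inr (by simp))
    simpa using h1.add h2
  · filter_upwards [eventually_ge_atTop 0] with R hR i
    set A : Set 𝔼 := V ∩ {η | R / 2 < ‖η‖}
    have hA : MeasurableSet A := hV.inter (measurableSet_lt measurable_const measurable_norm)
    have hWR : MeasurableSet (W ∩ {ξ : 𝔼 | R < ‖ξ‖}) :=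
      hW.inter (measurableSet_lt measurable_const measurable_norm)
    set F : 𝔼 → ℝ≥0∞ := A.indicator fun η ↦ ‖f i η‖ₑ
    have hF : Measurable F := (hf i).enorm.indicator hA
    have hpt : ∀ ξ ∈ W ∩ {ξ : 𝔼 | R < ‖ξ‖}, ‖h i ξ‖ₑ ≤
        D₁ * ENNReal.ofReal (((1 + ‖ξ‖) ^ n)⁻¹) + ∫⁻ η, ENNReal.ofReal (κ (η - ξ)) * F η := by
      rintro ξ ⟨hξ, hξR⟩
      refine (hh i ξ).trans ?_
      rw [← lintegral_add_compl _ hA, add_comm]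
      refine add_le_add ?_ ?_
      · refine hD₁ (f i) (hfb i) ξ _ hA.compl fun η hη ↦ ?_
        rw [mem_compl_iff, mem_inter_iff, not_and_or] at hη
        rcases hη with hη | hη
        · rw [norm_sub_rev]
          exact (mul_le_mul_of_nonneg_right (min_le_left _ _) (norm_nonneg _)).trans (hsep ξ hξ η hη)
        · have h1 : ‖η‖ ≤ ‖ξ‖ / 2 := by
            simp only [mem_ofPred_eq, not_lt] at hη hξR
            linarith
          have h2 : ‖ξ‖ ≤ ‖η‖ + ‖η - ξ‖ := by
            calc ‖ξ‖ = ‖η - (η - ξ)‖ := by rw [sub_sub_cancel]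
              _ ≤ _ := norm_sub_le _ _
          have h3 : c * ‖ξ‖ ≤ 1 / 2 * ‖ξ‖ :=
            mul_le_mul_of_nonneg_right (min_le_right _ _) (norm_nonneg _)
          linarith
      · rw [← lintegral_indicator hA]
        refine lintegral_mono fun η ↦ ?_
        by_cases hη : η ∈ A <;> simp [F, hη]
    have h2 := hD₂ F hF
    have e : ∫⁻ η, F η ^ 2 * ENNReal.ofReal ((1 + ‖η‖ ^ 2) ^ r) = weightedEnergy r A (f i) := by
      rw [weightedEnergy_eq, ← lintegral_indicator hA]
      congr 1 with η
      by_cases hη : η ∈ A <;> simp [F, hη]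
    rw [e] at h2
    rw [weightedEnergy_eq]
    calc _ ≤ ∫⁻ ξ in W ∩ {ξ | R < ‖ξ‖}, (2 * (D₁ ^ 2 * g ξ) +
          2 * ((∫⁻ η, ENNReal.ofReal (κ (η - ξ)) * F η) ^ 2 *
            ENNReal.ofReal ((1 + ‖ξ‖ ^ 2) ^ r))) := by
          refine setLIntegral_mono' hWR fun ξ hξ ↦ ?_
          calc _ ≤ (D₁ * ENNReal.ofReal (((1 + ‖ξ‖) ^ n)⁻¹) +
                ∫⁻ η, ENNReal.ofReal (κ (η - ξ)) * F η) ^ 2 * ENNReal.ofReal ((1 + ‖ξ‖ ^ 2) ^ r) := by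
                gcongr; exact hpt ξ hξ
            _ ≤ _ := mul_le_mul_left (ENNReal.add_sq_le _ _) _
            _ = _ := by simp only [g]; ring
      _ = 2 * (D₁ ^ 2 * ∫⁻ ξ in W ∩ {ξ | R < ‖ξ‖}, g ξ) +
          2 * ∫⁻ ξ in W ∩ {ξ | R < ‖ξ‖}, (∫⁻ η, ENNReal.ofReal (κ (η - ξ)) * F η) ^ 2 *
            ENNReal.ofReal ((1 + ‖ξ‖ ^ 2) ^ r) := by
          rw [lintegral_add_left ((hgm.const_mul _).const_mul _), lintegral_const_mul' _ _ (by simp),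
            lintegral_const_mul' _ _ (by simp), lintegral_const_mul' _ _ (by simp)]
      _ ≤ _ := by
          refine add_le_add ?_ ?_
          · gcongr
            exact inter_subset_right
          · refine mul_le_mul_right ?_ _
            refine (setLIntegral_le_lintegral _ _).trans (h2.trans ?_)
            gcongr
            exact le_iSup (fun i ↦ weightedEnergy r A (f i)) i

end EuclideanAnalysis

/-! ### Derivatives of characters, and products of test functions with smooth functions. -/

section TestCalculus

variable {m : ℕ} {Ω : TopologicalSpace.Opens (EuclideanSpace ℝ (Fin m))}

local notation "𝔼" => EuclideanSpace ℝ (Fin m)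

/-! ### Characters and their derivatives -/

/-- The character `x ↦ e^{-i x·η}`. -/
noncomputable def expChar (η : 𝔼) : 𝔼 → ℂ := fun x ↦
  Complex.exp (-(Complex.I * ((inner ℝ x η : ℝ) : ℂ)))

theorem contDiff_expChar (η : 𝔼) : ContDiff ℝ ∞ (expChar η) := by
  refine (contDiff_const.mul ?_).neg.cexp
  exact Complex.ofRealCLM.contDiff.comp (contDiff_id.inner ℝ contDiff_const)

theorem norm_expChar (η x : 𝔼) : ‖expChar η x‖ = 1 := by
  unfold expChar
  rw [mul_comm, ← neg_mul, ← Complex.ofReal_neg, Complex.norm_exp_ofReal_mul_I]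

theorem expChar_add (η ζ x : 𝔼) : expChar (η + ζ) x = expChar η x * expChar ζ x := by
  unfold expChar
  rw [← Complex.exp_add, inner_add_right]
  congr 1
  push_cast
  ring

theorem continuous_expChar_uncurry : Continuous fun p : 𝔼 × 𝔼 ↦ expChar p.1 p.2 := by
  unfold expChar
  fun_prop

/-- The pairing for which `expChar` is the Fourier kernel. -/
noncomputable def charPairing (m : ℕ) : EuclideanSpace ℝ (Fin m) →L[ℝ]
    EuclideanSpace ℝ (Fin m) →L[ℝ] ℝ :=
  (2 * Real.pi)⁻¹ • innerSL ℝ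

theorem charPairing_apply (η x : 𝔼) :
    charPairing m η x = (2 * Real.pi)⁻¹ * inner ℝ η x := rfl

theorem fourierChar_charPairing (η x : 𝔼) :
    ((Real.fourierChar (-(charPairing m η x)) : Circle) : ℂ) = expChar η x := by
  rw [Real.fourierChar_apply]
  unfold expChar
  congr 1
  rw [charPairing_apply, real_inner_comm η x]
  push_cast
  have : (Real.pi : ℂ) ≠ 0 := by exact_mod_cast Real.pi_ne_zero
  field_simp

theorem norm_charPairing_le : 2 * Real.pi * ‖charPairing m‖ ≤ 1 := by
  have h : ‖charPairing m‖ ≤ (2 * Real.pi)⁻¹ := by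
    refine ContinuousLinearMap.opNorm_le_bound₂ _ (by positivity) fun x y ↦ ?_
    rw [charPairing_apply, norm_mul, Real.norm_of_nonneg (by positivity), mul_assoc]
    gcongr
    exact norm_inner_le_norm x y
  calc _ ≤ 2 * Real.pi * (2 * Real.pi)⁻¹ := by gcongr
    _ = 1 := mul_inv_cancel₀ (by positivity)

/-- The coefficient of `e^{-i x·η}` in its `n`-th derivative. -/
noncomputable def expCharDeriv (n : ℕ) (η : 𝔼) : 𝔼 [×n]→L[ℝ] ℂ :=
  VectorFourier.fourierPowSMulRight (charPairing m) (fun _ ↦ (1 : ℂ)) η n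

theorem continuous_expCharDeriv (n : ℕ) : Continuous (expCharDeriv (m := m) n) :=
  Continuous.fourierPowSMulRight _ continuous_const n

theorem norm_expCharDeriv_le {n N : ℕ} (hn : n ≤ N) (η : 𝔼) :
    ‖expCharDeriv n η‖ ≤ (1 + ‖η‖) ^ N := by
  refine (VectorFourier.norm_fourierPowSMulRight_le _ _ _ _).trans ?_
  calc (2 * Real.pi * ‖charPairing m‖) ^ n * ‖η‖ ^ n * ‖(1 : ℂ)‖
      ≤ 1 ^ n * (1 + ‖η‖) ^ n * 1 := by
        gcongr
        · exact norm_charPairing_le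
        · linarith
        · simp
    _ = (1 + ‖η‖) ^ n := by simp
    _ ≤ (1 + ‖η‖) ^ N := pow_le_pow_right₀ (by linarith [norm_nonneg η]) hn

/-- The character is the Fourier integral of the constant 1 against the Dirac measure at η, so the
general formula for derivatives of Fourier integrals applies. -/
theorem iteratedFDeriv_expChar (n : ℕ) (η x : 𝔼) :
    iteratedFDeriv ℝ n (expChar η) x = expChar η x • expCharDeriv n η := by
  have h := VectorFourier.iteratedFDeriv_fourierIntegral (charPairing m) (μ := Measure.dirac η)
    (f := fun _ ↦ (1 : ℂ)) (N := ⊤) (n := n)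
    (fun n _ ↦ integrable_dirac (by simp)) aestronglyMeasurable_const (by simp)
  have e : VectorFourier.fourierIntegral Real.fourierChar (Measure.dirac η)
      (charPairing m).toLinearMap₁₂ (fun _ ↦ (1 : ℂ)) = expChar η := by
    funext y
    simp only [VectorFourier.fourierIntegral, integral_dirac]
    rw [← fourierChar_charPairing]
    simp [Circle.smul_def]
  rw [e] at h
  rw [h]
  simp only [VectorFourier.fourierIntegral, integral_dirac]
  rw [← fourierChar_charPairing]
  rfl

theorem norm_iteratedFDeriv_expChar_le {n N : ℕ} (hn : n ≤ N) (η x : 𝔼) :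
    ‖iteratedFDeriv ℝ n (expChar η) x‖ ≤ (1 + ‖η‖) ^ N := by
  rw [iteratedFDeriv_expChar, norm_smul, norm_expChar, one_mul]
  exact norm_expCharDeriv_le hn η

/-! ### Products with smooth functions -/

variable (m) in
/-- The space of all smooth complex functions on `ℝᵐ`. -/
def smoothFunctions : Submodule ℂ (EuclideanSpace ℝ (Fin m) → ℂ) where
  carrier := {χ | ContDiff ℝ ∞ χ}
  add_mem' := by
    intro f g (hf : ContDiff ℝ ∞ f) (hg : ContDiff ℝ ∞ g)
    exact hf.add hg
  zero_mem' := show ContDiff ℝ ∞ (fun _ ↦ (0 : ℂ)) from contDiff_const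
  smul_mem' := by
    intro c f (hf : ContDiff ℝ ∞ f)
    exact hf.const_smul c

theorem contDiff_smoothFunction (χ : smoothFunctions m) : ContDiff ℝ ∞ χ.1 := χ.2

/-- The product of a smooth function and a test function. -/
noncomputable def smoothMul (φ : TestFunction Ω ℂ ⊤) : smoothFunctions m →ₗ[ℂ] TestFunction Ω ℂ ⊤ where
  toFun χ :=
    { toFun := fun x ↦ χ.1 x * φ x
      contDiff' := (contDiff_smoothFunction χ).mul φ.contDiff
      hasCompactSupport' := φ.hasCompactSupport.mul_left
      tsupport_subset' := tsupport_mul_subset_right.trans φ.tsupport_subset }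
  map_add' χ χ' := TestFunction.ext fun x ↦ add_mul (χ.1 x) (χ'.1 x) (φ x)
  map_smul' c χ := TestFunction.ext fun x ↦ mul_assoc c (χ.1 x) (φ x)

theorem tsupport_smoothMul (φ : TestFunction Ω ℂ ⊤) (χ : smoothFunctions m) :
    tsupport (smoothMul φ χ) ⊆ tsupport φ := tsupport_mul_subset_right

/-- The character `e^{-i x·η}` as a smooth function. -/
noncomputable def smoothExpChar (η : 𝔼) : smoothFunctions m := ⟨expChar η, contDiff_expChar η⟩

theorem modulate_eq (φ : TestFunction Ω ℂ ⊤) (ξ : 𝔼) :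
    modulate φ ξ = smoothMul φ (smoothExpChar ξ) := rfl

theorem tsupport_modulate (φ : TestFunction Ω ℂ ⊤) (ξ : 𝔼) :
    tsupport (modulate φ ξ) ⊆ tsupport φ := tsupport_smoothMul φ (smoothExpChar ξ)

theorem modulate_smoothMul (φ : TestFunction Ω ℂ ⊤) (χ : smoothFunctions m) (ξ : 𝔼) :
    modulate (smoothMul φ χ) ξ = smoothMul (modulate φ ξ) χ :=
  TestFunction.ext fun x ↦ mul_left_comm (expChar ξ x) (χ.1 x) (φ x)

theorem smoothMul_modulate (φ : TestFunction Ω ℂ ⊤) (ξ η : 𝔼) :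
    smoothMul (modulate φ ξ) (smoothExpChar η) = modulate φ (η + ξ) :=
  TestFunction.ext fun x ↦ by
    change expChar η x * (expChar ξ x * φ x) = expChar (η + ξ) x * φ x
    rw [expChar_add, mul_assoc]

/-- A multiple of a test function has derivatives controlled by those of the factor on the support
of the test function. -/
theorem exists_iteratedFDeriv_smoothMul_le (φ : TestFunction Ω ℂ ⊤) (N : ℕ) :
    ∃ C : ℝ, 0 ≤ C ∧ ∀ (χ : smoothFunctions m) (A : ℝ), 0 ≤ A →
      (∀ n ≤ N, ∀ x ∈ tsupport φ, ‖iteratedFDeriv ℝ n χ.1 x‖ ≤ A) →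
      ∀ n ≤ N, ∀ x, ‖iteratedFDeriv ℝ n (smoothMul φ χ) x‖ ≤ C * A := by
  have hb : ∀ n : ℕ, ∃ D : ℝ, ∀ x, ‖iteratedFDeriv ℝ n φ x‖ ≤ D := fun n ↦
    ((φ.contDiff.continuous_iteratedFDeriv (m := n) (by exact_mod_cast le_top)).norm
      ).bddAbove_range_of_hasCompactSupport (φ.hasCompactSupport.iteratedFDeriv n).norm |>.imp
      fun D hD x ↦ hD ⟨x, rfl⟩
  choose D hD using hb
  have hD0 : ∀ n, 0 ≤ D n := fun n ↦ (norm_nonneg _).trans (hD n 0)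
  set S := ∑ n ∈ Finset.range (N + 1), D n
  have hS : ∀ n ≤ N, D n ≤ S := fun n hn ↦
    Finset.single_le_sum (fun i _ ↦ hD0 i) (Finset.mem_range.2 (by omega))
  have hS0 : 0 ≤ S := Finset.sum_nonneg fun i _ ↦ hD0 i
  refine ⟨2 ^ N * S, by positivity, fun χ A hA0 hA n hn x ↦ ?_⟩
  by_cases hx : x ∈ tsupport φ
  · have h := norm_iteratedFDeriv_mul_le (𝕜 := ℝ) (N := ∞) (contDiff_smoothFunction χ) φ.contDiff x (n := n)
      (by exact_mod_cast le_top)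
    refine h.trans ?_
    calc _ ≤ ∑ i ∈ Finset.range (n + 1), (n.choose i : ℝ) * A * S := by
          refine Finset.sum_le_sum fun i hi ↦ ?_
          have hi' : i ≤ n := by simpa [Nat.lt_succ_iff] using hi
          gcongr
          · exact hA i (by omega) x hx
          · exact (hD (n - i) x).trans (hS _ (by omega))
      _ = 2 ^ n * S * A := by
          rw [← Finset.sum_mul, ← Finset.sum_mul]
          have := Nat.sum_range_choose n
          have h2 : ∑ i ∈ Finset.range (n + 1), (n.choose i : ℝ) = 2 ^ n := by exact_mod_cast this
          rw [h2]; ring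
      _ ≤ 2 ^ N * S * A := by
          gcongr
          norm_num
  · have h0 : iteratedFDeriv ℝ n (smoothMul φ χ) x = 0 := by
      refine image_eq_zero_of_notMem_tsupport fun h ↦ hx ?_
      exact tsupport_smoothMul φ χ (tsupport_iteratedFDeriv_subset n h)
    rw [h0, norm_zero]
    positivity

end TestCalculus

/-! ### Linear forms on test functions: multiplication as convolution of Fourier transforms. -/

section LocalForms

variable {m : ℕ} {Ω : TopologicalSpace.Opens (EuclideanSpace ℝ (Fin m))}

local notation "𝔼" => EuclideanSpace ℝ (Fin m)

/-! ### Jets on compact sets -/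

/-- The space of values of `n`-th derivatives of complex functions on `ℝᵐ`. -/
def DerivSpace (m n : ℕ) : Type := EuclideanSpace ℝ (Fin m) [×n]→L[ℝ] ℂ

noncomputable instance (n : ℕ) : NormedAddCommGroup (DerivSpace m n) :=
  inferInstanceAs (NormedAddCommGroup (𝔼 [×n]→L[ℝ] ℂ))

noncomputable instance (n : ℕ) : NormedSpace ℂ (DerivSpace m n) :=
  inferInstanceAs (NormedSpace ℂ (𝔼 [×n]→L[ℝ] ℂ))

instance (n : ℕ) : CompleteSpace (DerivSpace m n) :=
  inferInstanceAs (CompleteSpace (𝔼 [×n]→L[ℝ] ℂ))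

/-- The jets of order `N` on a set. -/
def JetSpace (K : Set 𝔼) (N : ℕ) : Type := ∀ n : Fin (N + 1), C(K, DerivSpace m n)

noncomputable instance (K : Set 𝔼) (N : ℕ) : AddCommGroup (JetSpace K N) :=
  inferInstanceAs (AddCommGroup (∀ n : Fin (N + 1), C(K, DerivSpace m n)))

noncomputable instance (K : Set 𝔼) (N : ℕ) : Module ℂ (JetSpace K N) :=
  inferInstanceAs (Module ℂ (∀ n : Fin (N + 1), C(K, DerivSpace m n)))

noncomputable instance (K : Set 𝔼) [CompactSpace K] (N : ℕ) : NormedAddCommGroup (JetSpace K N) :=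
  inferInstanceAs (NormedAddCommGroup (∀ n : Fin (N + 1), C(K, DerivSpace m n)))

noncomputable instance (K : Set 𝔼) [CompactSpace K] (N : ℕ) : NormedSpace ℂ (JetSpace K N) :=
  inferInstanceAs (NormedSpace ℂ (∀ n : Fin (N + 1), C(K, DerivSpace m n)))

instance (K : Set 𝔼) [CompactSpace K] (N : ℕ) : CompleteSpace (JetSpace K N) :=
  inferInstanceAs (CompleteSpace (∀ n : Fin (N + 1), C(K, DerivSpace m n)))

/-- The restriction of the jet of order `N` of a smooth function to a set. -/
noncomputable def jet (K : Set 𝔼) (N : ℕ) : smoothFunctions m →ₗ[ℂ] JetSpace K N where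
  toFun χ n := ⟨fun x ↦ iteratedFDeriv ℝ n χ.1 x,
    ((contDiff_smoothFunction χ).continuous_iteratedFDeriv (m := (n : ℕ))
      (by exact_mod_cast le_top)).comp continuous_subtype_val⟩
  map_add' χ χ' := by
    refine funext fun n ↦ ContinuousMap.ext fun x ↦ ?_
    exact iteratedFDeriv_add_apply
      ((contDiff_smoothFunction χ).contDiffAt.of_le (by exact_mod_cast le_top))
      ((contDiff_smoothFunction χ').contDiffAt.of_le (by exact_mod_cast le_top))
  map_smul' c χ := by
    refine funext fun n ↦ ContinuousMap.ext fun x ↦ ?_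
    exact iteratedFDeriv_const_smul_apply
      ((contDiff_smoothFunction χ).contDiffAt.of_le (by exact_mod_cast le_top))

theorem jet_apply (K : Set 𝔼) (N : ℕ) (χ : smoothFunctions m) (n : Fin (N + 1)) (x : K) :
    jet K N χ n x = iteratedFDeriv ℝ n χ.1 x := rfl

theorem norm_jet_le {K : Set 𝔼} [CompactSpace K] {N : ℕ} {χ : smoothFunctions m} {A : ℝ}
    (hA : 0 ≤ A) (h : ∀ n ≤ N, ∀ x ∈ K, ‖iteratedFDeriv ℝ n χ.1 x‖ ≤ A) : ‖jet K N χ‖ ≤ A := by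
  refine (pi_norm_le_iff_of_nonneg (G := fun n : Fin (N + 1) ↦ C(K, DerivSpace m n)) hA).2 fun n ↦ ?_
  rw [ContinuousMap.norm_le _ hA]
  exact fun x ↦ h n (by omega) x x.2

/-- Gives both the continuity of F(φT) and the measurability needed to integrate jets over
frequencies. -/
theorem continuous_jet_smoothExpChar (K : Set 𝔼) [CompactSpace K] (N : ℕ) :
    Continuous fun η : 𝔼 ↦ jet K N (smoothExpChar η) := by
  refine continuous_pi fun n ↦ ContinuousMap.continuous_of_continuous_uncurry _ ?_
  have : (Function.uncurry fun (η : 𝔼) (x : K) ↦ jet K N (smoothExpChar η) n x) =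
      fun p ↦ expChar p.1 p.2 • expCharDeriv n p.1 := by
    funext p
    exact iteratedFDeriv_expChar n p.1 p.2
  rw [this]
  exact (continuous_expChar_uncurry.comp (by fun_prop : Continuous fun p : 𝔼 × K ↦
    (p.1, (p.2 : 𝔼)))).smul ((continuous_expCharDeriv n).comp continuous_fst)

/-- A linear form on the smooth functions that is bounded by the norm of the jet extends to the jet
space. -/
theorem exists_extension_jet {K : Set 𝔼} [CompactSpace K] {N : ℕ} (ℓ : smoothFunctions m →ₗ[ℂ] ℂ)
    {C : ℝ} (h : ∀ χ, ‖ℓ χ‖ ≤ C * ‖jet K N χ‖) :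
    ∃ g : JetSpace K N →L[ℂ] ℂ, ∀ χ, g (jet K N χ) = ℓ χ := by
  have hker : LinearMap.ker (jet K N) ≤ LinearMap.ker ℓ := by
    intro χ hχ
    have h1 := h χ
    rw [LinearMap.mem_ker.1 hχ, norm_zero, mul_zero] at h1
    exact norm_le_zero_iff.1 h1
  -- The bound makes ℓ factor through the range of `jet`; Hahn–Banach then extends it to the Banach
  -- space of jets.
  let ℓ' : LinearMap.range (jet K N) →ₗ[ℂ] ℂ :=
    ((LinearMap.ker (jet K N)).liftQ ℓ hker) ∘ₗ (jet K N).quotKerEquivRange.symm.toLinearMap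
  have hℓ' : ∀ χ, ℓ' ⟨jet K N χ, χ, rfl⟩ = ℓ χ := by
    intro χ
    have : (⟨jet K N χ, χ, rfl⟩ : LinearMap.range (jet K N)) =
        (jet K N).quotKerEquivRange (Submodule.Quotient.mk χ) := rfl
    simp only [ℓ', LinearMap.comp_apply, LinearEquiv.coe_coe, this, LinearEquiv.symm_apply_apply]
    rfl
  let L := ℓ'.mkContinuous C (by
    rintro ⟨_, χ, rfl⟩
    rw [hℓ']
    exact h χ)
  obtain ⟨g, hg, -⟩ := exists_extension_norm_eq _ L
  exact ⟨g, fun χ ↦ (hg ⟨jet K N χ, χ, rfl⟩).trans (hℓ' χ)⟩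

/-! ### Fourier expansion of a smooth function with compact support -/

theorem SchwartzMap.isRapidKernel_norm (κ : SchwartzMap 𝔼 ℂ) : IsRapidKernel fun η ↦ ‖κ η‖ where
  nonneg _ := norm_nonneg _
  measurable := κ.continuous.norm.measurable
  decay n := ⟨2 ^ n * ((Finset.Iic (n, 0)).sup fun p ↦ SchwartzMap.seminorm ℝ p.1 p.2) κ, fun ζ ↦ by
    have := SchwartzMap.one_add_le_sup_seminorm_apply (𝕜 := ℝ) (m := (n, 0)) (k := n) (n := 0)
      le_rfl le_rfl κ ζ
    rwa [norm_iteratedFDeriv_zero, mul_comm] at this⟩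

/-- Fourier inversion. The substitution ζ = η/(2π) converts the kernel e^{-2πi x·ζ} into e^{-i x·η}
and contributes the Jacobian (2π)^{-m}. -/
theorem SchwartzMap.exists_eq_integral_expChar (ψ : SchwartzMap 𝔼 ℂ) : ∃ κ : SchwartzMap 𝔼 ℂ,
    (ψ : 𝔼 → ℂ) = VectorFourier.fourierIntegral Real.fourierChar volume
      (charPairing m).toLinearMap₁₂ κ := by
  open scoped FourierTransform in
  let g : SchwartzMap 𝔼 ℂ := 𝓕⁻ ψ
  have h2 : (2 * Real.pi)⁻¹ ≠ 0 := by positivity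
  let e : 𝔼 ≃L[ℝ] 𝔼 := ContinuousLinearEquiv.smulLeft (Units.mk0 _ h2)
  let c : ℝ := (2 * Real.pi)⁻¹ ^ m
  refine ⟨(c : ℂ) • SchwartzMap.compCLMOfContinuousLinearEquiv ℂ e g, ?_⟩
  funext x
  have hψ : ψ = FourierTransform.fourier g := (FourierTransform.fourier_fourierInv_eq ψ).symm
  have hx : ψ x = ∫ ζ, Real.fourierChar (-(inner ℝ ζ x)) • g ζ := by
    conv_lhs => rw [hψ]
    rw [SchwartzMap.fourier_coe, Real.fourier_eq]
  have hs := Measure.integral_comp_smul (volume : Measure 𝔼)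
    (fun ζ ↦ Real.fourierChar (-(inner ℝ ζ x)) • g ζ) (2 * Real.pi)⁻¹
  rw [finrank_euclideanSpace_fin, abs_of_pos (by positivity), ← hx] at hs
  simp only [VectorFourier.fourierIntegral]
  have hc : 0 < c := by positivity
  have : ψ x = (c : ℂ) * (c⁻¹ • ψ x) := by
    rw [Complex.real_smul, ← mul_assoc, ← Complex.ofReal_mul, mul_inv_cancel₀ hc.ne']; simp
  rw [this, ← hs, ← integral_const_mul]
  congr 1 with η
  simp only [ContinuousLinearMap.toLinearMap₁₂_apply_apply_apply, charPairing_apply,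
    real_inner_smul_left]
  simp only [Circle.smul_def, smul_eq_mul, smul_apply]
  rw [mul_left_comm]
  rfl

theorem SchwartzMap.integrable_norm_mul_pow (κ : SchwartzMap 𝔼 ℂ) (N : ℕ) :
    Integrable fun η ↦ ‖κ η‖ * (1 + ‖η‖) ^ N := by
  obtain ⟨D, hD⟩ := κ.isRapidKernel_norm.decay (N + (m + 1))
  have h := (integrable_one_add_norm (E := 𝔼) (μ := volume) (r := ((m + 1 : ℕ) : ℝ))
    (by rw [finrank_euclideanSpace_fin]; push_cast; linarith)).const_mul D
  refine h.mono' (Continuous.aestronglyMeasurable (by have := κ.continuous; fun_prop))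
    (Eventually.of_forall fun η ↦ ?_)
  rw [Real.norm_of_nonneg (by positivity), Real.rpow_neg (by positivity), Real.rpow_natCast,
    ← div_eq_mul_inv, le_div_iff₀ (by positivity), mul_assoc, ← pow_add]
  exact hD η

theorem integrable_smul_jet_smoothExpChar (K : Set 𝔼) [CompactSpace K] (N : ℕ)
    (κ : SchwartzMap 𝔼 ℂ) : Integrable fun η ↦ κ η • jet K N (smoothExpChar η) := by
  refine (κ.integrable_norm_mul_pow N).mono'
    (κ.continuous.smul (continuous_jet_smoothExpChar K N)).aestronglyMeasurable
    (Eventually.of_forall fun η ↦ ?_)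
  rw [norm_smul]
  gcongr
  exact norm_jet_le (by positivity) fun n hn x _ ↦ norm_iteratedFDeriv_expChar_le hn η x

/-- Differentiation under the integral sign, organised as a Bochner integral in the jet space, so
that a continuous linear form on jets may be taken inside the integral. -/
theorem jet_eq_integral (K : Set 𝔼) [CompactSpace K] (N : ℕ) {κ : SchwartzMap 𝔼 ℂ}
    {ψ : smoothFunctions m} (h : ψ.1 = VectorFourier.fourierIntegral Real.fourierChar volume
      (charPairing m).toLinearMap₁₂ κ) :
    jet K N ψ = ∫ η, κ η • jet K N (smoothExpChar η) := by
  have hi := integrable_smul_jet_smoothExpChar K N κ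
  refine funext fun n ↦ ContinuousMap.ext fun x ↦ ?_
  let ev : JetSpace K N →L[ℂ] DerivSpace m n := (ContinuousMap.evalCLM ℂ x).comp
    (ContinuousLinearMap.proj (R := ℂ) (φ := fun n : Fin (N + 1) ↦ C(K, DerivSpace m n)) n)
  have hev : (∫ η, κ η • jet K N (smoothExpChar η)) n x =
      ∫ η, ev (κ η • jet K N (smoothExpChar η)) := (ev.integral_comp_comm hi).symm
  refine Eq.trans ?_ hev.symm
  rw [jet_apply, h,
    VectorFourier.iteratedFDeriv_fourierIntegral (N := ⊤) (charPairing m) (fun n _ ↦ by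
      simpa using κ.integrable_pow_mul volume n) κ.continuous.aestronglyMeasurable (by simp)]
  simp only [VectorFourier.fourierIntegral]
  congr 1 with η : 1
  change _ = κ η • iteratedFDeriv ℝ n (expChar η) x
  rw [iteratedFDeriv_expChar, ← fourierChar_charPairing, smul_comm]
  ext v
  simp [expCharDeriv, Circle.smul_def]
  ring

/-! ### Locally uniformly bounded families of linear forms -/

/-- A set of linear forms on test functions that satisfies on each compact set a common continuity
estimate. -/
def LocallyUniformlyBounded (𝓣 : Set (TestFunction Ω ℂ ⊤ →ₗ[ℂ] ℂ)) : Prop :=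
  ∀ K : Set 𝔼, IsCompact K → K ⊆ Ω → ∃ (N : ℕ) (C : ℝ), 0 ≤ C ∧
    ∀ T ∈ 𝓣, ∀ φ : TestFunction Ω ℂ ⊤, tsupport φ ⊆ K → ∀ A : ℝ, 0 ≤ A →
      (∀ n ≤ N, ∀ x, ‖iteratedFDeriv ℝ n φ x‖ ≤ A) → ‖T φ‖ ≤ C * A

variable {𝓣 : Set (TestFunction Ω ℂ ⊤ →ₗ[ℂ] ℂ)}

theorem LocallyUniformlyBounded.exists_smoothMul_le (h : LocallyUniformlyBounded 𝓣)
    (φ : TestFunction Ω ℂ ⊤) : ∃ (N : ℕ) (C : ℝ), 0 ≤ C ∧ ∀ T ∈ 𝓣, ∀ (χ : smoothFunctions m)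
      (A : ℝ), 0 ≤ A → (∀ n ≤ N, ∀ x ∈ tsupport φ, ‖iteratedFDeriv ℝ n χ.1 x‖ ≤ A) →
        ‖T (smoothMul φ χ)‖ ≤ C * A := by
  obtain ⟨N, C, hC, hT⟩ := h _ φ.hasCompactSupport.isCompact φ.tsupport_subset
  obtain ⟨D, hD, hφ⟩ := exists_iteratedFDeriv_smoothMul_le φ N
  refine ⟨N, C * D, by positivity, fun T hT' χ A hA hχ ↦ ?_⟩
  rw [mul_assoc]
  exact hT T hT' _ (tsupport_smoothMul φ χ) _ (by positivity) (hφ χ A hA hχ)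

/-- Each derivative of the character costs one factor of size at most 1 + |ξ|, so the order of the
common continuity estimate is the order of growth. The bound is the same for all T, as the
convolution estimate requires. -/
theorem LocallyUniformlyBounded.exists_localFourier_le (h : LocallyUniformlyBounded 𝓣)
    (φ : TestFunction Ω ℂ ⊤) : ∃ (N : ℕ) (C : ℝ), 0 ≤ C ∧ ∀ T ∈ 𝓣, ∀ ξ,
      ‖localFourier T φ ξ‖ ≤ C * (1 + ‖ξ‖) ^ N := by
  obtain ⟨N, C, hC, hT⟩ := h.exists_smoothMul_le φ
  exact ⟨N, C, hC, fun T hT' ξ ↦ hT T hT' (smoothExpChar ξ) _ (by positivity)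
    fun n hn x _ ↦ norm_iteratedFDeriv_expChar_le hn ξ x⟩

/-- A mere linear form cannot be exchanged with an integral; this realises χ ↦ T(φχ) as a continuous
form on a Banach space. -/
theorem LocallyUniformlyBounded.exists_jet (h : LocallyUniformlyBounded 𝓣)
    (φ : TestFunction Ω ℂ ⊤) [CompactSpace (tsupport φ)] {T} (hT : T ∈ 𝓣) :
    ∃ (N : ℕ) (g : JetSpace (tsupport φ) N →L[ℂ] ℂ), ∀ χ,
      g (jet (tsupport φ) N χ) = T (smoothMul φ χ) := by
  obtain ⟨N, C, hC, hT'⟩ := h.exists_smoothMul_le φ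
  refine ⟨N, exists_extension_jet (T ∘ₗ smoothMul φ) (C := C) fun χ ↦ ?_⟩
  refine hT' T hT χ _ (norm_nonneg _) fun n hn x hx ↦ ?_
  have h1 := norm_le_pi_norm (jet (tsupport φ) N χ) ⟨n, by omega⟩
  exact ((jet (tsupport φ) N χ ⟨n, by omega⟩).norm_coe_le_norm ⟨x, hx⟩).trans h1

theorem LocallyUniformlyBounded.continuous_localFourier (h : LocallyUniformlyBounded 𝓣)
    (φ : TestFunction Ω ℂ ⊤) {T} (hT : T ∈ 𝓣) : Continuous (localFourier T φ) := by
  have : CompactSpace (tsupport φ) := isCompact_iff_compactSpace.1 φ.hasCompactSupport.isCompact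
  obtain ⟨N, g, hg⟩ := h.exists_jet φ hT
  have e : localFourier T φ = fun ξ ↦ g (jet (tsupport φ) N (smoothExpChar ξ)) := by
    funext ξ
    rw [hg, ← modulate_eq]
    rfl
  rw [e]
  exact g.continuous.comp (continuous_jet_smoothExpChar _ N)

/-- The Fourier transform of a product `ψ φ T` is a convolution. -/
theorem LocallyUniformlyBounded.localFourier_smoothMul (h : LocallyUniformlyBounded 𝓣)
    (φ : TestFunction Ω ℂ ⊤) {κ : SchwartzMap 𝔼 ℂ} {ψ : smoothFunctions m}
    (hψ : ψ.1 = VectorFourier.fourierIntegral Real.fourierChar volume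
      (charPairing m).toLinearMap₁₂ κ) {T} (hT : T ∈ 𝓣) (ξ : 𝔼) :
    localFourier T (smoothMul φ ψ) ξ = ∫ η, κ η * localFourier T φ (η + ξ) := by
  have : CompactSpace (tsupport (modulate φ ξ)) :=
    isCompact_iff_compactSpace.1 (modulate φ ξ).hasCompactSupport.isCompact
  obtain ⟨N, g, hg⟩ := h.exists_jet (modulate φ ξ) hT
  unfold localFourier
  rw [modulate_smoothMul, ← hg, jet_eq_integral _ N hψ,
    ← g.integral_comp_comm (integrable_smul_jet_smoothExpChar _ N κ)]
  congr 1 with η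
  rw [map_smul, hg, smoothMul_modulate, smul_eq_mul]

/-- The kernel depends on ψ alone, hence serves all T at once. -/
theorem LocallyUniformlyBounded.exists_kernel (h : LocallyUniformlyBounded 𝓣)
    (φ : TestFunction Ω ℂ ⊤) (ψ : smoothFunctions m) (hψ : HasCompactSupport ψ.1) :
    ∃ κ : 𝔼 → ℝ, IsRapidKernel κ ∧ ∀ T ∈ 𝓣, ∀ ξ, ‖localFourier T (smoothMul φ ψ) ξ‖ₑ ≤
      ∫⁻ η, ENNReal.ofReal (κ (η - ξ)) * ‖localFourier T φ η‖ₑ := by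
  obtain ⟨κ, hκ⟩ := (hψ.toSchwartzMap (contDiff_smoothFunction ψ)).exists_eq_integral_expChar
  refine ⟨_, κ.isRapidKernel_norm, fun T hT ξ ↦ ?_⟩
  rw [h.localFourier_smoothMul φ (ψ := ψ) hκ hT ξ]
  refine (enorm_integral_le_lintegral_enorm _).trans (le_of_eq ?_)
  rw [← lintegral_sub_right_eq_self _ ξ]
  congr 1 with η
  rw [enorm_mul, sub_add_cancel, ofReal_norm]

/-- Uniform tails survive a further localisation: the kernel spreads frequencies only a little, and
the common polynomial bound controls what comes from outside V. -/
theorem LocallyUniformlyBounded.uniformTails_smoothMul (h : LocallyUniformlyBounded 𝓣)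
    (φ : TestFunction Ω ℂ ⊤) (ψ : smoothFunctions m) (hψ : HasCompactSupport ψ.1) {r : ℝ}
    {V W : Set 𝔼} (hV : MeasurableSet V) (hW : MeasurableSet W) {ε : ℝ} (hε : 0 < ε)
    (hsep : ∀ ξ ∈ W, ∀ ζ ∉ V, ε * ‖ξ‖ ≤ ‖ξ - ζ‖)
    (ht : UniformTails r V fun T : 𝓣 ↦ localFourier T.1 φ) :
    UniformTails r W fun T : 𝓣 ↦ localFourier T.1 (smoothMul φ ψ) := by
  obtain ⟨κ, hκ, hle⟩ := h.exists_kernel φ ψ hψ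
  obtain ⟨N, C, -, hC⟩ := h.exists_localFourier_le φ
  exact UniformTails.conv hV hW hε hsep (fun T ↦ (h.continuous_localFourier φ T.2).measurable)
    (fun T ↦ hC T.1 T.2) hκ (fun T ↦ hle T.1 T.2) ht

end LocalForms

/-! ### From microlocal conditions at points to tails over compact sets of points and directions. -/

section LocalRegularity

variable {m : ℕ} {Ω : TopologicalSpace.Opens (EuclideanSpace ℝ (Fin m))}

local notation "𝔼" => EuclideanSpace ℝ (Fin m)

variable {𝓣 : Set (TestFunction Ω ℂ ⊤ →ₗ[ℂ] ℂ)} {r : ℝ}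

theorem iSup_image_weightedEnergy (φ : TestFunction Ω ℂ ⊤) (V : Set 𝔼) :
    ⨆ f ∈ (fun T ↦ localFourier T φ) '' 𝓣, weightedEnergy r V f =
      ⨆ T : 𝓣, weightedEnergy r V (localFourier T.1 φ) := by
  rw [iSup_image, iSup_subtype']

theorem notMem_sigmaCompactAt {x η : 𝔼} (hη : η ≠ 0) : η ∉ sigmaCompactAt r 𝓣 x ↔
    ∃ φ : TestFunction Ω ℂ ⊤, φ x ≠ 0 ∧ ∃ V : Set 𝔼, IsOpen V ∧ IsConeSet V ∧ 0 ∉ V ∧ η ∈ V ∧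
      UniformTails r V fun T : 𝓣 ↦ localFourier T.1 φ := by
  simp only [sigmaCompactAt, sigmaCompact, mem_iInter, mem_ofPred_eq, not_forall, not_and, not_not,
    iSup_image_weightedEnergy, UniformTails]
  exact ⟨fun ⟨φ, h, hV⟩ ↦ ⟨φ, h, hV hη⟩, fun ⟨φ, h, hV⟩ ↦ ⟨φ, h, fun _ ↦ hV⟩⟩

/-- A test function whose support is covered by the sets `{φ l ≠ 0}` is a combination of the `φ l`
with smooth compactly supported coefficients. -/
theorem exists_eq_sum_smoothMul {ι : Type*} (s : Finset ι) (φ' : ι → TestFunction Ω ℂ ⊤)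
    (φ : TestFunction Ω ℂ ⊤) (h : ∀ x ∈ tsupport φ, ∃ l ∈ s, φ' l x ≠ 0) :
    ∃ ψ : ι → smoothFunctions m, (∀ l, HasCompactSupport (ψ l).1) ∧
      φ = ∑ l ∈ s, smoothMul (φ' l) (ψ l) := by
  -- Here g = ∑ |φ'_l|² is positive on supp φ, so the coefficients φ · conj(φ'_l)/g are smooth and
  -- no partition of unity is needed.
  let g : 𝔼 → ℂ := fun x ↦ ∑ l ∈ s, starRingEnd ℂ (φ' l x) * φ' l x
  have hconj : ∀ l, ContDiff ℝ ∞ fun x ↦ starRingEnd ℂ (φ' l x) := fun l ↦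
    Complex.conjCLE.contDiff.comp (φ' l).contDiff
  have hg : ContDiff ℝ ∞ g := ContDiff.sum fun l _ ↦ (hconj l).mul (φ' l).contDiff
  have hg0 : ∀ x ∈ tsupport φ, g x ≠ 0 := by
    intro x hx h0
    obtain ⟨l, hl, hlx⟩ := h x hx
    have e : g x = ((∑ l ∈ s, Complex.normSq (φ' l x) : ℝ) : ℂ) := by
      simp only [g, Complex.ofReal_sum, Complex.normSq_eq_conj_mul_self]
    rw [e, Complex.ofReal_eq_zero, Finset.sum_eq_zero_iff_of_nonneg
      fun i _ ↦ Complex.normSq_nonneg _] at h0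
    exact hlx (Complex.normSq_eq_zero.1 (h0 l hl))
  have hs : ∀ l, ContDiff ℝ ∞ fun x ↦ φ x * (starRingEnd ℂ (φ' l x) * (g x)⁻¹) := by
    intro l
    rw [contDiff_iff_contDiffAt]
    intro x
    by_cases hx : x ∈ tsupport φ
    · exact φ.contDiff.contDiffAt.mul ((hconj l).contDiffAt.mul (hg.contDiffAt.inv (hg0 x hx)))
    · refine ContDiffAt.congr_of_eventuallyEq (contDiffAt_const (c := 0)) ?_
      filter_upwards [notMem_tsupport_iff_eventuallyEq.1 hx] with y hy
      rw [hy, Pi.zero_apply, zero_mul]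
  refine ⟨fun l ↦ ⟨_, hs l⟩, fun l ↦ φ.hasCompactSupport.mul_right, TestFunction.ext fun x ↦ ?_⟩
  have e : (∑ l ∈ s, smoothMul (φ' l) ⟨_, hs l⟩) x =
      ∑ l ∈ s, φ x * (starRingEnd ℂ (φ' l x) * (g x)⁻¹) * φ' l x := by
    rw [FunLike.coe_sum, Finset.sum_apply]
    rfl
  rw [e]
  by_cases hx : x ∈ tsupport φ
  · have e2 : ∑ l ∈ s, φ x * (starRingEnd ℂ (φ' l x) * (g x)⁻¹) * φ' l x = φ x * (g x * (g x)⁻¹) := by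
      rw [Finset.sum_mul, Finset.mul_sum]
      exact Finset.sum_congr rfl fun l _ ↦ by ring
    rw [e2, mul_inv_cancel₀ (hg0 x hx), mul_one]
  · simp [image_eq_zero_of_notMem_tsupport hx]

theorem localFourier_sum {ι : Type*} (T : TestFunction Ω ℂ ⊤ →ₗ[ℂ] ℂ) (s : Finset ι)
    (φ : ι → TestFunction Ω ℂ ⊤) :
    localFourier T (∑ l ∈ s, φ l) = ∑ l ∈ s, localFourier T (φ l) := by
  funext ξ
  rw [Finset.sum_apply]
  unfold localFourier
  rw [← map_sum]
  congr 1
  refine TestFunction.ext fun x ↦ ?_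
  change expChar ξ x * (∑ l ∈ s, φ l) x = _
  rw [FunLike.coe_sum, Finset.sum_apply, FunLike.coe_sum, Finset.sum_apply, Finset.mul_sum]
  rfl

/-- Compactness in the base, for a fixed direction: finitely many of the local test functions
suffice on supp φ, and finitely many open cones around ν contain a common ball. -/
theorem LocallyUniformlyBounded.exists_unitCone (h : LocallyUniformlyBounded 𝓣)
    (φ : TestFunction Ω ℂ ⊤) {ν : 𝔼} (hν : ‖ν‖ = 1)
    (hs : ∀ x ∈ tsupport φ, ν ∉ sigmaCompactAt r 𝓣 x) :
    ∃ ε > 0, UniformTails r (unitCone ν ε) fun T : 𝓣 ↦ localFourier T.1 φ := by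
  have hν0 : ν ≠ 0 := by rintro rfl; simp at hν
  have h1 : ∀ x : tsupport φ, _ := fun x ↦ (notMem_sigmaCompactAt hν0).1 (hs x.1 x.2)
  choose φ' hφ' V hVo hVc _ hνV hV using h1
  obtain ⟨s, hsc⟩ := φ.hasCompactSupport.isCompact.elim_finite_subcover
    (fun l ↦ {x | φ' l x ≠ 0}) (fun l ↦ isOpen_ne_fun (φ' l).continuous continuous_const)
    fun x hx ↦ mem_iUnion.2 ⟨⟨x, hx⟩, hφ' ⟨x, hx⟩⟩
  obtain ⟨ψ, hψ, hφ⟩ := exists_eq_sum_smoothMul s φ' φ fun x hx ↦ by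
    simpa using hsc hx
  have hVs : (⋂ l ∈ s, V l) ∈ 𝓝 ν :=
    (biInter_finset_mem s).2 fun l _ ↦ (hVo l).mem_nhds (hνV l)
  obtain ⟨δ, hδ, hball⟩ := Metric.mem_nhds_iff.1 hVs
  -- Half of δ, because separating `unitCone ν ε` from the complement of a cone needs a ball of
  -- radius 2ε.
  refine ⟨δ / 2, by positivity, ?_⟩
  have hsum : (fun T : 𝓣 ↦ localFourier T.1 φ) =
      ∑ l ∈ s, fun T : 𝓣 ↦ localFourier T.1 (smoothMul (φ' l) (ψ l)) := by
    funext T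
    rw [Finset.sum_apply, ← localFourier_sum, ← hφ]
  rw [hsum]
  refine UniformTails.sum s (fun l T ↦ (h.continuous_localFourier _ T.2).measurable) fun l hl ↦ ?_
  refine h.uniformTails_smoothMul (φ' l) (ψ l) (hψ l) (hVo l).measurableSet
    (isClosed_unitCone ν _).measurableSet (half_pos hδ) (fun ξ hξ ζ hζ ↦ ?_) (hV l)
  refine unitCone_separated (hVc l) (half_pos hδ) ?_ hξ hζ
  rw [mul_div_cancel₀ _ two_ne_zero]
  exact hball.trans (biInter_subset_of_mem hl)

/-- If a closed cone avoids the compactness wave front set over the support of `φ`, then the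
energies in the cone of the Fourier transforms of `φ T` have uniformly small tails. -/
theorem LocallyUniformlyBounded.uniformTails (h : LocallyUniformlyBounded 𝓣)
    (φ : TestFunction Ω ℂ ⊤) {V : Set 𝔼} (hV : IsClosed V) (hVc : IsConeSet V)
    (hs : ∀ x ∈ tsupport φ, ∀ η ∈ V, η ≠ 0 → η ∉ sigmaCompactAt r 𝓣 x) :
    UniformTails r V fun T : 𝓣 ↦ localFourier T.1 φ := by
  -- Compactness in the directions: finitely many of the small cones cover V apart from 0, which
  -- does not occur in a tail with R ≥ 0.
  have hK : IsCompact (V ∩ Metric.sphere 0 1) := (isCompact_sphere _ _).inter_left hV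
  have h1 : ∀ ν : ↥(V ∩ Metric.sphere (0 : 𝔼) 1), ∃ ε > 0, UniformTails r (unitCone ν.1 ε)
      fun T : 𝓣 ↦ localFourier T.1 φ := by
    rintro ⟨ν, hνV, hν⟩
    have hν1 : ‖ν‖ = 1 := by simpa using hν
    exact h.exists_unitCone φ hν1 fun x hx ↦ hs x hx ν hνV (norm_pos_iff.1 (hν1 ▸ one_pos))
  choose ε hε hT using h1
  obtain ⟨s, hsc⟩ := hK.elim_finite_subcover 
    (fun ν : ↥(V ∩ Metric.sphere (0 : 𝔼) 1) ↦ Metric.ball ν.1 (ε ν))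
    (fun ν ↦ Metric.isOpen_ball)
    fun ν hν ↦ mem_iUnion.2 ⟨⟨ν, hν⟩, Metric.mem_ball_self (hε ⟨ν, hν⟩)⟩
  have hU := UniformTails.biUnion s fun ν _ ↦ hT ν
  refine .of_le hU ?_
  filter_upwards [eventually_ge_atTop 0] with R hR T
  refine le_trans (weightedEnergy_mono r ?_ _) (le_iSup (fun T : 𝓣 ↦
    weightedEnergy r ((⋃ ν ∈ s, unitCone ν.1 (ε ν)) ∩ {ξ | R < ‖ξ‖}) (localFourier T.1 φ)) T)
  intro ξ hξ
  refine ⟨?_, hξ.2⟩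
  have hpos : 0 < ‖ξ‖ := hR.trans_lt hξ.2
  have hmem : ‖ξ‖⁻¹ • ξ ∈ V ∩ Metric.sphere 0 1 := by
    refine ⟨hVc ξ hξ.1 _ (by positivity), ?_⟩
    rw [mem_sphere_zero_iff_norm, norm_smul, norm_inv, norm_norm, inv_mul_cancel₀ hpos.ne']
  obtain ⟨ν, hν, hb⟩ := mem_iUnion₂.1 (hsc hmem)
  refine mem_iUnion₂.2 ⟨ν, hν, ?_⟩
  have e : ξ - ‖ξ‖ • ν.1 = ‖ξ‖ • (‖ξ‖⁻¹ • ξ - ν.1) := by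
    rw [smul_sub, smul_smul, mul_inv_cancel₀ hpos.ne', one_smul]
  change ‖ξ - ‖ξ‖ • ν.1‖ ≤ ε ν * ‖ξ‖
  rw [e, norm_smul, norm_norm, mul_comm]
  gcongr
  exact (mem_ball_iff_norm.1 hb).le

/-- The tails of a function of finite energy tend to zero; hence the compactness wave front set of
a single distribution is contained in its Sobolev wave front set. -/
theorem sigmaCompactAt_singleton_subset (T : TestFunction Ω ℂ ⊤ →ₗ[ℂ] ℂ) (x : 𝔼) :
    sigmaCompactAt r {T} x ⊆ sigmaAt r T x ∪ {0} := by
  intro η hη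
  by_contra hn
  -- The point 0 is treated separately because `sigmaCompactAt` is an intersection over test
  -- functions with φ x ≠ 0, hence everything when x is outside Ω.
  rw [mem_union, mem_singleton_iff, not_or] at hn
  obtain ⟨hn, h0⟩ := hn
  have : ∃ (V : Set 𝔼) (φ : TestFunction Ω ℂ ⊤), IsOpen V ∧ IsConeSet V ∧ η ∈ V ∧ φ x ≠ 0 ∧
      weightedEnergy r V (localFourier T φ) < (⊤ : ℝ≥0∞) := by
    by_contra hc
    exact hn ⟨h0, hc⟩
  obtain ⟨V, φ, hVo, hVc, hηV, hφ, hE⟩ := this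
  refine (notMem_sigmaCompactAt h0).2 ⟨φ, hφ, V \ {0}, hVo.sdiff isClosed_singleton, ?_, by simp,
    ⟨hηV, h0⟩, ?_⟩ hη
  · rintro ξ ⟨hξ, hξ0⟩ t ht
    exact ⟨hVc ξ hξ t ht, by simpa [ht.ne'] using hξ0⟩
  · have hm : MeasurableSet (V \ {0}) := (hVo.sdiff isClosed_singleton).measurableSet
    refine .of_le (tendsto_lintegral_norm_gt hm
      (g := fun ξ ↦ ENNReal.ofReal (‖localFourier T φ ξ‖ ^ 2 * (1 + ‖ξ‖ ^ 2) ^ r)) ?_)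
      (Eventually.of_forall ?_)
    · exact (lt_of_le_of_lt (lintegral_mono_set sdiff_subset) hE).ne
    · rintro R ⟨_, rfl⟩
      exact le_rfl

end LocalRegularity

/-! ### Densities and components of sections under changes of bundle chart. -/

section ChartChange

variable {m : ℕ} {M : Type*} [TopologicalSpace M] [ChartedSpace (EuclideanSpace ℝ (Fin m)) M]

local notation "𝔼" => EuclideanSpace ℝ (Fin m)

/-! ### Coordinate frames and densities -/

theorem mfderiv_coordVec_self {x : OpenPartialHomeomorph M 𝔼}
    (hx : x ∈ IsManifold.maximalAtlas (𝓡 m) ∞ M) {p : M} (hp : p ∈ x.source) (i : Fin m) :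
    (mfderiv (𝓡 m) (𝓡 m) x p (coordVec x p i) : 𝔼) = EuclideanSpace.single i (1 : ℝ) := by
  have hy := x.map_source hp
  have h := mfderiv_coordVec hx hx hy (by rwa [x.left_inv hp]) i
  rw [x.left_inv hp] at h
  have h2 : x ∘ x.symm =ᶠ[𝓝 (x p)] id := by
    filter_upwards [x.open_target.mem_nhds hy] with z hz
    exact x.right_inv hz
  rw [h, h2.fderiv_eq, fderiv_id]
  rfl

/-- The linear map that sends the coordinate frame of a chart to a given family of vectors. -/
noncomputable def frameMap (x : OpenPartialHomeomorph M 𝔼) (p : M)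
    (v : Fin m → TangentSpace (𝓡 m) p) : TangentSpace (𝓡 m) p →ₗ[ℝ] TangentSpace (𝓡 m) p :=
  ((EuclideanSpace.basisFun (Fin m) ℝ).toBasis.constr ℝ v) ∘ₗ
    (mfderiv (𝓡 m) (𝓡 m) x p).toLinearMap

theorem frameMap_coordVec {x : OpenPartialHomeomorph M 𝔼}
    (hx : x ∈ IsManifold.maximalAtlas (𝓡 m) ∞ M) {p : M} (hp : p ∈ x.source)
    (v : Fin m → TangentSpace (𝓡 m) p) (i : Fin m) : frameMap x p v (coordVec x p i) = v i := by
  have h := mfderiv_coordVec_self hx hp i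
  refine (congrArg ((EuclideanSpace.basisFun (Fin m) ℝ).toBasis.constr ℝ v) h).trans ?_
  have h2 : (EuclideanSpace.basisFun (Fin m) ℝ).toBasis i = EuclideanSpace.single i (1 : ℝ) := by
    simp
  rw [← h2]
  exact Module.Basis.constr_basis _ _ _ _

/-- A density is determined by its value on one frame, since every family of m vectors is the image
of that frame under a linear map. -/
theorem densitySpace_apply {x : OpenPartialHomeomorph M 𝔼}
    (hx : x ∈ IsManifold.maximalAtlas (𝓡 m) ∞ M) {p : M} (hp : p ∈ x.source)
    (δ : densitySpace m (TangentSpace (𝓡 m) p)) (v : Fin m → TangentSpace (𝓡 m) p) :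
    δ.1 v = ((|LinearMap.det (frameMap x p v)| : ℝ) : ℂ) * δ.1 (coordVec x p) := by
  have h := δ.2 (frameMap x p v) (coordVec x p)
  simp only [frameMap_coordVec hx hp] at h
  exact h

/-- By the one-dimensionality of densities it suffices to compare δ with λˣ, whose value on the
frame of x is 1 and on that of x' the Jacobian factor. -/
theorem densitySpace_coordVec {x x' : OpenPartialHomeomorph M 𝔼}
    (hx : x ∈ IsManifold.maximalAtlas (𝓡 m) ∞ M) (hx' : x' ∈ IsManifold.maximalAtlas (𝓡 m) ∞ M)
    {y : 𝔼} (hy : y ∈ x'.target) (hp : x'.symm y ∈ x.source)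
    (δ : densitySpace m (TangentSpace (𝓡 m) (x'.symm y))) :
    δ.1 (coordVec x' (x'.symm y)) =
      ((|LinearMap.det (fderiv ℝ (x ∘ x'.symm) y).toLinearMap| : ℝ) : ℂ) *
        δ.1 (coordVec x (x'.symm y)) := by
  rw [densitySpace_apply hx hp δ, ← chartDensity_coordVec' hx hx' hy hp,
    densitySpace_apply hx hp (chartDensity x (x'.symm y)), chartDensity_coordVec hx hp, mul_one]

/-! ### Components in different bundle charts -/

variable {k : ℕ} {E : M → Type*} [TopologicalSpace (TotalSpace (Fin k → ℂ) E)]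
  [∀ p, AddCommGroup (E p)] [∀ p, Module ℂ (E p)] [∀ p, TopologicalSpace (E p)]
  [FiberBundle (Fin k → ℂ) E]

theorem exists_bundleChart [IsManifold (𝓡 m) ∞ M] [VectorBundle ℂ (Fin k → ℂ) E]
    [ContMDiffVectorBundle ∞ (Fin k → ℂ) E (𝓡 m)] (p : M) :
    ∃ Φ : BundleChart m k E, p ∈ Φ.chart.source := by
  let e := trivializationAt (Fin k → ℂ) E p
  let x := chartAt 𝔼 p
  refine ⟨⟨x.restr e.baseSet, restr_mem_maximalAtlas _ (IsManifold.chart_mem_maximalAtlas p)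
    e.open_baseSet, e, inferInstance, e.contMDiffOn, e.contMDiffOn_symm, ?_⟩, ?_⟩
  · rw [x.restr_source' _ e.open_baseSet]
    exact inter_subset_right
  · change p ∈ (x.restr e.baseSet).source
    rw [x.restr_source' _ e.open_baseSet]
    exact ⟨mem_chart_source _ p, FiberBundle.mem_baseSet_trivializationAt' p⟩

theorem BundleChart.component_chart (Φ : BundleChart m k E) (s : DualSection m E) (j : Fin k)
    {p : M} (hp : p ∈ Φ.chart.source) : Φ.component s j (Φ.chart p) =
      (s p (Φ.triv.symm p (Pi.single j 1))).1 (coordVec Φ.chart p) := by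
  -- The fibres depend on the base point, so x⁻¹(x(p)) = p is substituted after generalising the
  -- point.
  have : ∀ q, q = p → (s q (Φ.triv.symm q (Pi.single j 1))).1 (coordVec Φ.chart q) =
      (s p (Φ.triv.symm p (Pi.single j 1))).1 (coordVec Φ.chart p) := by
    rintro q rfl
    rfl
  exact this _ (Φ.chart.left_inv hp)

theorem BundleChart.eq_sum_frame (Φ : BundleChart m k E) {p : M} (hp : p ∈ Φ.chart.source)
    (w : E p) : w = ∑ j, Φ.triv.linearMapAt ℂ p w j • Φ.triv.symm p (Pi.single j 1) := by
  have hb := Φ.source_subset hp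
  conv_lhs => rw [← Φ.triv.symmₗ_linearMapAt (R := ℂ) hb w,
    pi_eq_sum_univ' (Φ.triv.linearMapAt ℂ p w), map_sum]
  refine Finset.sum_congr rfl fun j _ ↦ ?_
  rw [map_smul, Φ.triv.symmₗ_apply (R := ℂ) hb]

/-- The values of a section in terms of its components in a bundle chart. -/
theorem BundleChart.section_apply (Φ : BundleChart m k E) (s : DualSection m E)
    {p : M} (hp : p ∈ Φ.chart.source) (w : E p) :
    (s p w).1 (coordVec Φ.chart p) =
      ∑ j, Φ.triv.linearMapAt ℂ p w j * Φ.component s j (Φ.chart p) := by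
  conv_lhs => rw [Φ.eq_sum_frame hp w, map_sum]
  simp only [map_smul, Φ.component_chart s _ hp]
  rw [Submodule.coe_sum, Finset.sum_apply]
  rfl

theorem BundleChart.component_eq_sum (Φ Φ' : BundleChart m k E) (s : DualSection m E)
    (j' : Fin k) {y : 𝔼} (hy : y ∈ Φ'.chart.target) (hp : Φ'.chart.symm y ∈ Φ.chart.source) :
    Φ'.component s j' y = ∑ j, Φ.component s j ((Φ.chart ∘ Φ'.chart.symm) y) *
      (Φ.triv.linearMapAt ℂ (Φ'.chart.symm y) (Φ'.triv.symm (Φ'.chart.symm y) (Pi.single j' 1)) j *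
        ((|LinearMap.det (fderiv ℝ (Φ.chart ∘ Φ'.chart.symm) y).toLinearMap| : ℝ) : ℂ)) := by
  unfold BundleChart.component
  rw [densitySpace_coordVec Φ.chart_mem Φ'.chart_mem hy hp, Φ.section_apply s hp, Finset.mul_sum]
  refine Finset.sum_congr rfl fun j _ ↦ ?_
  rw [BundleChart.component, Function.comp_apply]
  ring

/-! ### Bounds on the derivatives of the components -/

/-- The derivatives of order at most `N` of the components of `s` in the bundle chart `Φ` are
bounded by `Q` on `C`. -/
def BundleChart.DerivBound (Φ : BundleChart m k E) (C : Set 𝔼) (N : ℕ) (s : DualSection m E)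
    (Q : ℝ) : Prop :=
  ∀ n ≤ N, ∀ j, ∀ y ∈ C, ‖iteratedFDeriv ℝ n (Φ.component s j) y‖ ≤ Q

theorem BundleChart.DerivBound.mono {Φ : BundleChart m k E} {C : Set 𝔼} {N N' : ℕ}
    {s : DualSection m E} {Q Q' : ℝ} (h : Φ.DerivBound C N s Q) (hN : N' ≤ N) (hQ : Q ≤ Q') :
    Φ.DerivBound C N' s Q' :=
  fun n hn j y hy ↦ (h n (hn.trans hN) j y hy).trans hQ

/-- The normalisation 1 ≤ D lets the same constant serve as D^i, i ≥ 1, in the chain rule estimate.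
-/
theorem exists_iteratedFDeriv_bound {F : Type*} [NormedAddCommGroup F] [NormedSpace ℝ F] {f : 𝔼 → F}
    {U Y : Set 𝔼} (hU : IsOpen U) (hf : ContDiffOn ℝ ∞ f U) (hY : IsCompact Y) (hYU : Y ⊆ U)
    (N : ℕ) : ∃ D : ℝ, 1 ≤ D ∧ ∀ n ≤ N, ∀ y ∈ Y, ‖iteratedFDeriv ℝ n f y‖ ≤ D := by
  have h : ∀ n : ℕ, ∃ D, ∀ y ∈ Y, ‖iteratedFDeriv ℝ n f y‖ ≤ D := fun n ↦
    hY.exists_bound_of_continuousOn fun y hy ↦ by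
      have h1 := (hf.contDiffAt (hU.mem_nhds (hYU hy))).iteratedFDeriv_right (i := n) (m := 0)
        (by exact_mod_cast le_top)
      exact h1.continuousAt.continuousWithinAt
  choose D hD using h
  refine ⟨1 + ∑ n ∈ Finset.range (N + 1), |D n|, le_add_of_nonneg_right (by positivity),
    fun n hn y hy ↦ ?_⟩
  have := Finset.single_le_sum (f := fun n ↦ |D n|) (fun i _ ↦ abs_nonneg _)
    (Finset.mem_range.2 (by omega : n < N + 1))
  linarith [hD n y hy, le_abs_self (D n)]

theorem norm_iteratedFDeriv_sum_le {ι : Type*} [Fintype ι] {f : ι → 𝔼 → ℂ} {y : 𝔼} (N : ℕ)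
    (hf : ∀ j, ContDiffAt ℝ ∞ (f j) y) {D : ι → ℝ} (hD : ∀ j, ‖iteratedFDeriv ℝ N (f j) y‖ ≤ D j) :
    ‖iteratedFDeriv ℝ N (fun y ↦ ∑ j, f j y) y‖ ≤ ∑ j, D j := by
  rw [iteratedFDeriv_fun_sum_apply fun j _ ↦ (hf j).of_le (by exact_mod_cast le_top)]
  exact norm_sum_le_of_le _ fun j _ ↦ hD j

/-- The derivatives of a product `(g ∘ τ) a` are bounded in terms of those of `g`. -/
theorem exists_iteratedFDeriv_comp_mul_bound {τ : 𝔼 → 𝔼} {a : 𝔼 → ℂ} {U T Y : Set 𝔼}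
    (hU : IsOpen U) (hT : IsOpen T) (hτ : ContDiffOn ℝ ∞ τ U) (hτT : MapsTo τ U T)
    (ha : ContDiffOn ℝ ∞ a U) (hY : IsCompact Y) (hYU : Y ⊆ U) (N : ℕ) :
    ∃ D : ℝ, 0 ≤ D ∧ ∀ (g : 𝔼 → ℂ), ContDiffOn ℝ ∞ g T → ∀ Q : ℝ, ∀ y ∈ Y,
      (∀ n ≤ N, ‖iteratedFDeriv ℝ n g (τ y)‖ ≤ Q) →
      ‖iteratedFDeriv ℝ N (fun y ↦ g (τ y) * a y) y‖ ≤ D * Q := by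
  obtain ⟨D₁, hD₁, h₁⟩ := exists_iteratedFDeriv_bound hU hτ hY hYU N
  obtain ⟨D₂, hD₂, h₂⟩ := exists_iteratedFDeriv_bound hU ha hY hYU N
  refine ⟨∑ i ∈ Finset.range (N + 1), (N.choose i : ℝ) * (i.factorial * D₁ ^ i) * D₂,
    by positivity, fun g hg Q y hy hQ ↦ ?_⟩
  have hyU := hYU hy
  rw [← iteratedFDerivWithin_of_isOpen N hU hyU]
  refine (norm_iteratedFDerivWithin_mul_le (N := ∞) (hg.comp hτ hτT) ha hU.uniqueDiffOn hyU
    (by exact_mod_cast le_top)).trans ?_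
  rw [Finset.sum_mul]
  refine Finset.sum_le_sum fun i hi ↦ ?_
  have hi' : i ≤ N := by simpa [Nat.lt_succ_iff] using hi
  have e1 : ‖iteratedFDerivWithin ℝ (N - i) a U y‖ ≤ D₂ := by
    rw [iteratedFDerivWithin_of_isOpen _ hU hyU]
    exact h₂ _ (by omega) y hy
  have e2 : ‖iteratedFDerivWithin ℝ i (g ∘ τ) U y‖ ≤ i.factorial * Q * D₁ ^ i := by
    refine norm_iteratedFDerivWithin_comp_le (N := ∞) hg hτ (by exact_mod_cast le_top)
      hT.uniqueDiffOn hU.uniqueDiffOn hτT hyU (fun n hn ↦ ?_) (fun n hn hni ↦ ?_)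
    · rw [iteratedFDerivWithin_of_isOpen _ hT (hτT hyU)]
      exact hQ n (by omega)
    · rw [iteratedFDerivWithin_of_isOpen _ hU hyU]
      exact (h₁ n (by omega) y hy).trans (le_self_pow₀ hD₁ (by omega))
  calc _ ≤ (N.choose i : ℝ) * (i.factorial * Q * D₁ ^ i) * D₂ := by
        have : 0 ≤ Q := (norm_nonneg _).trans (hQ 0 (by omega))
        gcongr
    _ = _ := by ring

variable [T2Space M]

/-- Derivatives of components in one bundle chart are bounded by those in another one, over
compact sets. -/
theorem BundleChart.exists_derivBound_le (Φ Φ' : BundleChart m k E) {C C' : Set 𝔼}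
    (hC : IsCompact C) (hCt : C ⊆ Φ.chart.target) (hC' : IsCompact C')
    (hCt' : C' ⊆ Φ'.chart.target) (N : ℕ) : ∃ D : ℝ, 0 ≤ D ∧ ∀ (s : TestSection m k E) (Q : ℝ),
      Φ.DerivBound C N s.1 Q → ∀ j', ∀ y ∈ C', Φ'.chart.symm y ∈ Φ.chart.source →
        Φ.chart (Φ'.chart.symm y) ∈ C → ‖iteratedFDeriv ℝ N (Φ'.component s.1 j') y‖ ≤ D * Q := by
  set U : Set 𝔼 := (Φ'.chart.symm.trans Φ.chart).source
  have hU : IsOpen U := (Φ'.chart.symm.trans Φ.chart).open_source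
  have hUm : ∀ y, y ∈ U ↔ y ∈ Φ'.chart.target ∧ Φ'.chart.symm y ∈ Φ.chart.source := fun y ↦ by
    simp [U, OpenPartialHomeomorph.trans_source]
  -- The part of C' that lies over the image of C in M. That image is compact, hence closed as M is
  -- Hausdorff, so Y is a compact subset of the domain of the coordinate change.
  set Y : Set 𝔼 := C' ∩ Φ'.chart.symm ⁻¹' (Φ.chart.symm '' C)
  have hYU : Y ⊆ U := by
    rintro y ⟨hy, z, hz, hzy⟩
    exact (hUm y).2 ⟨hCt' hy, hzy ▸ Φ.chart.map_target (hCt hz)⟩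
  have hY : IsCompact Y := by
    have h1 : IsCompact (Φ.chart.symm '' C) :=
      hC.image_of_continuousOn (Φ.chart.continuousOn_symm.mono hCt)
    exact hC'.of_isClosed_subset ((Φ'.chart.continuousOn_symm.mono hCt').preimage_isClosed_of_isClosed
      hC'.isClosed h1.isClosed) inter_subset_left
  have hτ : ContDiffOn ℝ ∞ (Φ.chart ∘ Φ'.chart.symm) U := fun y hy ↦
    (contDiffAt_coordChange Φ.chart_mem Φ'.chart_mem ((hUm y).1 hy).1
      ((hUm y).1 hy).2).contDiffWithinAt
  have hτT : MapsTo (Φ.chart ∘ Φ'.chart.symm) U Φ.chart.target := fun y hy ↦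
    Φ.chart.map_source ((hUm y).1 hy).2
  have ha : ∀ j' j, ContDiffOn ℝ ∞ (fun y ↦ Φ.triv.linearMapAt ℂ (Φ'.chart.symm y)
      (Φ'.triv.symm (Φ'.chart.symm y) (Pi.single j' 1)) j *
        ((|LinearMap.det (fderiv ℝ (Φ.chart ∘ Φ'.chart.symm) y).toLinearMap| : ℝ) : ℂ)) U :=
    fun j' j y hy ↦ ((contDiffAt_transition Φ Φ' j j' ((hUm y).1 hy).1 ((hUm y).1 hy).2).mul
      (contDiffAt_abs_det_coordChange Φ.chart_mem Φ'.chart_mem ((hUm y).1 hy).1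
        ((hUm y).1 hy).2)).contDiffWithinAt
  have hb := fun j' j ↦ exists_iteratedFDeriv_comp_mul_bound hU Φ.chart.open_target hτ hτT
    (ha j' j) hY hYU N
  choose D hD hDb using hb
  refine ⟨∑ j', ∑ j, D j' j, Finset.sum_nonneg fun _ _ ↦ Finset.sum_nonneg fun _ _ ↦ hD _ _,
    fun s Q hQ j' y hy hyp hyC ↦ ?_⟩
  have hyU : y ∈ U := (hUm y).2 ⟨hCt' hy, hyp⟩
  have hyY : y ∈ Y := ⟨hy, _, hyC, Φ.chart.left_inv hyp⟩
  have e : Φ'.component s.1 j' =ᶠ[𝓝 y] fun y ↦ ∑ j, Φ.component s.1 j ((Φ.chart ∘ Φ'.chart.symm) y) *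
      (Φ.triv.linearMapAt ℂ (Φ'.chart.symm y) (Φ'.triv.symm (Φ'.chart.symm y) (Pi.single j' 1)) j *
        ((|LinearMap.det (fderiv ℝ (Φ.chart ∘ Φ'.chart.symm) y).toLinearMap| : ℝ) : ℂ)) := by
    filter_upwards [hU.mem_nhds hyU] with z hz
    exact Φ.component_eq_sum Φ' s.1 j' ((hUm z).1 hz).1 ((hUm z).1 hz).2
  -- For k = 0 the bound is vacuous and says nothing on the sign of Q; a component index is needed.
  have hQ0 : ∀ j : Fin k, 0 ≤ Q := fun j ↦ (norm_nonneg _).trans (hQ 0 (by omega) j _ hyC)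
  calc _ ≤ ∑ j, D j' j * Q := by
        refine (congrArg norm (Filter.EventuallyEq.iteratedFDeriv ℝ e N).eq_of_nhds).le.trans ?_
        refine norm_iteratedFDeriv_sum_le N (fun j ↦ (((s.2.1 Φ j).comp hτ hτT).mul
          (ha j' j)).contDiffAt (hU.mem_nhds hyU)) fun j ↦ ?_
        exact hDb j' j _ (s.2.1 Φ j) Q y hyY fun n hn ↦ hQ n hn j _ hyC
    _ = (∑ j, D j' j) * Q := by rw [Finset.sum_mul]
    _ ≤ _ := by
      refine mul_le_mul_of_nonneg_right ?_ (hQ0 j')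
      exact Finset.single_le_sum (f := fun j' ↦ ∑ j, D j' j)
        (fun i _ ↦ Finset.sum_nonneg fun _ _ ↦ hD _ _) (Finset.mem_univ j')

end ChartChange

/-! ### Continuous seminorms on test sections, and bounded sets of distributions. -/

section SectionSeminorms

variable {m : ℕ} {M : Type*} [TopologicalSpace M] [ChartedSpace (EuclideanSpace ℝ (Fin m)) M]
  {k : ℕ} {E : M → Type*} [TopologicalSpace (TotalSpace (Fin k → ℂ) E)]
  [∀ p, AddCommGroup (E p)] [∀ p, Module ℂ (E p)] [∀ p, TopologicalSpace (E p)]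
  [FiberBundle (Fin k → ℂ) E]

local notation "𝔼" => EuclideanSpace ℝ (Fin m)

/-! ### Finite families of charts that cover a compact set -/

variable (m k E) in
/-- A finite family of bundle charts, each with a compact subset of its image. -/
structure ChartFamily where
  ι : Type
  [fintype : Fintype ι]
  Φ : ι → BundleChart m k E
  C : ι → Set (EuclideanSpace ℝ (Fin m))
  isCompact_C : ∀ i, IsCompact (C i)
  C_subset : ∀ i, C i ⊆ (Φ i).chart.target

attribute [instance] ChartFamily.fintype

/-- The compact sets of the family cover the subset `K` of the manifold. -/
def ChartFamily.Covers (𝓒 : ChartFamily m k E) (K : Set M) : Prop :=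
  ∀ p ∈ K, ∃ i, p ∈ (𝓒.Φ i).chart.source ∧ (𝓒.Φ i).chart p ∈ 𝓒.C i

/-- The derivatives of order at most `N` of the components of `s` are bounded by `Q` on the compact
sets of the family. -/
def ChartFamily.DerivBound (𝓒 : ChartFamily m k E) (N : ℕ) (s : DualSection m E) (Q : ℝ) : Prop :=
  ∀ i, (𝓒.Φ i).DerivBound (𝓒.C i) N s Q

theorem exists_chartFamily_covers [IsManifold (𝓡 m) ∞ M] [VectorBundle ℂ (Fin k → ℂ) E]
    [ContMDiffVectorBundle ∞ (Fin k → ℂ) E (𝓡 m)] {K : Set M} (hK : IsCompact K) :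
    ∃ 𝓒 : ChartFamily m k E, 𝓒.Covers K := by
  have h1 : ∀ p : M, ∃ (Φ : BundleChart m k E) (C : Set 𝔼), p ∈ Φ.chart.source ∧ IsCompact C ∧
      C ⊆ Φ.chart.target ∧ C ∈ 𝓝 (Φ.chart p) := by
    intro p
    obtain ⟨Φ, hp⟩ := exists_bundleChart (m := m) (k := k) (E := E) p
    obtain ⟨C, hC, hCt, hCc⟩ := local_compact_nhds
      (Φ.chart.open_target.mem_nhds (Φ.chart.map_source hp))
    exact ⟨Φ, C, hp, hCc, hCt, hC⟩
  choose Φ C hp hC hCt hCn using h1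
  obtain ⟨t, -, ht⟩ := hK.elim_nhds_subcover (fun p ↦ (Φ p).chart.source ∩ (Φ p).chart ⁻¹' (C p))
    fun p _ ↦ inter_mem ((Φ p).chart.open_source.mem_nhds (hp p))
      (((Φ p).chart.continuousAt (hp p)) (hCn p))
  let e := t.equivFin
  refine ⟨⟨Fin t.card, fun i ↦ Φ (e.symm i), fun i ↦ C (e.symm i), fun i ↦ hC _, fun i ↦ hCt _⟩,
    fun p hpK ↦ ?_⟩
  obtain ⟨q, hq, hpq⟩ := mem_iUnion₂.1 (ht hpK)
  refine ⟨e ⟨q, hq⟩, ?_⟩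
  simpa using hpq

theorem TestSection.contDiffOn_component (s : TestSection m k E) (Φ : BundleChart m k E)
    (j : Fin k) : ContDiffOn ℝ ∞ (Φ.component s.1 j) Φ.chart.target := s.2.1 Φ j

theorem DerivIndex.supNorm_le {ι : DerivIndex m k E} {s : TestSection m k E} {Q : ℝ}
    (h : ∀ j, ∀ y ∈ ι.C, ‖iteratedFDeriv ℝ ι.n (ι.Φ.component s.1 j) y‖ ≤ Q) :
    ι.supNorm s ≤ ENNReal.ofReal Q := by
  refine iSup_le fun j ↦ iSup₂_le fun y hy ↦ ?_
  rw [← ofReal_norm]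
  exact ENNReal.ofReal_le_ofReal (h j y hy)

theorem DerivIndex.enorm_le_supNorm (ι : DerivIndex m k E) (s : TestSection m k E) (j : Fin k)
    {y : 𝔼} (hy : y ∈ ι.C) : ‖iteratedFDeriv ℝ ι.n (ι.Φ.component s.1 j) y‖ₑ ≤ ι.supNorm s :=
  le_iSup_of_le (f := fun j : Fin k ↦ ⨆ y ∈ ι.C, ‖iteratedFDeriv ℝ ι.n (ι.Φ.component s.1 j) y‖ₑ) j
    (le_iSup₂_of_le (f := fun y _ ↦ ‖iteratedFDeriv ℝ ι.n (ι.Φ.component s.1 j) y‖ₑ) y hy le_rfl)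

theorem DerivIndex.supNorm_lt_top (ι : DerivIndex m k E) (s : TestSection m k E) :
    ι.supNorm s < ⊤ := by
  choose D hD hDb using fun j ↦ exists_iteratedFDeriv_bound ι.Φ.chart.open_target
    (s.contDiffOn_component ι.Φ j) ι.isCompact_C ι.C_subset ι.n
  refine lt_of_le_of_lt (ι.supNorm_le (Q := ∑ j, D j) fun j y hy ↦ ?_) ENNReal.ofReal_lt_top
  exact (hDb j ι.n le_rfl y hy).trans (Finset.single_le_sum (f := D)
    (fun i _ ↦ zero_le_one.trans (hD i)) (Finset.mem_univ j))

theorem isVonNBounded_testSection_iff {S : Set (TestSection m k E)} :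
    Bornology.IsVonNBounded ℂ S ↔ ∀ q : Seminorm ℂ (TestSection m k E), IsLFSeminorm q →
      ∃ C : ℝ, ∀ s ∈ S, q s ≤ C := by
  rw [TestSection.withSeminorms.isVonNBounded_iff_seminorm_bounded]
  constructor
  · intro h q hq
    obtain ⟨C, -, hC⟩ := h ⟨q, hq⟩
    exact ⟨C, fun s hs ↦ (hC s hs).le⟩
  · rintro h ⟨q, hq⟩
    obtain ⟨C, hC⟩ := h q hq
    exact ⟨max C 0 + 1, by positivity, fun s hs ↦ by
      have := hC s hs
      have := le_max_left C 0
      change q s < _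
      linarith⟩

theorem exists_forall_norm_apply_le {B : Set (DistSection m k E)}
    (hB : Bornology.IsVonNBounded ℂ B) {S : Set (TestSection m k E)}
    (hS : Bornology.IsVonNBounded ℂ S) : ∃ C : ℝ, ∀ u ∈ B, ∀ s ∈ S, ‖u s‖ ≤ C := by
  have h := ContinuousLinearMap.isVonNBounded_image2_apply hB hS
  rw [NormedSpace.isVonNBounded_iff, isBounded_iff_forall_norm_le] at h
  obtain ⟨C, hC⟩ := h
  exact ⟨C, fun u hu s hs ↦ hC _ ⟨u, hu, s, hs, rfl⟩⟩

/-- A criterion for a seminorm to be continuous on `Γ_K`. -/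
theorem ChartFamily.exists_supNorm_le (𝓒 : ChartFamily m k E) (K : Set M)
    {q : Seminorm ℂ (TestSection m k E)} {N : ℕ} {D : ℝ} (hD : 0 ≤ D)
    (h : ∀ s ∈ TestSection.supportedIn K, ∀ Q : ℝ, 0 ≤ Q → 𝓒.DerivBound N s.1 Q → q s ≤ D * Q) :
    ∃ (S : Finset (DerivIndex m k E)) (A : ℝ≥0),
      ∀ s ∈ TestSection.supportedIn K, ENNReal.ofReal (q s) ≤ A * ⨆ ι ∈ S, ι.supNorm s := by
  classical
  let f : 𝓒.ι × Fin (N + 1) → DerivIndex m k E := fun a ↦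
    ⟨𝓒.Φ a.1, 𝓒.C a.1, 𝓒.isCompact_C a.1, 𝓒.C_subset a.1, a.2⟩
  refine ⟨Finset.univ.image f, D.toNNReal, fun s hs ↦ ?_⟩
  set R := ⨆ ι ∈ Finset.univ.image f, ι.supNorm s
  have hR : R ≠ ⊤ := by
    refine (lt_of_le_of_lt (b := ∑ ι ∈ Finset.univ.image f, ι.supNorm s) ?_ ?_).ne
    · exact iSup₂_le fun ι hι ↦ Finset.single_le_sum (f := fun ι : DerivIndex m k E ↦ ι.supNorm s)
        (fun _ _ ↦ zero_le) hι
    · exact ENNReal.sum_lt_top.2 fun ι _ ↦ ι.supNorm_lt_top s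
  have hb : 𝓒.DerivBound N s.1 R.toReal := by
    intro i n hn j y hy
    have h1 := (f (i, ⟨n, by omega⟩)).enorm_le_supNorm s j hy
    have h2 : (f (i, ⟨n, by omega⟩)).supNorm s ≤ R :=
      le_iSup₂_of_le (f := fun (ι : DerivIndex m k E) _ ↦ ι.supNorm s) _
        (Finset.mem_image_of_mem f (Finset.mem_univ _)) le_rfl
    have h3 := ENNReal.toReal_mono hR (h1.trans h2)
    rwa [toReal_enorm] at h3
  have h1 := h s hs _ ENNReal.toReal_nonneg hb
  calc ENNReal.ofReal (q s) ≤ ENNReal.ofReal (D * R.toReal) := ENNReal.ofReal_le_ofReal h1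
    _ = _ := by rw [ENNReal.ofReal_mul hD, ENNReal.ofReal_toReal hR]; rfl

variable [T2Space M]

/-- On sections supported in `K`, derivatives in any bundle chart are bounded by the derivatives in
the charts of a family that covers `K`. -/
theorem ChartFamily.Covers.exists_derivBound {𝓒 : ChartFamily m k E} {K : Set M}
    (h𝓒 : 𝓒.Covers K) (hK : IsCompact K) (Φ : BundleChart m k E) {C : Set 𝔼} (hC : IsCompact C)
    (hCt : C ⊆ Φ.chart.target) (n : ℕ) : ∃ D : ℝ, 0 ≤ D ∧
      ∀ s ∈ (TestSection.supportedIn K : Set (TestSection m k E)), ∀ Q : ℝ, 0 ≤ Q → 𝓒.DerivBound n s.1 Q →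
        ∀ j, ∀ y ∈ C, ‖iteratedFDeriv ℝ n (Φ.component s.1 j) y‖ ≤ D * Q := by
  choose D hD hDb using fun i ↦ (𝓒.Φ i).exists_derivBound_le Φ (𝓒.isCompact_C i) (𝓒.C_subset i)
    hC hCt n
  refine ⟨∑ i, D i, Finset.sum_nonneg fun i _ ↦ hD i, fun s hs Q hQ0 hQ j y hy ↦ ?_⟩
  -- Over K some chart of the family controls the derivative at y. Off K the section vanishes on an
  -- open set, so all derivatives at y are 0.
  by_cases hp : Φ.chart.symm y ∈ K
  · obtain ⟨i, hi, hiC⟩ := h𝓒 _ hp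
    refine (hDb i s Q (hQ i) j y hy hi hiC).trans ?_
    gcongr
    exact Finset.single_le_sum (f := D) (fun i _ ↦ hD i) (Finset.mem_univ i)
  · have e : Φ.component s.1 j =ᶠ[𝓝 y] fun _ ↦ 0 := by
      filter_upwards [(Φ.chart.continuousAt_symm (hCt hy))
        (hK.isClosed.isOpen_compl.mem_nhds hp)] with z hz
      unfold BundleChart.component
      rw [hs _ hz]
      rfl
    have h0 := (Filter.EventuallyEq.iteratedFDeriv ℝ e n).eq_of_nhds
    rw [h0, iteratedFDeriv_fun_zero]
    simp only [norm_zero, Pi.zero_apply]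
    exact mul_nonneg (Finset.sum_nonneg fun i _ ↦ hD i) hQ0

/-- A continuous seminorm is bounded on `Γ_K` by finitely many derivatives in the charts of a family
that covers `K`. -/
theorem IsLFSeminorm.exists_le {q : Seminorm ℂ (TestSection m k E)} (hq : IsLFSeminorm q)
    {𝓒 : ChartFamily m k E} {K : Set M} (h𝓒 : 𝓒.Covers K) (hK : IsCompact K) :
    ∃ (N : ℕ) (D : ℝ), 0 ≤ D ∧ ∀ s ∈ TestSection.supportedIn K, ∀ Q : ℝ, 0 ≤ Q →
      𝓒.DerivBound N s.1 Q → q s ≤ D * Q := by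
  obtain ⟨S, A, hA⟩ := hq K hK
  choose D hD hDb using fun ι : DerivIndex m k E ↦
    h𝓒.exists_derivBound hK ι.Φ ι.isCompact_C ι.C_subset ι.n
  refine ⟨S.sup fun ι ↦ ι.n, A * ∑ ι ∈ S, D ι, mul_nonneg A.coe_nonneg (Finset.sum_nonneg fun i _ ↦ hD i),
    fun s hs Q hQ0 hQ ↦ ?_⟩
  have h1 : ⨆ ι ∈ S, ι.supNorm s ≤ ENNReal.ofReal ((∑ ι ∈ S, D ι) * Q) := by
    refine iSup₂_le fun ι hι ↦ ι.supNorm_le fun j y hy ↦ ?_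
    refine (hDb ι s hs Q hQ0 (fun i ↦ (hQ i).mono (Finset.le_sup (f := fun ι ↦ ι.n) hι) le_rfl)
      j y hy).trans ?_
    gcongr
    exact Finset.single_le_sum (f := D) (fun i _ ↦ hD i) hι
  have h2 := (hA s hs).trans (mul_le_mul_right h1 _)
  have hnn : 0 ≤ (∑ ι ∈ S, D ι) * Q := mul_nonneg (Finset.sum_nonneg fun i _ ↦ hD i) hQ0
  rw [← ENNReal.ofReal_coe_nnreal, ← ENNReal.ofReal_mul A.coe_nonneg,
    ENNReal.ofReal_le_ofReal_iff (mul_nonneg A.coe_nonneg hnn)] at h2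
  rwa [mul_assoc]

/-! ### Local sections -/

theorem BundleChart.component_localSection (Φ : BundleChart m k E) (j j' : Fin k)
    (φ : TestFunction Φ.Ω ℂ ⊤) {y : 𝔼} (hy : y ∈ Φ.chart.target) :
    Φ.component (Φ.localSection j φ).1 j' y = if j' = j then φ y else 0 := by
  have hp := Φ.chart.map_target hy
  have hb := Φ.source_subset hp
  change (Φ.localSectionFun j φ (Φ.chart.symm y) (Φ.triv.symm (Φ.chart.symm y) (Pi.single j' 1))).1
    (coordVec Φ.chart (Φ.chart.symm y)) = _
  unfold BundleChart.localSectionFun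
  rw [if_pos hp, Φ.chart.right_inv hy]
  have e : Φ.triv.linearMapAt ℂ (Φ.chart.symm y)
      (Φ.triv.symm (Φ.chart.symm y) (Pi.single j' 1)) = Pi.single j' 1 :=
    Φ.triv.linearMapAt_symm hb _
  change φ y * ((Φ.triv.linearMapAt ℂ (Φ.chart.symm y)
      (Φ.triv.symm (Φ.chart.symm y) (Pi.single j' 1))) j *
        (chartDensity Φ.chart (Φ.chart.symm y)).1 (coordVec Φ.chart (Φ.chart.symm y))) = _
  rw [e, chartDensity_coordVec Φ.chart_mem hp, mul_one]
  by_cases h : j' = j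
  · subst h; simp
  · rw [Pi.single_eq_of_ne (Ne.symm h)]; simp [h]

theorem BundleChart.localSection_mem_supportedIn (Φ : BundleChart m k E) (j : Fin k)
    {φ : TestFunction Φ.Ω ℂ ⊤} {K : Set 𝔼} (hφ : tsupport φ ⊆ K) :
    Φ.localSection j φ ∈ TestSection.supportedIn (Φ.chart.symm '' K) := by
  intro p hp
  change Φ.localSectionFun j φ p = 0
  unfold BundleChart.localSectionFun
  split_ifs with h
  · rw [image_eq_zero_of_notMem_tsupport (f := φ), zero_smul]
    exact fun h' ↦ hp ⟨_, hφ h', Φ.chart.left_inv h⟩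
  · rfl

/-- The chart of Φ alone covers the support of the local section, and there its components are φ and
zeros; hence q is controlled by derivatives of φ only. -/
theorem IsLFSeminorm.exists_localSection_le {q : Seminorm ℂ (TestSection m k E)}
    (hq : IsLFSeminorm q) (Φ : BundleChart m k E) {K : Set 𝔼} (hK : IsCompact K)
    (hKt : K ⊆ Φ.chart.target) : ∃ (N : ℕ) (D : ℝ), 0 ≤ D ∧ ∀ (j : Fin k)
      (φ : TestFunction Φ.Ω ℂ ⊤), tsupport φ ⊆ K → ∀ A : ℝ, 0 ≤ A →
        (∀ n ≤ N, ∀ x, ‖iteratedFDeriv ℝ n φ x‖ ≤ A) → q (Φ.localSection j φ) ≤ D * A := by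
  let 𝓒 : ChartFamily m k E := ⟨Unit, fun _ ↦ Φ, fun _ ↦ K, fun _ ↦ hK, fun _ ↦ hKt⟩
  have h𝓒 : 𝓒.Covers (Φ.chart.symm '' K) := by
    rintro _ ⟨y, hy, rfl⟩
    refine ⟨(), Φ.chart.map_target (hKt hy), ?_⟩
    change Φ.chart (Φ.chart.symm y) ∈ K
    rwa [Φ.chart.right_inv (hKt hy)]
  obtain ⟨N, D, hD, h⟩ := hq.exists_le h𝓒
    (hK.image_of_continuousOn (Φ.chart.continuousOn_symm.mono hKt))
  refine ⟨N, D, hD, fun j φ hφ A hA hb ↦ h _ (Φ.localSection_mem_supportedIn j hφ) A hA ?_⟩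
  intro _ n hn j' y hy
  have e : Φ.component (Φ.localSection j φ).1 j' =ᶠ[𝓝 y] if j' = j then φ else fun _ ↦ 0 := by
    filter_upwards [Φ.chart.open_target.mem_nhds (hKt hy)] with z hz
    rw [Φ.component_localSection j j' φ hz]
    split_ifs <;> rfl
  refine (congrArg norm (Filter.EventuallyEq.iteratedFDeriv ℝ e n).eq_of_nhds).le.trans ?_
  split_ifs
  · exact hb n hn y
  · rw [iteratedFDeriv_fun_zero]
    simpa using hA

/-- The local representatives of the distributions dominated by a continuous seminorm are locally
uniformly bounded. -/
theorem IsLFSeminorm.locallyUniformlyBounded {q : Seminorm ℂ (TestSection m k E)}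
    (hq : IsLFSeminorm q) (Φ : BundleChart m k E) (j : Fin k) {B : Set (DistSection m k E)}
    (hB : ∀ u ∈ B, ∀ s, ‖u s‖ ≤ q s) :
    LocallyUniformlyBounded ((fun u : DistSection m k E ↦ u.localize Φ j) '' B) := by
  intro K hK hKt
  obtain ⟨N, D, hD, h⟩ := hq.exists_localSection_le Φ hK hKt
  refine ⟨N, D, hD, ?_⟩
  rintro _ ⟨u, hu, rfl⟩ φ hφ A hA hb
  exact (hB u hu _).trans (h j φ hφ A hA hb)

/-! ### Bounded sets of distributions -/

/-- The spaces `Γ_K` are bornological, uniformly for bounded sets of distributions. -/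
theorem exists_apply_le_of_isVonNBounded {B : Set (DistSection m k E)}
    (hB : Bornology.IsVonNBounded ℂ B) {𝓒 : ChartFamily m k E} {K : Set M} (h𝓒 : 𝓒.Covers K)
    (hK : IsCompact K) : ∃ (N : ℕ) (D : ℝ), 0 ≤ D ∧ ∀ u ∈ B, ∀ s ∈ TestSection.supportedIn K,
      ∀ Q : ℝ, 0 ≤ Q → 𝓒.DerivBound N s.1 Q → ‖u s‖ ≤ D * Q := by
  by_contra! hc
  choose u hu s hs Q hQ hb hlt using fun l : ℕ ↦ hc l l (Nat.cast_nonneg l)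
  have hpos : ∀ l, 0 < ‖u l (s l)‖ := fun l ↦ lt_of_le_of_lt (by have := hQ l; positivity) (hlt l)
  -- If no estimate holds, there are u_l and s_l with |u_l(s_l)| > l Q_l. This scaling makes u_l(c_l
  -- s_l) of size l while keeping c_l Q_l ≤ 1.
  let c : ℕ → ℝ := fun l ↦ l / ‖u l (s l)‖
  have hc0 : ∀ l, 0 ≤ c l := fun l ↦ div_nonneg (Nat.cast_nonneg l) (hpos l).le
  have hcQ : ∀ l, c l * Q l ≤ 1 := fun l ↦ by
    have h1 := hlt l
    have h2 := hpos l
    simp only [c]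
    rw [div_mul_eq_mul_div, div_le_one h2]
    exact h1.le
  have hS : Bornology.IsVonNBounded ℂ (range fun l ↦ (c l : ℂ) • s l) := by
    rw [isVonNBounded_testSection_iff]
    intro q hq
    obtain ⟨N, D, hD, hqb⟩ := hq.exists_le h𝓒 hK
    -- For l ≥ N the derivatives of order at most N of c_l s_l are bounded by 1; the finitely many
    -- earlier terms are covered by the sum.
    refine ⟨D + ∑ l ∈ Finset.range N, q ((c l : ℂ) • s l), ?_⟩
    rintro _ ⟨l, rfl⟩
    have hsum : 0 ≤ ∑ l ∈ Finset.range N, q ((c l : ℂ) • s l) :=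
      Finset.sum_nonneg fun _ _ ↦ apply_nonneg _ _
    rcases lt_or_ge l N with hl | hl
    · have := Finset.single_le_sum (f := fun l ↦ q ((c l : ℂ) • s l))
        (fun _ _ ↦ apply_nonneg _ _) (Finset.mem_range.2 hl)
      linarith
    · have h1 := hqb (s l) (hs l) (Q l) (hQ l) fun i ↦ (hb l i).mono hl le_rfl
      have h2 : q ((c l : ℂ) • s l) = c l * q (s l) := by
        rw [map_smul_eq_mul, Complex.norm_real, Real.norm_of_nonneg (hc0 l)]
      have h3 : c l * q (s l) ≤ D * (c l * Q l) := by
        calc c l * q (s l) ≤ c l * (D * Q l) := mul_le_mul_of_nonneg_left h1 (hc0 l)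
          _ = _ := by ring
      have h4 := mul_le_mul_of_nonneg_left (hcQ l) hD
      simp only [h2]
      linarith
  obtain ⟨C, hC⟩ := exists_forall_norm_apply_le hB hS
  obtain ⟨l, hl⟩ := exists_nat_gt C
  have h1 := hC (u l) (hu l) _ ⟨l, rfl⟩
  have h2 : ‖u l ((c l : ℂ) • s l)‖ = l := by
    rw [map_smul, norm_smul, Complex.norm_real, Real.norm_of_nonneg (hc0 l)]
    exact div_mul_cancel₀ _ (hpos l).ne'
  linarith [h2 ▸ h1]

/-- A bounded set of distributions is dominated by a continuous seminorm. -/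
theorem exists_isLFSeminorm_of_isVonNBounded [IsManifold (𝓡 m) ∞ M] [VectorBundle ℂ (Fin k → ℂ) E]
    [ContMDiffVectorBundle ∞ (Fin k → ℂ) E (𝓡 m)] {B : Set (DistSection m k E)}
    (hB : Bornology.IsVonNBounded ℂ B) : ∃ q : Seminorm ℂ (TestSection m k E), IsLFSeminorm q ∧
      ∀ u ∈ B, ∀ s, ‖u s‖ ≤ q s := by
  -- The dominating seminorm is q(s) = sup_{u ∈ B} |u(s)|. It is finite because singletons are
  -- bounded, and continuous on each Γ_K by the preceding uniform estimate.
  have hb : BddAbove (range fun u : B ↦ (normSeminorm ℂ ℂ).comp u.1.toLinearMap) := by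
    rw [Seminorm.bddAbove_range_iff]
    intro s
    have hs : Bornology.IsVonNBounded ℂ {s} := by
      rw [isVonNBounded_testSection_iff]
      exact fun q _ ↦ ⟨q s, fun _ h ↦ by rw [mem_singleton_iff.1 h]⟩
    obtain ⟨C, hC⟩ := exists_forall_norm_apply_le hB hs
    refine ⟨C, ?_⟩
    rintro _ ⟨u, rfl⟩
    exact hC u.1 u.2 s rfl
  have happ : ∀ s, (⨆ u : B, (normSeminorm ℂ ℂ).comp u.1.toLinearMap) s = ⨆ u : B, ‖u.1 s‖ :=
    fun s ↦ Seminorm.iSup_apply hb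
  refine ⟨⨆ u : B, (normSeminorm ℂ ℂ).comp u.1.toLinearMap, fun K hK ↦ ?_, fun u hu s ↦ ?_⟩
  · obtain ⟨𝓒, h𝓒⟩ := exists_chartFamily_covers (m := m) (k := k) (E := E) hK
    obtain ⟨N, D, hD, h⟩ := exists_apply_le_of_isVonNBounded hB h𝓒 hK
    refine 𝓒.exists_supNorm_le (N := N) K hD fun s hs Q hQ hsQ ↦ ?_
    rw [happ]
    exact Real.iSup_le (fun u ↦ h u.1 u.2 s hs Q hQ hsQ) (by positivity)
  · rw [happ]
    rw [Seminorm.bddAbove_range_iff] at hb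
    exact le_ciSup (f := fun u : B ↦ ‖u.1 s‖) (hb s) ⟨u, hu⟩

end SectionSeminorms

/-! ### The Montel property of test sections, and strong compactness of polars. -/

section Montel

/-! ### Bounded sets of test sections are precompact -/

/-- Derivatives at a point thus take values in a proper space, where bounded ultrafilters converge.
-/
instance finiteDimensional_continuousMultilinearMap {ι V W : Type*} [Fintype ι]
    [NormedAddCommGroup V] [NormedSpace ℝ V] [FiniteDimensional ℝ V]
    [NormedAddCommGroup W] [NormedSpace ℝ W] [FiniteDimensional ℝ W] :
    FiniteDimensional ℝ (ContinuousMultilinearMap ℝ (fun _ : ι ↦ V) W) :=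
  FiniteDimensional.of_injective
    (ContinuousMultilinearMap.toMultilinearMapLinear :
      ContinuousMultilinearMap ℝ (fun _ : ι ↦ V) W →ₗ[ℝ] MultilinearMap ℝ (fun _ : ι ↦ V) W) ContinuousMultilinearMap.toMultilinearMap_injective

variable {m : ℕ} {M : Type*} [TopologicalSpace M] [ChartedSpace (EuclideanSpace ℝ (Fin m)) M]
  {k : ℕ} {E : M → Type*} [TopologicalSpace (TotalSpace (Fin k → ℂ) E)]
  [∀ p, AddCommGroup (E p)] [∀ p, Module ℂ (E p)] [∀ p, TopologicalSpace (E p)]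
  [FiberBundle (Fin k → ℂ) E]

local notation "𝔼" => EuclideanSpace ℝ (Fin m)

/-- Along an ultrafilter, the derivatives of a family of smooth functions that is bounded with all
its derivatives are uniformly Cauchy on compact sets. -/
theorem Ultrafilter.eventually_norm_iteratedFDeriv_sub_le {S : Type*} (𝓤 : Ultrafilter S)
    {g : S → 𝔼 → ℂ} {U C : Set 𝔼} (hU : IsOpen U) (hg : ∀ s, ContDiffOn ℝ ∞ (g s) U)
    (hb : ∀ (n : ℕ) (C' : Set 𝔼), IsCompact C' → C' ⊆ U →
      ∃ A : ℝ, ∀ s, ∀ y ∈ C', ‖iteratedFDeriv ℝ n (g s) y‖ ≤ A)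
    (hC : IsCompact C) (hCU : C ⊆ U) (n : ℕ) {ε : ℝ} (hε : 0 < ε) :
    ∀ᶠ z in (𝓤 : Filter S) ×ˢ (𝓤 : Filter S),
      ∀ y ∈ C, ‖iteratedFDeriv ℝ n (g z.1) y - iteratedFDeriv ℝ n (g z.2) y‖ ≤ ε := by
  -- The argument of Arzelà–Ascoli: the bound on derivatives of order n + 1 makes those of order n
  -- equi-Lipschitz near y, and at y itself they converge along the ultrafilter. Finitely many such
  -- neighbourhoods cover C.
  have key : ∀ y ∈ C, ∃ t ∈ 𝓝 y, ∀ᶠ z in (𝓤 : Filter S) ×ˢ (𝓤 : Filter S), ∀ w ∈ t,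
      ‖iteratedFDeriv ℝ n (g z.1) w - iteratedFDeriv ℝ n (g z.2) w‖ ≤ ε := by
    intro y hy
    obtain ⟨ρ, hρ, hρU⟩ := Metric.nhds_basis_closedBall.mem_iff.1 (hU.mem_nhds (hCU hy))
    obtain ⟨A, hA⟩ := hb (n + 1) _ (isCompact_closedBall y ρ) hρU
    obtain ⟨A', hA'⟩ := hb n _ (isCompact_closedBall y ρ) hρU
    have hyy : y ∈ Metric.closedBall y ρ := Metric.mem_closedBall_self hρ.le
    have hlip : ∀ s, ∀ w ∈ Metric.closedBall y ρ,
        ‖iteratedFDeriv ℝ n (g s) w - iteratedFDeriv ℝ n (g s) y‖ ≤ A * ‖w - y‖ := by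
      intro s w hw
      refine (convex_closedBall y ρ).norm_image_sub_le_of_norm_fderiv_le (𝕜 := ℝ)
        (f := iteratedFDeriv ℝ n (g s)) (fun z hz ↦ ?_) (fun z hz ↦ ?_) hyy hw
      · exact (((hg s).contDiffAt (hU.mem_nhds (hρU hz))).iteratedFDeriv_right (i := n) (m := 1)
          (by exact_mod_cast le_top)).differentiableAt (by simp)
      · rw [norm_fderiv_iteratedFDeriv]
        exact hA s z hz
    have hc : ∀ᶠ z in (𝓤 : Filter S) ×ˢ (𝓤 : Filter S),
        ‖iteratedFDeriv ℝ n (g z.1) y - iteratedFDeriv ℝ n (g z.2) y‖ < ε / 3 := by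
      have : ProperSpace (𝔼 [×n]→L[ℝ] ℂ) := FiniteDimensional.proper ℝ _
      obtain ⟨a, -, ha⟩ := (isCompact_closedBall (0 : 𝔼 [×n]→L[ℝ] ℂ) A').ultrafilter_le_nhds
        (𝓤.map fun s ↦ iteratedFDeriv ℝ n (g s) y) (by
          rw [le_principal_iff]
          exact Filter.mem_map.2 (univ_mem' fun s ↦ by simpa using hA' s y hyy))
      have ha' : Tendsto (fun s ↦ iteratedFDeriv ℝ n (g s) y) 𝓤 (𝓝 a) := ha
      have h2 := ((ha'.comp tendsto_fst).sub (ha'.comp tendsto_snd)).norm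
      simp only [sub_self, norm_zero] at h2
      exact h2.eventually (gt_mem_nhds (by positivity))
    refine ⟨Metric.closedBall y (min ρ (ε / 3 / (|A| + 1))),
      Metric.closedBall_mem_nhds y (by positivity), hc.mono fun z hz w hw ↦ ?_⟩
    have hwρ : w ∈ Metric.closedBall y ρ := Metric.closedBall_subset_closedBall (min_le_left _ _) hw
    have hsm : A * ‖w - y‖ ≤ ε / 3 := by
      have h1 : ‖w - y‖ ≤ ε / 3 / (|A| + 1) := by
        rw [← dist_eq_norm]
        exact (Metric.mem_closedBall.1 hw).trans (min_le_right _ _)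
      calc A * ‖w - y‖ ≤ (|A| + 1) * (ε / 3 / (|A| + 1)) := by
            gcongr
            linarith [le_abs_self A]
        _ = ε / 3 := by field_simp
    have e : iteratedFDeriv ℝ n (g z.1) w - iteratedFDeriv ℝ n (g z.2) w =
        (iteratedFDeriv ℝ n (g z.1) w - iteratedFDeriv ℝ n (g z.1) y) +
        (iteratedFDeriv ℝ n (g z.1) y - iteratedFDeriv ℝ n (g z.2) y) -
        (iteratedFDeriv ℝ n (g z.2) w - iteratedFDeriv ℝ n (g z.2) y) := by abel
    rw [e]
    refine (norm_sub_le _ _).trans ?_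
    have := norm_add_le (iteratedFDeriv ℝ n (g z.1) w - iteratedFDeriv ℝ n (g z.1) y)
      (iteratedFDeriv ℝ n (g z.1) y - iteratedFDeriv ℝ n (g z.2) y)
    linarith [hlip z.1 w hwρ, hlip z.2 w hwρ]
  choose! t ht htc using key
  obtain ⟨F, hF, hCF⟩ := hC.elim_nhds_subcover t ht
  have h := (Filter.eventually_all_finset F).2 fun y hy ↦ htc y (hF y hy)
  refine h.mono fun z hz y hy ↦ ?_
  obtain ⟨l, hl, hyl⟩ := mem_iUnion₂.1 (hCF hy)
  exact hz l hl y hyl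

/-- The supremum of the ‖f a ·‖ is a continuous seminorm, as its restriction to each Γ_K is
dominated by finitely many derivatives. Testing bounded sets with such suprema yields uniform
derivative bounds and a common compact support. -/
theorem exists_forall_norm_le_of_isVonNBounded {S : Set (TestSection m k E)}
    (hS : Bornology.IsVonNBounded ℂ S) {A F : Type*} [SeminormedAddCommGroup F] [NormedSpace ℂ F]
    (f : A → TestSection m k E →ₗ[ℂ] F)
    (hf : ∀ K : Set M, IsCompact K → ∃ (J : Finset (DerivIndex m k E)) (c : ℝ≥0), ∀ a,
      ∀ s ∈ TestSection.supportedIn K, ‖f a s‖ₑ ≤ c * ⨆ ι ∈ J, ι.supNorm s) :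
    ∃ c : ℝ, ∀ a, ∀ s ∈ S, ‖f a s‖ ≤ c := by
  have hfin : ∀ (J : Finset (DerivIndex m k E)) (c : ℝ≥0) (s : TestSection m k E),
      c * ⨆ ι ∈ J, ι.supNorm s ≠ ⊤ := fun J c s ↦ by
    refine ENNReal.mul_ne_top ENNReal.coe_ne_top
      (lt_of_le_of_lt (b := ∑ ι ∈ J, ι.supNorm s) ?_ ?_).ne
    · exact iSup₂_le fun ι hι ↦ Finset.single_le_sum (f := fun ι : DerivIndex m k E ↦ ι.supNorm s)
        (fun _ _ ↦ zero_le) hι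
    · exact ENNReal.sum_lt_top.2 fun ι _ ↦ ι.supNorm_lt_top s
  have hf' : ∀ K : Set M, IsCompact K → ∃ (J : Finset (DerivIndex m k E)) (c : ℝ≥0), ∀ a,
      ∀ s ∈ TestSection.supportedIn K, ‖f a s‖ ≤ (c * ⨆ ι ∈ J, ι.supNorm s).toReal := by
    intro K hK
    obtain ⟨J, c, h⟩ := hf K hK
    refine ⟨J, c, fun a s hs ↦ ?_⟩
    rw [← toReal_enorm]
    exact ENNReal.toReal_mono (hfin J c s) (h a s hs)
  have hbdd : BddAbove (range fun a ↦ (normSeminorm ℂ F).comp (f a)) := by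
    rw [Seminorm.bddAbove_range_iff]
    intro s
    obtain ⟨K, hK, hsK⟩ := s.2.2
    obtain ⟨J, c, h⟩ := hf' K hK
    exact ⟨_, by rintro _ ⟨a, rfl⟩; exact h a s hsK⟩
  have happ : ∀ s, (⨆ a, (normSeminorm ℂ F).comp (f a)) s = ⨆ a, ‖f a s‖ :=
    fun s ↦ Seminorm.iSup_apply hbdd
  have hq : IsLFSeminorm (⨆ a, (normSeminorm ℂ F).comp (f a)) := by
    intro K hK
    obtain ⟨J, c, h⟩ := hf' K hK
    refine ⟨J, c, fun s hs ↦ ?_⟩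
    rw [happ]
    exact ENNReal.ofReal_le_of_le_toReal (Real.iSup_le (fun a ↦ h a s hs) ENNReal.toReal_nonneg)
  obtain ⟨C, hC⟩ := isVonNBounded_testSection_iff.1 hS _ hq
  refine ⟨C, fun a s hs ↦ le_trans ?_ (hC s hs)⟩
  rw [happ]
  rw [Seminorm.bddAbove_range_iff] at hbdd
  exact le_ciSup (f := fun a ↦ ‖f a s‖) (hbdd s) a

/-- The derivatives of a component at a point, as a linear function of the section. -/
noncomputable def BundleChart.derivAt (Φ : BundleChart m k E) (n : ℕ) (j : Fin k)
    (y : Φ.chart.target) : TestSection m k E →ₗ[ℂ] 𝔼 [×n]→L[ℝ] ℂ where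
  toFun s := iteratedFDeriv ℝ n (Φ.component s.1 j) y.1
  map_add' s t := iteratedFDeriv_add_apply
    (((s.contDiffOn_component Φ j).contDiffAt (Φ.chart.open_target.mem_nhds y.2)).of_le
      (by exact_mod_cast le_top))
    (((t.contDiffOn_component Φ j).contDiffAt (Φ.chart.open_target.mem_nhds y.2)).of_le
      (by exact_mod_cast le_top))
  map_smul' c s := iteratedFDeriv_const_smul_apply
    (((s.contDiffOn_component Φ j).contDiffAt (Φ.chart.open_target.mem_nhds y.2)).of_le
      (by exact_mod_cast le_top))

theorem exists_norm_iteratedFDeriv_component_le {S : Set (TestSection m k E)}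
    (hS : Bornology.IsVonNBounded ℂ S) (Φ : BundleChart m k E) (n : ℕ) (j : Fin k) {C : Set 𝔼}
    (hC : IsCompact C) (hCt : C ⊆ Φ.chart.target) :
    ∃ A : ℝ, ∀ s ∈ S, ∀ y ∈ C, ‖iteratedFDeriv ℝ n (Φ.component s.1 j) y‖ ≤ A := by
  obtain ⟨A, hA⟩ := exists_forall_norm_le_of_isVonNBounded hS
    (fun y : C ↦ Φ.derivAt n j ⟨y.1, hCt y.2⟩) fun K _ ↦ ⟨{⟨Φ, C, hC, hCt, n⟩}, 1, fun y s _ ↦ by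
      rw [Finset.iSup_singleton, ENNReal.coe_one, one_mul]
      exact (DerivIndex.enorm_le_supNorm ⟨Φ, C, hC, hCt, n⟩ s j y.2 :)⟩
  exact ⟨A, fun s hs y hy ↦ hA ⟨y, hy⟩ s hs⟩

theorem BundleChart.eq_zero_of_component_eq_zero (Φ : BundleChart m k E) (s : DualSection m E)
    {p : M} (hp : p ∈ Φ.chart.source) (h : ∀ j, Φ.component s j (Φ.chart p) = 0) : s p = 0 := by
  refine LinearMap.ext fun w ↦ Subtype.ext <| funext fun v ↦ ?_
  rw [densitySpace_apply Φ.chart_mem hp (s p w) v, Φ.section_apply s hp w]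
  simp [h]

/-- The value of a component at a point, as a linear function of the section. -/
noncomputable def BundleChart.componentAt (Φ : BundleChart m k E) (j : Fin k) (y : 𝔼) :
    TestSection m k E →ₗ[ℂ] ℂ where
  toFun s := Φ.component s.1 j y
  map_add' _ _ := rfl
  map_smul' _ _ := rfl

/-- A bounded set of test sections is supported in a fixed compact set. -/
theorem exists_subset_supportedIn [IsManifold (𝓡 m) ∞ M] [VectorBundle ℂ (Fin k → ℂ) E]
    [ContMDiffVectorBundle ∞ (Fin k → ℂ) E (𝓡 m)] [SecondCountableTopology M]
    {S : Set (TestSection m k E)} (hS : Bornology.IsVonNBounded ℂ S) :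
    ∃ K : Set M, IsCompact K ∧ S ⊆ TestSection.supportedIn K := by
  classical
  have : LocallyCompactSpace M := ChartedSpace.locallyCompactSpace 𝔼 M
  let 𝓚 : CompactExhaustion M := default
  by_contra! hc
  have h1 : ∀ n : ℕ, ∃ s ∈ S, ∃ p ∉ 𝓚 n, ∃ (Φ : BundleChart m k E) (j : Fin k),
      p ∈ Φ.chart.source ∧ Φ.component s.1 j (Φ.chart p) ≠ 0 := by
    intro n
    obtain ⟨s, hs, hsn⟩ := not_subset.1 (hc (𝓚 n) (𝓚.isCompact n))
    have hsn' : ∃ p ∉ 𝓚 n, s.1 p ≠ 0 := by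
      by_contra! h
      exact hsn h
    obtain ⟨p, hp, hsp⟩ := hsn'
    obtain ⟨Φ, hΦ⟩ := exists_bundleChart (m := m) (k := k) (E := E) p
    have : ∃ j, Φ.component s.1 j (Φ.chart p) ≠ 0 := by
      by_contra! h
      exact hsp (Φ.eq_zero_of_component_eq_zero s.1 hΦ h)
    obtain ⟨j, hj⟩ := this
    exact ⟨s, hs, p, hp, Φ, j, hΦ, hj⟩
  choose s hs p hp Φ j hpΦ hne using h1
  -- If S is in no Γ_K, there are s_n ∈ S nonzero at points p_n outside the n-th set of an
  -- exhaustion. With these weights the functional at p_n takes the value n on s_n. On a fixed Γ_K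
  -- all but finitely many of the functionals vanish, so their supremum is a continuous seminorm
  -- that is unbounded on S.
  let c : ℕ → ℂ := fun n ↦ n / ((Φ n).component (s n).1 (j n) ((Φ n).chart (p n)))
  let idx : ℕ → DerivIndex m k E := fun n ↦ ⟨Φ n, {(Φ n).chart (p n)}, isCompact_singleton,
    singleton_subset_iff.2 ((Φ n).chart.map_source (hpΦ n)), 0⟩
  obtain ⟨A, hA⟩ := exists_forall_norm_le_of_isVonNBounded hS
    (fun n ↦ c n • (Φ n).componentAt (j n) ((Φ n).chart (p n))) fun K hK ↦ by
    obtain ⟨N, hN⟩ := 𝓚.exists_superset_of_isCompact hK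
    refine ⟨(Finset.range N).image idx, ∑ n ∈ Finset.range N, ‖c n‖₊, fun n t ht ↦ ?_⟩
    change ‖c n • (Φ n).component t.1 (j n) ((Φ n).chart (p n))‖ₑ ≤ _
    rcases lt_or_ge n N with hn | hn
    · have h0 := (idx n).enorm_le_supNorm t (j n) (mem_singleton _)
      rw [← ofReal_norm] at h0
      change ENNReal.ofReal ‖iteratedFDeriv ℝ 0 ((Φ n).component t.1 (j n)) _‖ ≤ _ at h0
      rw [norm_iteratedFDeriv_zero, ofReal_norm] at h0
      have h1 : ‖c n‖₊ ≤ ∑ n ∈ Finset.range N, ‖c n‖₊ :=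
        Finset.single_le_sum (f := fun n ↦ ‖c n‖₊) (fun _ _ ↦ zero_le) (Finset.mem_range.2 hn)
      have h2 : (idx n).supNorm t ≤ ⨆ ι ∈ (Finset.range N).image idx, ι.supNorm t :=
        le_iSup₂_of_le (f := fun (ι : DerivIndex m k E) _ ↦ ι.supNorm t) (idx n)
          (Finset.mem_image_of_mem _ (Finset.mem_range.2 hn)) le_rfl
      rw [enorm_smul]
      exact mul_le_mul' (ENNReal.coe_le_coe.2 h1) (h0.trans h2)
    · have hpK : p n ∉ K := fun h ↦ hp n (𝓚.subset hn (hN h))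
      have e1 : (Φ n).component t.1 (j n) ((Φ n).chart (p n)) = 0 := by
        rw [(Φ n).component_chart _ _ (hpΦ n), ht _ hpK]
        rfl
      simp [e1]
  obtain ⟨n, hn⟩ := exists_nat_gt A
  have h1 : ‖c n • (Φ n).component (s n).1 (j n) ((Φ n).chart (p n))‖ ≤ A := hA n (s n) (hs n)
  rw [smul_eq_mul, div_mul_cancel₀ _ (hne n), Complex.norm_natCast] at h1
  linarith

variable [T2Space M] [IsManifold (𝓡 m) ∞ M] [VectorBundle ℂ (Fin k → ℂ) E]
    [ContMDiffVectorBundle ∞ (Fin k → ℂ) E (𝓡 m)] [SecondCountableTopology M]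

/-- Ultrafilters on bounded sets of test sections are Cauchy. -/
theorem Ultrafilter.eventually_seminorm_sub_le {S : Set (TestSection m k E)}
    (hS : Bornology.IsVonNBounded ℂ S) (𝓤 : Ultrafilter S) {q : Seminorm ℂ (TestSection m k E)}
    (hq : IsLFSeminorm q) {ε : ℝ} (hε : 0 < ε) :
    ∀ᶠ z in (𝓤 : Filter S) ×ˢ (𝓤 : Filter S), q (z.1.1 - z.2.1) ≤ ε := by
  obtain ⟨K, hK, hSK⟩ := exists_subset_supportedIn hS
  obtain ⟨𝓒, h𝓒⟩ := exists_chartFamily_covers (m := m) (k := k) (E := E) hK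
  obtain ⟨N, D, hD, h⟩ := hq.exists_le h𝓒 hK
  -- With a common compact support, q sees only finitely many charts, orders and components; D + 1
  -- instead of D allows for D = 0.
  have h1 : ∀ᶠ z in (𝓤 : Filter S) ×ˢ (𝓤 : Filter S), ∀ (i : 𝓒.ι) (n : Fin (N + 1)) (j : Fin k),
      ∀ y ∈ 𝓒.C i, ‖iteratedFDeriv ℝ n ((𝓒.Φ i).component z.1.1.1 j) y -
        iteratedFDeriv ℝ n ((𝓒.Φ i).component z.2.1.1 j) y‖ ≤ ε / (D + 1) := by
    simp only [Filter.eventually_all]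
    intro i n j
    refine 𝓤.eventually_norm_iteratedFDeriv_sub_le (g := fun s : S ↦ (𝓒.Φ i).component s.1.1 j)
      (𝓒.Φ i).chart.open_target (fun s ↦ s.1.contDiffOn_component _ _) (fun n' C' hC' hCt' ↦ ?_)
      (𝓒.isCompact_C i) (𝓒.C_subset i) n (by positivity)
    obtain ⟨A, hA⟩ := exists_norm_iteratedFDeriv_component_le hS (𝓒.Φ i) n' j hC' hCt'
    exact ⟨A, fun s ↦ hA s.1 s.2⟩
  refine h1.mono fun z hz ↦ ?_
  refine (h (z.1.1 - z.2.1) (fun p hp ↦ ?_) (ε / (D + 1)) (by positivity) ?_).trans ?_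
  · change z.1.1.1 p - z.2.1.1 p = 0
    rw [hSK z.1.2 p hp, hSK z.2.2 p hp]
    exact sub_self (G := E p →ₗ[ℂ] densitySpace m (TangentSpace (𝓡 m) p)) 0
  · intro i n hn j y hy
    have h2 := hz i ⟨n, by omega⟩ j y hy
    have h3 := map_sub ((𝓒.Φ i).derivAt n j ⟨y, 𝓒.C_subset i hy⟩) z.1.1 z.2.1
    exact (congrArg norm h3).le.trans h2
  · rw [mul_div_assoc', div_le_iff₀ (by positivity)]
    nlinarith

/-- The polar of a neighbourhood of `0` is strongly compact, in terms of ultrafilters. -/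
theorem Ultrafilter.exists_le_nhds_of_forall_norm_le {q : Seminorm ℂ (TestSection m k E)}
    (hq : IsLFSeminorm q) (𝓤 : Ultrafilter (DistSection m k E))
    (h𝓤 : ∀ᶠ u in (𝓤 : Filter (DistSection m k E)), ∀ s, ‖u s‖ ≤ q s) :
    ∃ u : DistSection m k E, (∀ s, ‖u s‖ ≤ q s) ∧ (𝓤 : Filter (DistSection m k E)) ≤ 𝓝 u := by
  have h1 : ∀ s, ∃ a : ℂ, ‖a‖ ≤ q s ∧
      Tendsto (fun u : DistSection m k E ↦ u s) 𝓤 (𝓝 a) := by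
    intro s
    obtain ⟨a, ha, hlim⟩ := (isCompact_closedBall (0 : ℂ) (q s)).ultrafilter_le_nhds
      (𝓤.map fun u : DistSection m k E ↦ u s) (by
        rw [le_principal_iff]
        exact Filter.mem_map.2 (h𝓤.mono fun u hu ↦ by simpa using hu s))
    exact ⟨a, by simpa using ha, hlim⟩
  choose a ha hlim using h1
  let f : TestSection m k E →ₗ[ℂ] ℂ :=
    { toFun := a
      map_add' := fun s t ↦ tendsto_nhds_unique (hlim (s + t)) (by
        simpa using (hlim s).add (hlim t))
      map_smul' := fun c s ↦ tendsto_nhds_unique (hlim (c • s)) (by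
        simpa using (hlim s).const_mul c) }
  -- The pointwise limit inherits the bound by q, hence is continuous.
  have hcont : Continuous f := by
    refine TestSection.withSeminorms.continuous_normedSpace_rng (F := ℂ) f
      ⟨{⟨q, hq⟩}, 1, fun s ↦ ?_⟩
    rw [Finset.sup_singleton, one_smul]
    exact ha s
  let u₀ : DistSection m k E := ⟨f, hcont⟩
  refine ⟨u₀, ha, ?_⟩
  change Tendsto id (𝓤 : Filter (DistSection m k E)) (𝓝 u₀)
  rw [← tendsto_sub_nhds_zero_iff, ContinuousLinearMap.hasBasis_nhds_zero.tendsto_right_iff]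
  rintro ⟨S, V⟩ ⟨hS, hV⟩
  obtain ⟨ε, hε, hεV⟩ := Metric.nhds_basis_closedBall.mem_iff.1 hV
  refine (Ultrafilter.eventually_or.1 (Filter.Eventually.of_forall (f := (𝓤 : Filter (DistSection m k E))) fun u : DistSection m k E ↦
    em (∀ s ∈ S, ‖u s - u₀ s‖ ≤ ε))).elim (fun h ↦ h.mono fun u hu s hs ↦ hεV (by
      simpa using hu s hs)) fun h ↦ ?_
  exfalso
  -- Suppose that almost every u differs from u₀ by more than ε at some σ(u) ∈ S. The image of the
  -- ultrafilter under σ is Cauchy for q, so σ(u) may be replaced by a fixed σ(u₁): this costs ε/3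
  -- for u and ε/3 for u₀. Pointwise convergence at σ(u₁) supplies the last third, a contradiction.
  have hS0 : ∀ u : DistSection m k E, ∃ s : S, (¬ ∀ s ∈ S, ‖u s - u₀ s‖ ≤ ε) →
      ε < ‖u s.1 - u₀ s.1‖ := by
    obtain ⟨u', hu'⟩ := h.exists
    push Not at hu'
    obtain ⟨s', hs', -⟩ := hu'
    intro u
    by_cases hu : ∀ s ∈ S, ‖u s - u₀ s‖ ≤ ε
    · exact ⟨⟨s', hs'⟩, fun h ↦ absurd hu h⟩
    · push Not at hu
      obtain ⟨s, hs, hlt⟩ := hu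
      exact ⟨⟨s, hs⟩, fun _ ↦ hlt⟩
  choose σ hσ using hS0
  have h2 := (𝓤.map σ).eventually_seminorm_sub_le hS hq (ε := ε / 3) (by positivity)
  obtain ⟨P, hP, P', hP', hPP⟩ := Filter.eventually_prod_iff.1 h2
  have hP1 : ∀ᶠ u in (𝓤 : Filter (DistSection m k E)), P (σ u) := hP
  have hP2 : ∀ᶠ u in (𝓤 : Filter (DistSection m k E)), P' (σ u) := hP'
  obtain ⟨u₁, hu₁⟩ := hP2.exists
  have h3 : ∀ᶠ u in (𝓤 : Filter (DistSection m k E)), ‖u (σ u₁).1 - u₀ (σ u₁).1‖ < ε / 3 := by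
    have := (tendsto_sub_nhds_zero_iff.2 (hlim (σ u₁).1)).norm
    rw [norm_zero] at this
    exact this.eventually (gt_mem_nhds (by positivity))
  obtain ⟨u, hu, huP, hu3, huq⟩ := (h.and (hP1.and (h3.and h𝓤))).exists
  have h4 := hσ u hu
  have h5 := hPP huP hu₁
  have e : u (σ u).1 - u₀ (σ u).1 = u ((σ u).1 - (σ u₁).1) - u₀ ((σ u).1 - (σ u₁).1) +
      (u (σ u₁).1 - u₀ (σ u₁).1) := by
    simp only [map_sub]; ring
  rw [e] at h4
  have h6 := norm_add_le (u ((σ u).1 - (σ u₁).1) - u₀ ((σ u).1 - (σ u₁).1))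
    (u (σ u₁).1 - u₀ (σ u₁).1)
  have h7 := norm_sub_le (u ((σ u).1 - (σ u₁).1)) (u₀ ((σ u).1 - (σ u₁).1))
  have h8 := huq ((σ u).1 - (σ u₁).1)
  have h9 : ‖u₀ ((σ u).1 - (σ u₁).1)‖ ≤ q ((σ u).1 - (σ u₁).1) := ha _
  linarith

end Montel

/-! ### Covectors in coordinates, and conic neighbourhoods that avoid L. -/

section CotangentCoordinates

variable {m : ℕ} {M : Type*} [TopologicalSpace M] [ChartedSpace (EuclideanSpace ℝ (Fin m)) M]

local notation "𝔼" => EuclideanSpace ℝ (Fin m)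

/-! ### Coordinates on the cotangent bundle -/

/-- The covector `∑ ζᵢ dxⁱ|ₚ`. -/
noncomputable def chartCovector (x : OpenPartialHomeomorph M 𝔼) (p : M) (ζ : 𝔼) :
    TangentSpace (𝓡 m) p →L[ℝ] ℝ :=
  (innerSL ℝ ζ).comp (mfderiv (𝓡 m) (𝓡 m) x p : TangentSpace (𝓡 m) p →L[ℝ] 𝔼)

theorem covectorCoords_chartCovector {x : OpenPartialHomeomorph M 𝔼}
    (hx : x ∈ IsManifold.maximalAtlas (𝓡 m) ∞ M) {p : M} (hp : p ∈ x.source) (ζ : 𝔼) :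
    covectorCoords x (chartCovector x p ζ) = ζ := by
  ext i
  change inner ℝ ζ (mfderiv (𝓡 m) (𝓡 m) x p (coordVec x p i) : 𝔼) = ζ i
  rw [mfderiv_coordVec_self hx hp i, EuclideanSpace.inner_single_right]
  simp

theorem covectorCoords_smul (x : OpenPartialHomeomorph M 𝔼) {p : M} (t : ℝ)
    (ξ : TangentSpace (𝓡 m) p →L[ℝ] ℝ) :
    covectorCoords x (t • ξ) = t • covectorCoords x ξ := rfl

theorem covectorCoords_zero (x : OpenPartialHomeomorph M 𝔼) (p : M) :
    covectorCoords x (0 : TangentSpace (𝓡 m) p →L[ℝ] ℝ) = 0 := rfl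

theorem chartCovector_covectorCoords {x : OpenPartialHomeomorph M 𝔼}
    (hx : x ∈ IsManifold.maximalAtlas (𝓡 m) ∞ M) {p : M} (hp : p ∈ x.source)
    (ξ : TangentSpace (𝓡 m) p →L[ℝ] ℝ) : chartCovector x p (covectorCoords x ξ) = ξ := by
  have hd : x.MDifferentiable (𝓡 m) (𝓡 m) :=
    ⟨(contMDiffOn_of_mem_maximalAtlas hx).mdifferentiableOn (by simp),
      (contMDiffOn_symm_of_mem_maximalAtlas hx).mdifferentiableOn (by simp)⟩
  refine ContinuousLinearMap.ext fun v ↦ ?_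
  have h1 := hd.symm_comp_deriv hp
  have h2 : mfderiv (𝓡 m) (𝓡 m) x.symm (x p) (mfderiv (𝓡 m) (𝓡 m) x p v) = v :=
    congrArg (fun f : TangentSpace (𝓡 m) p →L[ℝ] TangentSpace (𝓡 m) p ↦ f v) h1
  let w : 𝔼 := mfderiv (𝓡 m) (𝓡 m) x p v
  let D : 𝔼 →L[ℝ] TangentSpace (𝓡 m) p := mfderiv (𝓡 m) (𝓡 m) x.symm (x p)
  have h3 : w = ∑ i, w i • EuclideanSpace.single i (1 : ℝ) := by
    have := (EuclideanSpace.basisFun (Fin m) ℝ).sum_repr w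
    simpa using this.symm
  have h4 : D w = v := h2
  have h5 : ξ v = ∑ i, w i * ξ (coordVec x p i) := by
    rw [← h4, h3, map_sum, map_sum]
    refine Finset.sum_congr rfl fun i _ ↦ ?_
    rw [map_smul, map_smul, ← h3]
    rfl
  change inner ℝ (covectorCoords x ξ) w = ξ v
  rw [h5, PiLp.inner_apply]
  rfl

variable [IsManifold (𝓡 m) ∞ M]

/-- In the trivialisation of T*M at p the map is composition with the derivative of the chart, which
varies continuously. This links the bundle topology, in which L is closed, with products of sets of
points and directions. -/
theorem continuousAt_chartCovector {x : OpenPartialHomeomorph M 𝔼}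
    (hx : x ∈ IsManifold.maximalAtlas (𝓡 m) ∞ M) {p : M} (hp : p ∈ x.source) (ζ : 𝔼) :
    ContinuousAt (fun z : M × 𝔼 ↦ (⟨z.1, chartCovector x z.1 z.2⟩ :
      TotalSpace (𝔼 →L[ℝ] ℝ) fun p : M ↦ TangentSpace (𝓡 m) p →L[ℝ] ℝ)) (p, ζ) := by
  refine (continuousAt_hom_bundle (σ := RingHom.id ℝ) (E₂ := Trivial M ℝ)
    (E₁ := fun p : M ↦ TangentSpace (𝓡 m) p) _).2 ⟨continuousAt_fst, ?_⟩
  have h1 : ContinuousAt (inTangentCoordinates (𝓡 m) (𝓡 m) id x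
      (mfderiv (𝓡 m) (𝓡 m) x) p) p :=
    ((contMDiffAt_of_mem_maximalAtlas hx hp).mfderiv_const (m := 0) (by simp)).continuousAt
  have h2 : ContinuousAt (fun z : M × 𝔼 ↦ (innerSL ℝ z.2).comp
      (inTangentCoordinates (𝓡 m) (𝓡 m) id x (mfderiv (𝓡 m) (𝓡 m) x) p z.1)) (p, ζ) :=
    ((innerSL ℝ).continuous.continuousAt.comp continuousAt_snd).clm_comp
      (ContinuousAt.comp (f := Prod.fst) (x := (p, ζ)) h1 continuousAt_fst)
  convert h2 using 2 with z
  ext v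
  simp [inTangentCoordinates, ContinuousLinearMap.inCoordinates, chartCovector]
  rfl

theorem exists_covectorCoords_eq {x : OpenPartialHomeomorph M 𝔼}
    (hx : x ∈ IsManifold.maximalAtlas (𝓡 m) ∞ M) {p : M} (hp : p ∈ x.source) {ζ : 𝔼}
    (hζ : ζ ≠ 0) : ∃ q : CotangentMinusZero m M, q.1.1 = p ∧ covectorCoords x q.1.2 = ζ := by
  refine ⟨⟨⟨p, chartCovector x p ζ⟩, fun h ↦ hζ ?_⟩, rfl, covectorCoords_chartCovector hx hp ζ⟩
  rw [← covectorCoords_chartCovector hx hp ζ]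
  change chartCovector x p ζ = 0 at h
  rw [h, covectorCoords_zero]

theorem covectorCoords_ne_zero {x : OpenPartialHomeomorph M 𝔼}
    (hx : x ∈ IsManifold.maximalAtlas (𝓡 m) ∞ M) (q : CotangentMinusZero m M)
    (hq : q.1.1 ∈ x.source) : covectorCoords x q.1.2 ≠ 0 := by
  intro h
  refine q.2 ?_
  rw [← chartCovector_covectorCoords hx hq q.1.2, h, chartCovector, map_zero]
  exact ContinuousLinearMap.zero_comp _

/-- The interior of a cone `unitCone ν ε`. -/
def openUnitCone (ν : 𝔼) (ε : ℝ) : Set 𝔼 := {ξ | ‖ξ - ‖ξ‖ • ν‖ < ε * ‖ξ‖}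

theorem isOpen_openUnitCone (ν : 𝔼) (ε : ℝ) : IsOpen (openUnitCone ν ε) :=
  isOpen_lt (by fun_prop) (by fun_prop)

theorem isConeSet_openUnitCone (ν : 𝔼) (ε : ℝ) : IsConeSet (openUnitCone ν ε) := by
  intro ξ hξ t ht
  simp only [openUnitCone, mem_ofPred_eq, norm_smul, Real.norm_of_nonneg ht.le] at hξ ⊢
  rw [mul_smul, ← smul_sub, norm_smul, Real.norm_of_nonneg ht.le, mul_left_comm]
  exact mul_lt_mul_of_pos_left hξ ht

theorem openUnitCone_subset (ν : 𝔼) (ε : ℝ) : openUnitCone ν ε ⊆ unitCone ν ε :=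
  fun _ h ↦ le_of_lt (mem_ofPred_eq.mp h : _ < _)

theorem zero_notMem_openUnitCone (ν : 𝔼) (ε : ℝ) : 0 ∉ openUnitCone ν ε := by
  simp [openUnitCone]

theorem self_mem_openUnitCone {η : 𝔼} (hη : η ≠ 0) {ε : ℝ} (hε : 0 < ε) :
    η ∈ openUnitCone (‖η‖⁻¹ • η) ε := by
  have h := norm_pos_iff.2 hη
  simp only [openUnitCone, mem_ofPred_eq, smul_smul, mul_inv_cancel₀ h.ne', one_smul, sub_self,
    norm_zero]
  positivity

variable {k : ℕ} {E : M → Type*} [TopologicalSpace (TotalSpace (Fin k → ℂ) E)]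
  [∀ p, AddCommGroup (E p)] [∀ p, Module ℂ (E p)] [∀ p, TopologicalSpace (E p)]
  [FiberBundle (Fin k → ℂ) E]

/-- A point outside of a closed conic set has a conic neighbourhood that is disjoint from it. -/
theorem exists_supportConeDisjoint {L : Set (CotangentMinusZero m M)} (hL : IsClosed L)
    (hLc : IsConicSet L) {q : CotangentMinusZero m M} (hq : q ∉ L) (Φ : BundleChart m k E)
    (hqΦ : q.1.1 ∈ Φ.chart.source) : ∃ φ : TestFunction Φ.Ω ℂ ⊤, φ (Φ.chart q.1.1) ≠ 0 ∧
      ∃ ε > 0, SupportConeDisjoint Φ φ (unitCone (‖covectorCoords Φ.chart q.1.2‖⁻¹ •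
        covectorCoords Φ.chart q.1.2) ε) L := by
  set η := covectorCoords Φ.chart q.1.2 with hη
  have hη0 : η ≠ 0 := covectorCoords_ne_zero Φ.chart_mem q hqΦ
  have hn : 0 < ‖η‖ := norm_pos_iff.2 hη0
  obtain ⟨O, hO, hOL⟩ := isOpen_induced_iff.1 hL.isOpen_compl
  have hmem : ∀ q' : CotangentMinusZero m M, q'.1 ∈ O ↔ q' ∉ L := fun q' ↦ by
    change q' ∈ Subtype.val ⁻¹' O ↔ _
    rw [hOL, mem_compl_iff]
  -- Since L is conic, membership can be tested on any positive multiple. A neighbourhood of the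
  -- unit covector of q then controls a whole cone of directions.
  have hscale : ∀ (q' : CotangentMinusZero m M), q'.1.1 ∈ Φ.chart.source → ∀ (t : ℝ) (ht : 0 < t),
      ((⟨q'.1.1, chartCovector Φ.chart q'.1.1 (t • covectorCoords Φ.chart q'.1.2)⟩ :
        TotalSpace (𝔼 →L[ℝ] ℝ) fun p : M ↦ TangentSpace (𝓡 m) p →L[ℝ] ℝ) ∈ O ↔ q' ∉ L) := by
    intro q' hq' t ht
    rw [← covectorCoords_smul, chartCovector_covectorCoords Φ.chart_mem hq']
    rw [hmem ⟨⟨q'.1.1, t • q'.1.2⟩, smul_ne_zero ht.ne' q'.2⟩, not_iff_not]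
    refine ⟨fun h ↦ ?_, fun h ↦ hLc q' h t ht⟩
    have h1 := hLc _ h t⁻¹ (inv_pos.2 ht)
    convert h1 using 1
    refine Subtype.ext ?_
    change q'.1 = ⟨q'.1.1, t⁻¹ • t • q'.1.2⟩
    rw [inv_smul_smul₀ ht.ne']
  have hN := (continuousAt_chartCovector Φ.chart_mem hqΦ (‖η‖⁻¹ • η)).preimage_mem_nhds
    (hO.mem_nhds ((hscale q hqΦ _ (inv_pos.2 hn)).2 hq))
  rw [nhds_prod_eq, mem_prod_iff] at hN
  obtain ⟨N₁, hN₁, N₂, hN₂, hNN⟩ := hN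
  obtain ⟨ε, hε, hεN⟩ := Metric.nhds_basis_closedBall.mem_iff.1 hN₂
  have hy := Φ.chart.map_source hqΦ
  have hN₃ : Φ.chart.target ∩ Φ.chart.symm ⁻¹' N₁ ∈ 𝓝 (Φ.chart q.1.1) := by
    refine inter_mem (Φ.chart.open_target.mem_nhds hy) ((Φ.chart.continuousAt_symm hy) ?_)
    rwa [Φ.chart.left_inv hqΦ]
  obtain ⟨ρ, hρ, hρN⟩ := Metric.nhds_basis_closedBall.mem_iff.1 hN₃
  let b : ContDiffBump (Φ.chart q.1.1) := ⟨ρ / 2, ρ, half_pos hρ, half_lt_self hρ⟩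
  have hts : tsupport (fun y ↦ ((b y : ℝ) : ℂ)) ⊆ Metric.closedBall (Φ.chart q.1.1) ρ := by
    refine (tsupport_comp_subset Complex.ofReal_zero b).trans ?_
    rw [b.tsupport_eq]
  let φ : TestFunction Φ.Ω ℂ ⊤ :=
    { toFun := fun y ↦ ((b y : ℝ) : ℂ)
      contDiff' := Complex.ofRealCLM.contDiff.comp b.contDiff
      hasCompactSupport' := b.hasCompactSupport.comp_left Complex.ofReal_zero
      tsupport_subset' := hts.trans (hρN.trans inter_subset_left) }
  refine ⟨φ, ?_, ε, hε, fun q' hq' hqs hqt hqV ↦ ?_⟩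
  · change ((b (Φ.chart q.1.1) : ℝ) : ℂ) ≠ 0
    rw [b.one_of_mem_closedBall (Metric.mem_closedBall_self b.rIn_pos.le)]
    simp
  · have h0 := covectorCoords_ne_zero Φ.chart_mem q' hqs
    have h1 := (hρN (hts hqt)).2
    rw [mem_preimage, Φ.chart.left_inv hqs] at h1
    have h2 := hNN (mk_mem_prod h1 (hεN (smul_unitCone_mem_closedBall hqV h0)))
    exact (hscale q' hqs _ (inv_pos.2 (norm_pos_iff.2 h0))).1 h2 hq'

end CotangentCoordinates

/-! ### Energies in balls and their tails. -/

section EnergyLimits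

variable {m : ℕ}

local notation "𝔼" => EuclideanSpace ℝ (Fin m)

/-! ### Splitting energies into low and high frequencies -/

theorem weightedEnergy_sub_comm (r : ℝ) (V : Set 𝔼) (f g : 𝔼 → ℂ) :
    weightedEnergy r V (f - g) = weightedEnergy r V (g - f) := by
  unfold weightedEnergy
  simp only [Pi.sub_apply, norm_sub_rev]

theorem weightedEnergy_sub_le (r : ℝ) (V : Set 𝔼) {f g : 𝔼 → ℂ} (hf : Measurable f) :
    weightedEnergy r V (f - g) ≤ 2 * weightedEnergy r V f + 2 * weightedEnergy r V g := by
  have h := weightedEnergy_add_le r V hf (-g)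
  have e : weightedEnergy r V (-g) = weightedEnergy r V g := by
    simp [weightedEnergy]
  rwa [e, ← sub_eq_add_neg] at h

theorem weightedEnergy_le_add (r : ℝ) (V : Set 𝔼) (f : 𝔼 → ℂ) (R : ℝ) :
    weightedEnergy r V f ≤
      weightedEnergy r (V ∩ {ξ | ‖ξ‖ ≤ R}) f + weightedEnergy r (V ∩ {ξ | R < ‖ξ‖}) f := by
  refine (weightedEnergy_mono r (fun ξ hξ ↦ ?_) f).trans (weightedEnergy_union_le _ _ _ _)
  rcases le_or_gt ‖ξ‖ R with h | h
  exacts [Or.inl ⟨hξ, h⟩, Or.inr ⟨hξ, h⟩]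

/-- The energy of the function `1` in a ball is finite. -/
theorem weightedEnergy_ball_lt_top (r R : ℝ) :
    ∫⁻ ξ in {ξ : 𝔼 | ‖ξ‖ ≤ R}, ENNReal.ofReal ((1 + ‖ξ‖ ^ 2) ^ r) < ⊤ := by
  have e : {ξ : 𝔼 | ‖ξ‖ ≤ R} = Metric.closedBall 0 R := by
    ext ξ; simp
  rw [e]
  refine ((continuous_one_add_norm_sq_rpow r).continuousOn.integrableOn_compact
    (isCompact_closedBall _ _)).lintegral_lt_top

theorem weightedEnergy_le_of_norm_le (r : ℝ) (V : Set 𝔼) (R : ℝ) {f : 𝔼 → ℂ} {ε : ℝ}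
    (h : ∀ ξ, ‖ξ‖ ≤ R → ‖f ξ‖ ≤ ε) : weightedEnergy r (V ∩ {ξ | ‖ξ‖ ≤ R}) f ≤
      (∫⁻ ξ in {ξ : 𝔼 | ‖ξ‖ ≤ R}, ENNReal.ofReal ((1 + ‖ξ‖ ^ 2) ^ r)) * ENNReal.ofReal ε ^ 2 := by
  refine (weightedEnergy_mono r inter_subset_right f).trans ?_
  rw [weightedEnergy_eq, mul_comm, ← lintegral_const_mul' _ _ (by simp)]
  refine setLIntegral_mono ((measurable_weight r).const_mul _) fun ξ hξ ↦ ?_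
  gcongr
  rw [← ofReal_norm]
  exact ENNReal.ofReal_le_ofReal (h ξ hξ)

theorem weightedEnergy_lt_top_of_continuous (r : ℝ) (V : Set 𝔼) (R : ℝ) {f : 𝔼 → ℂ}
    (hf : Continuous f) : weightedEnergy r (V ∩ {ξ | ‖ξ‖ ≤ R}) f < ⊤ := by
  obtain ⟨C, hC⟩ := (isCompact_closedBall (0 : 𝔼) R).exists_bound_of_continuousOn hf.continuousOn
  refine (weightedEnergy_le_of_norm_le r V R fun ξ hξ ↦ hC ξ (by simpa using hξ)).trans_lt ?_
  exact ENNReal.mul_lt_top (weightedEnergy_ball_lt_top r R) (by simp)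

/-- Continuity from below of the measure with density |f|²⟨ξ⟩^{2r} along balls; it holds for
arbitrary V, measurable or not. -/
theorem weightedEnergy_le_of_forall_ball (r : ℝ) (V : Set 𝔼) (f : 𝔼 → ℂ) {c : ℝ≥0∞}
    (h : ∀ n : ℕ, weightedEnergy r (V ∩ {ξ | ‖ξ‖ ≤ n}) f ≤ c) : weightedEnergy r V f ≤ c := by
  have hV : V = ⋃ n : ℕ, V ∩ {ξ | ‖ξ‖ ≤ n} := by
    ext ξ
    simp only [mem_iUnion, mem_inter_iff, mem_ofPred_eq, exists_and_left, iff_self_and]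
    exact fun _ ↦ exists_nat_ge _
  have hd : Directed (· ⊆ ·) fun n : ℕ ↦ V ∩ {ξ : 𝔼 | ‖ξ‖ ≤ n} :=
    Monotone.directed_le fun a b hab ξ hξ ↦ ⟨hξ.1, le_trans (show ‖ξ‖ ≤ a from hξ.2)
      (by exact_mod_cast hab)⟩
  have h1 := hd.measure_iUnion (μ := volume.withDensity fun ξ : 𝔼 ↦
    ENNReal.ofReal (‖f ξ‖ ^ 2 * (1 + ‖ξ‖ ^ 2) ^ r))
  rw [← hV] at h1
  simp only [withDensity_apply'] at h1
  unfold weightedEnergy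
  rw [h1]
  exact iSup_le h

theorem exists_pos_mul_ofReal_sq_le {C δ : ℝ≥0∞} (hC : C ≠ ⊤) (hδ : 0 < δ) :
    ∃ ε : ℝ, 0 < ε ∧ C * ENNReal.ofReal ε ^ 2 ≤ δ := by
  have h1 : Tendsto (fun ε : ℝ ↦ C * ENNReal.ofReal ε ^ 2) (𝓝[>] 0) (𝓝 0) := by
    have h2 : Continuous fun ε : ℝ ↦ C * ENNReal.ofReal ε ^ 2 :=
      (ENNReal.continuous_const_mul hC).comp
        ((ENNReal.continuous_pow 2).comp ENNReal.continuous_ofReal)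
    have h3 := (h2.tendsto 0).mono_left (nhdsWithin_le_nhds (s := Ioi 0))
    simpa using h3
  obtain ⟨ε, h, hε⟩ := ((ENNReal.tendsto_nhds_zero.1 h1 δ hδ).and self_mem_nhdsWithin).exists
  exact ⟨ε, hε, h⟩

theorem ENNReal.rpow_half_le_iff {x y : ℝ≥0∞} : x ^ (1 / 2 : ℝ) ≤ y ↔ x ≤ y ^ 2 := by
  rw [one_div, ENNReal.rpow_inv_le_iff (by norm_num), ENNReal.rpow_ofNat]

/-- Some tail is at most 1, and a continuous function has finite energy in the remaining ball. -/
theorem UniformTails.weightedEnergy_lt_top {ι : Type*} {r : ℝ} {V : Set 𝔼} {f : ι → 𝔼 → ℂ}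
    (h : UniformTails r V f) (i : ι) (hf : Continuous (f i)) : weightedEnergy r V (f i) < ⊤ := by
  obtain ⟨R, hR⟩ := (ENNReal.tendsto_nhds_zero.1 h 1 one_pos).exists
  refine (weightedEnergy_le_add r V (f i) R).trans_lt
    (ENNReal.add_lt_top.2 ⟨weightedEnergy_lt_top_of_continuous r V R hf, ?_⟩)
  exact ((le_iSup (fun i ↦ weightedEnergy r (V ∩ {ξ | R < ‖ξ‖}) (f i)) i).trans hR).trans_lt
    ENNReal.one_lt_top

end EnergyLimits

/-! ### Tails, wave front sets and compactness in D'^r_L. -/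

section SobolevWaveFront

variable {m k : ℕ} {M : Type*} [TopologicalSpace M]
  [ChartedSpace (EuclideanSpace ℝ (Fin m)) M] [T2Space M]
  {E : M → Type*} [TopologicalSpace (TotalSpace (Fin k → ℂ) E)]
  [∀ p, AddCommGroup (E p)] [∀ p, Module ℂ (E p)] [∀ p, TopologicalSpace (E p)]
  [FiberBundle (Fin k → ℂ) E]

local notation "𝔼" => EuclideanSpace ℝ (Fin m)

/-! ### Fourier transforms of local representatives -/

/-- The Fourier transform of `φ u_Φʲ`. -/
noncomputable abbrev DistSection.componentFourier (u : DistSection m k E) (Φ : BundleChart m k E)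
    (j : Fin k) (φ : TestFunction Φ.Ω ℂ ⊤) : 𝔼 → ℂ := localFourier (u.localize Φ j) φ

theorem componentFourier_sub (u v : DistSection m k E) (Φ : BundleChart m k E) (j : Fin k)
    (φ : TestFunction Φ.Ω ℂ ⊤) : DistSection.componentFourier (u - v) Φ j φ =
      u.componentFourier Φ j φ - v.componentFourier Φ j φ := rfl

/-- Derivatives of e^{-i x·ξ}φ are bounded uniformly for |ξ| ≤ R, so the strong topology controls
the Fourier transform uniformly on balls. -/
theorem isVonNBounded_range_modulate (Φ : BundleChart m k E) (j : Fin k)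
    (φ : TestFunction Φ.Ω ℂ ⊤) (R : ℝ) : Bornology.IsVonNBounded ℂ
      ((fun ξ ↦ Φ.localSection j (modulate φ ξ)) '' {ξ : 𝔼 | ‖ξ‖ ≤ R}) := by
  rw [isVonNBounded_testSection_iff]
  intro q hq
  obtain ⟨N, D, hD, h⟩ := hq.exists_localSection_le Φ φ.hasCompactSupport.isCompact
    φ.tsupport_subset
  obtain ⟨C, hC, hφ⟩ := exists_iteratedFDeriv_smoothMul_le φ N
  refine ⟨D * (C * (1 + |R|) ^ N), ?_⟩
  rintro _ ⟨ξ, hξ, rfl⟩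
  have hξ' : ‖ξ‖ ≤ R := hξ
  refine h j _ (tsupport_modulate φ ξ) _ (by positivity) (hφ (smoothExpChar ξ) _ (by positivity)
    fun n hn x _ ↦ (norm_iteratedFDeriv_expChar_le hn ξ x).trans ?_)
  gcongr
  exact hξ'.trans (le_abs_self R)

theorem eventually_norm_componentFourier_sub_le (u : DistSection m k E) (Φ : BundleChart m k E)
    (j : Fin k) (φ : TestFunction Φ.Ω ℂ ⊤) (R : ℝ) {ε : ℝ} (hε : 0 < ε) :
    ∀ᶠ v : DistSection m k E in 𝓝 u, ∀ ξ : 𝔼, ‖ξ‖ ≤ R →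
      ‖(v.componentFourier Φ j φ - u.componentFourier Φ j φ) ξ‖ ≤ ε := by
  have h1 : Tendsto (fun v : DistSection m k E ↦ v - u) (𝓝 u) (𝓝 0) :=
    tendsto_sub_nhds_zero_iff.2 tendsto_id
  have h2 := ContinuousLinearMap.hasBasis_nhds_zero.tendsto_right_iff.1 h1
    (_, Metric.closedBall 0 ε)
    ⟨isVonNBounded_range_modulate Φ j φ R, Metric.closedBall_mem_nhds 0 hε⟩
  refine h2.mono fun v hv ξ hξ ↦ ?_
  have h3 : (v - u) (Φ.localSection j (modulate φ ξ)) ∈ Metric.closedBall (0 : ℂ) ε :=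
    hv _ ⟨ξ, hξ, rfl⟩
  rwa [mem_closedBall_zero_iff] at h3

/-- The low frequency part of the energy is continuous. -/
theorem tendsto_weightedEnergy_componentFourier_sub (r : ℝ) (u : DistSection m k E)
    (Φ : BundleChart m k E) (j : Fin k) (φ : TestFunction Φ.Ω ℂ ⊤) (V : Set 𝔼) (R : ℝ) :
    Tendsto (fun v : DistSection m k E ↦ weightedEnergy r (V ∩ {ξ | ‖ξ‖ ≤ R})
      (v.componentFourier Φ j φ - u.componentFourier Φ j φ)) (𝓝 u) (𝓝 0) := by
  rw [ENNReal.tendsto_nhds_zero]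
  intro δ hδ
  obtain ⟨ε, hε, h⟩ := exists_pos_mul_ofReal_sq_le (weightedEnergy_ball_lt_top (m := m) r R).ne hδ
  filter_upwards [eventually_norm_componentFourier_sub_le u Φ j φ R hε] with v hv
  exact (weightedEnergy_le_of_norm_le r V R hv).trans h

theorem sobolevSeminorm_sub_self (r : ℝ) (Φ : BundleChart m k E) (φ : TestFunction Φ.Ω ℂ ⊤) (V : Set 𝔼)
    (u : DistSection m k E) : sobolevSeminorm r Φ φ V (u - u) = 0 := by
  refine le_antisymm (iSup_le fun j ↦ ?_) zero_le
  change weightedEnergy r V (DistSection.componentFourier (u - u) Φ j φ) ^ (1 / 2 : ℝ) ≤ 0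
  rw [componentFourier_sub, sub_self]
  simp [weightedEnergy]

variable [IsManifold (𝓡 m) ∞ M]

/-! ### Wave front sets and tails -/

theorem WFc_singleton_subset (r : ℝ) (u : DistSection m k E) : WFc r {u} ⊆ WF r u := by
  rintro q ⟨Φ, hq, hη⟩
  refine ⟨Φ, hq, ?_⟩
  obtain ⟨j, hj⟩ := mem_iUnion.1 hη
  rw [image_singleton] at hj
  refine mem_iUnion.2 ⟨j, (sigmaCompactAt_singleton_subset _ _ hj).resolve_right ?_⟩
  exact covectorCoords_ne_zero Φ.chart_mem q hq

variable {r : ℝ} {L : Set (CotangentMinusZero m M)} {B : Set (DistSection m k E)}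

/-- A covector outside L has a product neighbourhood disjoint from L. The uniform tails there,
restricted to the open cone, are what excludes it from the wave front set. -/
theorem WFc_subset_of_uniformTails (hL : IsClosed L) (hLc : IsConicSet L)
    (h : ∀ (Φ : BundleChart m k E) (φ : TestFunction Φ.Ω ℂ ⊤) (V : Set 𝔼), IsClosed V →
      IsConeSet V → SupportConeDisjoint Φ φ V L →
        ∀ j, UniformTails r V fun u : B ↦ u.1.componentFourier Φ j φ) : WFc r B ⊆ L := by
  rintro q ⟨Φ, hq, hη⟩
  obtain ⟨j, hj⟩ := mem_iUnion.1 hη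
  by_contra hqL
  obtain ⟨φ, hφ, ε, hε, hd⟩ := exists_supportConeDisjoint hL hLc hqL Φ hq
  have h0 := covectorCoords_ne_zero Φ.chart_mem q hq
  refine (notMem_sigmaCompactAt h0).2 ⟨φ, hφ, _, isOpen_openUnitCone _ ε,
    isConeSet_openUnitCone _ ε, zero_notMem_openUnitCone _ ε, self_mem_openUnitCone h0 hε, ?_⟩ hj
  have h1 := (h Φ φ _ (isClosed_unitCone _ ε) (isConeSet_unitCone _ ε) hd j).mono
    (openUnitCone_subset _ ε)
  refine .of_le h1 (Eventually.of_forall ?_)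
  rintro R ⟨_, u, hu, rfl⟩
  exact le_iSup (fun u : B ↦ weightedEnergy r (_ ∩ {ξ | R < ‖ξ‖}) (u.1.componentFourier Φ j φ))
    ⟨u, hu⟩

theorem WF_subset_of_weightedEnergy_lt_top (hL : IsClosed L) (hLc : IsConicSet L)
    {u : DistSection m k E}
    (h : ∀ (Φ : BundleChart m k E) (φ : TestFunction Φ.Ω ℂ ⊤) (V : Set 𝔼), IsClosed V →
      IsConeSet V → SupportConeDisjoint Φ φ V L →
        ∀ j, weightedEnergy r V (u.componentFourier Φ j φ) < ⊤) : WF r u ⊆ L := by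
  rintro q ⟨Φ, hq, hη⟩
  obtain ⟨j, hj⟩ := mem_iUnion.1 hη
  by_contra hqL
  obtain ⟨φ, hφ, ε, hε, hd⟩ := exists_supportConeDisjoint hL hLc hqL Φ hq
  have h0 := covectorCoords_ne_zero Φ.chart_mem q hq
  refine hj.2 ⟨_, φ, isOpen_openUnitCone _ ε, isConeSet_openUnitCone _ ε,
    self_mem_openUnitCone h0 hε, hφ, ?_⟩
  exact (weightedEnergy_mono r (openUnitCone_subset _ ε) _).trans_lt
    (h Φ φ _ (isClosed_unitCone _ ε) (isConeSet_unitCone _ ε) hd j)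

/-! ### The topology of `D'^r_L` -/

/-- The distribution that underlies an element of `D'^r_L`. -/
def SobolevDist.val (u : SobolevDist k E r L) : DistSection m k E := u.1

variable (k E r L) in
/-- The open balls of the seminorms that define the topology of `D'^r_L`. -/
def sobolevBalls : Set (Set (SobolevDist k E r L)) :=
  {S | ∃ (Φ : BundleChart m k E) (φ : TestFunction Φ.Ω ℂ ⊤) (V : Set 𝔼), IsClosed V ∧ IsConeSet V ∧
    SupportConeDisjoint Φ φ V L ∧ ∃ (u : SobolevDist k E r L) (ε : ℝ), 0 < ε ∧
      S = {v | sobolevSeminorm r Φ φ V (v.1 - u.1) < ENNReal.ofReal ε}}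

theorem nhds_sobolevDist (u : SobolevDist k E r L) :
    𝓝 u = comap SobolevDist.val (𝓝 u.val) ⊓
      @nhds _ (TopologicalSpace.generateFrom (sobolevBalls k E r L)) u := by
  rw [← nhds_induced]
  exact @nhds_inf (SobolevDist k E r L) (TopologicalSpace.induced SobolevDist.val inferInstance)
    (TopologicalSpace.generateFrom (sobolevBalls k E r L)) u

theorem continuous_val_sobolevDist :
    Continuous (SobolevDist.val : SobolevDist k E r L → DistSection m k E) :=
  continuous_iff_continuousAt.2 fun u ↦
    tendsto_iff_comap.2 ((nhds_sobolevDist u).le.trans inf_le_left)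

theorem sobolevBall_mem_nhds {Φ : BundleChart m k E} {φ : TestFunction Φ.Ω ℂ ⊤} {V : Set 𝔼}
    (hV : IsClosed V) (hVc : IsConeSet V) (hd : SupportConeDisjoint Φ φ V L)
    (u : SobolevDist k E r L) {ε : ℝ} (hε : 0 < ε) :
    {v : SobolevDist k E r L | sobolevSeminorm r Φ φ V (v.1 - u.1) < ENNReal.ofReal ε} ∈ 𝓝 u := by
  rw [nhds_sobolevDist, TopologicalSpace.nhds_generateFrom]
  refine mem_inf_of_right (mem_iInf_of_mem _ (mem_iInf_of_mem
    ⟨?_, Φ, φ, V, hV, hVc, hd, u, ε, hε, rfl⟩ (mem_principal_self _)))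
  change sobolevSeminorm r Φ φ V (u.1 - u.1) < ENNReal.ofReal ε
  rw [sobolevSeminorm_sub_self]
  exact ENNReal.ofReal_pos.2 hε

/-! ### Continuity, semicontinuity and tails -/

variable [VectorBundle ℂ (Fin k → ℂ) E] [ContMDiffVectorBundle ∞ (Fin k → ℂ) E (𝓡 m)]

theorem DistSection.continuous_componentFourier (u : DistSection m k E) (Φ : BundleChart m k E)
    (j : Fin k) (φ : TestFunction Φ.Ω ℂ ⊤) : Continuous (u.componentFourier Φ j φ) := by
  obtain ⟨q, hq, h⟩ := exists_isLFSeminorm_of_isVonNBounded (Bornology.isVonNBounded_singleton u)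
  exact (hq.locallyUniformlyBounded Φ j h).continuous_localFourier φ ⟨u, rfl, rfl⟩

/-- Energies are lower semicontinuous. -/
theorem weightedEnergy_componentFourier_le {u : DistSection m k E}
    {𝓕 : Filter (DistSection m k E)} [𝓕.NeBot] (h𝓕 : 𝓕 ≤ 𝓝 u) (Φ : BundleChart m k E) (j : Fin k)
    (φ : TestFunction Φ.Ω ℂ ⊤) (V : Set 𝔼) {c : ℝ≥0∞}
    (hc : ∀ᶠ v : DistSection m k E in 𝓕, weightedEnergy r V (v.componentFourier Φ j φ) ≤ c) :
    weightedEnergy r V (u.componentFourier Φ j φ) ≤ c := by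
  refine weightedEnergy_le_of_forall_ball r V _ fun n ↦ ?_
  have h1 := (tendsto_weightedEnergy_componentFourier_sub r u Φ j φ V n).mono_left h𝓕
  have h2 := (ENNReal.continuous_rpow_const (y := 1 / 2)).continuousAt.tendsto.comp h1
  have h3 := h2.const_add (c ^ (1 / 2 : ℝ))
  rw [ENNReal.zero_rpow_of_pos (by norm_num), add_zero] at h3
  have h4 : weightedEnergy r (V ∩ {ξ | ‖ξ‖ ≤ n}) (u.componentFourier Φ j φ) ^ (1 / 2 : ℝ) ≤
      c ^ (1 / 2 : ℝ) := by
    refine ge_of_tendsto h3 (hc.mono fun v hv ↦ ?_)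
    -- Minkowski's inequality, since a factor 2 would not vanish in the limit and the bound c has to
    -- be kept.
    have h5 := weightedEnergy_rpow_add_le r (V ∩ {ξ | ‖ξ‖ ≤ n})
      (v.continuous_componentFourier Φ j φ).measurable
      ((u.continuous_componentFourier Φ j φ).sub (v.continuous_componentFourier Φ j φ)).measurable
    rw [weightedEnergy_sub_comm r _ (u.componentFourier Φ j φ)] at h5
    rw [add_sub_cancel] at h5
    refine h5.trans (add_le_add ?_ le_rfl)
    gcongr
    exact (weightedEnergy_mono r inter_subset_left _).trans hv
  rwa [ENNReal.rpow_le_rpow_iff (by norm_num)] at h4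

/-- Every direction in V over a point of supp φ is the coordinate vector of a covector outside L,
hence outside WF^r_c(B). As WF^r_c is a union over all bundle charts, this information is available
in the given Φ, and the local theorem for uniformly bounded families applies. -/
theorem uniformTails_of_WFc_subset (hB : Bornology.IsVonNBounded ℂ B) (h : WFc r B ⊆ L)
    {Φ : BundleChart m k E} {φ : TestFunction Φ.Ω ℂ ⊤} {V : Set 𝔼} (hV : IsClosed V)
    (hVc : IsConeSet V) (hd : SupportConeDisjoint Φ φ V L) (j : Fin k) :
    UniformTails r V fun u : B ↦ u.1.componentFourier Φ j φ := by
  obtain ⟨q, hq, hBq⟩ := exists_isLFSeminorm_of_isVonNBounded hB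
  have h1 := (hq.locallyUniformlyBounded Φ j hBq).uniformTails φ (r := r) hV hVc
    fun y hy η hη hη0 hs ↦ by
      have hyt : y ∈ Φ.chart.target := φ.tsupport_subset hy
      obtain ⟨ξ, hξp, hξ⟩ := exists_covectorCoords_eq Φ.chart_mem (Φ.chart.map_target hyt) hη0
      have hξs : ξ.1.1 ∈ Φ.chart.source := hξp ▸ Φ.chart.map_target hyt
      have hξy : Φ.chart ξ.1.1 = y := by rw [hξp, Φ.chart.right_inv hyt]
      refine hd ξ (h ⟨Φ, hξs, mem_iUnion.2 ⟨j, ?_⟩⟩) hξs (by rwa [hξy]) (by rwa [hξ])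
      rwa [hξ, hξy]
  refine .of_le h1 (Eventually.of_forall fun R u ↦ ?_)
  exact le_iSup (fun T : ((fun u : DistSection m k E ↦ u.localize Φ j) '' B) ↦
    weightedEnergy r (V ∩ {ξ | R < ‖ξ‖}) (localFourier T.1 φ)) ⟨_, u.1, u.2, rfl⟩

instance : T2Space (DistSection m k E) :=
  have := TestSection.withSeminorms (m := m) (k := k) (E := E) |>.continuousSMul
  inferInstance

/-- Makes compact sets closed, so that a compact set containing B also contains its closure. -/
instance : T2Space (SobolevDist k E r L) :=
  T2Space.of_injective_continuous (fun _ _ h ↦ Subtype.ext h) continuous_val_sobolevDist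

theorem sobolevSeminorm_sub_le (Φ : BundleChart m k E) (φ : TestFunction Φ.Ω ℂ ⊤) (V : Set 𝔼)
    (u v w : DistSection m k E) : sobolevSeminorm r Φ φ V (u - w) ≤
      sobolevSeminorm r Φ φ V (u - v) + sobolevSeminorm r Φ φ V (v - w) := by
  refine iSup_le fun j ↦ ?_
  have h := weightedEnergy_rpow_add_le r V
    (DistSection.continuous_componentFourier (u - v) Φ j φ).measurable
    (DistSection.continuous_componentFourier (v - w) Φ j φ).measurable
  have e : DistSection.componentFourier (u - v) Φ j φ +
      DistSection.componentFourier (v - w) Φ j φ = localFourier ((u - w).localize Φ j) φ := by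
    rw [componentFourier_sub, componentFourier_sub, sub_add_sub_cancel]
    rfl
  rw [e] at h
  exact h.trans (add_le_add
    (le_iSup (fun j ↦ weightedEnergy r V (localFourier ((u - v).localize Φ j) φ) ^ (1 / 2 : ℝ)) j)
    (le_iSup (fun j ↦ weightedEnergy r V (localFourier ((v - w).localize Φ j) φ) ^ (1 / 2 : ℝ)) j))

/-- Convergence in `D'^r_L`. -/
theorem le_nhds_sobolevDist {𝓕 : Filter (SobolevDist k E r L)} {u : SobolevDist k E r L}
    (h1 : 𝓕.map SobolevDist.val ≤ 𝓝 u.1)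
    (h2 : ∀ (Φ : BundleChart m k E) (φ : TestFunction Φ.Ω ℂ ⊤) (V : Set 𝔼), IsClosed V →
      IsConeSet V → SupportConeDisjoint Φ φ V L →
        Tendsto (fun v : SobolevDist k E r L ↦ sobolevSeminorm r Φ φ V (v.1 - u.1)) 𝓕 (𝓝 0)) :
    𝓕 ≤ 𝓝 u := by
  rw [nhds_sobolevDist, le_inf_iff, ← map_le_iff_le_comap]
  refine ⟨h1, ?_⟩
  rw [TopologicalSpace.nhds_generateFrom]
  refine le_iInf₂ fun S hS ↦ le_principal_iff.2 ?_
  obtain ⟨huS, Φ, φ, V, hV, hVc, hd, u₀, ε, hε, rfl⟩ := hS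
  have h3 := (h2 Φ φ V hV hVc hd).add_const (sobolevSeminorm r Φ φ V (u.1 - u₀.1))
  rw [zero_add] at h3
  -- The generating balls may be centred at any u₀; by the triangle inequality a small seminorm of v
  -- - u keeps v in the ball.
  filter_upwards [h3.eventually (gt_mem_nhds huS)] with v hv
  exact (sobolevSeminorm_sub_le Φ φ V v.1 u.1 u₀.1).trans_lt hv

variable (r L) in
/-- The distributions in `D'^r_L` that are dominated by a seminorm and whose high frequency parts are
dominated by those of a set of distributions. -/
def tailPolar (q : Seminorm ℂ (TestSection m k E)) (B : Set (DistSection m k E)) :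
    Set (SobolevDist k E r L) :=
  {u | (∀ s, ‖u.1 s‖ ≤ q s) ∧ ∀ (Φ : BundleChart m k E) (φ : TestFunction Φ.Ω ℂ ⊤) (V : Set 𝔼),
    IsClosed V → IsConeSet V → SupportConeDisjoint Φ φ V L → ∀ j (R : ℝ),
      weightedEnergy r (V ∩ {ξ | R < ‖ξ‖}) (u.1.componentFourier Φ j φ) ≤
        ⨆ v : B, weightedEnergy r (V ∩ {ξ | R < ‖ξ‖}) (v.1.componentFourier Φ j φ)}

/-- Strong compactness of the polar of q provides the limit; the tail bounds put it in D'^r_L and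
upgrade the convergence to the Sobolev seminorms. -/
theorem isCompact_tailPolar [SecondCountableTopology M] (hL : IsClosed L) (hLc : IsConicSet L)
    (hB : Bornology.IsVonNBounded ℂ B) (h : WFc r B ⊆ L) {q : Seminorm ℂ (TestSection m k E)}
    (hq : IsLFSeminorm q) : IsCompact (tailPolar r L q B) := by
  rw [isCompact_iff_ultrafilter_le_nhds]
  intro 𝓤 h𝓤
  have h𝓤' : ∀ᶠ v in (𝓤 : Filter (SobolevDist k E r L)), v ∈ tailPolar r L q B :=
    le_principal_iff.1 h𝓤
  obtain ⟨u, hu, hlim⟩ := (𝓤.map SobolevDist.val).exists_le_nhds_of_forall_norm_le hq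
    (Filter.eventually_map.2 (h𝓤'.mono fun v hv ↦ hv.1))
  have htails : ∀ (Φ : BundleChart m k E) (φ : TestFunction Φ.Ω ℂ ⊤) (V : Set 𝔼),
      IsClosed V → IsConeSet V → SupportConeDisjoint Φ φ V L → ∀ j (R : ℝ),
        weightedEnergy r (V ∩ {ξ | R < ‖ξ‖}) (u.componentFourier Φ j φ) ≤
          ⨆ v : B, weightedEnergy r (V ∩ {ξ | R < ‖ξ‖}) (v.1.componentFourier Φ j φ) :=
    fun Φ φ V hV hVc hd j R ↦ weightedEnergy_componentFourier_le hlim Φ j φ _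
      (Filter.eventually_map.2 (h𝓤'.mono fun v hv ↦ hv.2 Φ φ V hV hVc hd j R))
  have hWF : WF r u ⊆ L := by
    refine WF_subset_of_weightedEnergy_lt_top hL hLc fun Φ φ V hV hVc hd j ↦ ?_
    -- The limit is regarded as a family with one member, whose tails are dominated by those of B.
    have h1 : UniformTails r V fun _ : Unit ↦ u.componentFourier Φ j φ :=
      .of_le (uniformTails_of_WFc_subset hB h hV hVc hd j)
        (Eventually.of_forall fun R _ ↦ htails Φ φ V hV hVc hd j R)
    exact h1.weightedEnergy_lt_top () (u.continuous_componentFourier Φ j φ)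
  refine ⟨⟨u, hWF⟩, ⟨hu, htails⟩, le_nhds_sobolevDist hlim fun Φ φ V hV hVc hd ↦ ?_⟩
  rw [ENNReal.tendsto_nhds_zero]
  intro δ hδ
  have h1 : ∀ j : Fin k, ∀ᶠ v in (𝓤 : Filter (SobolevDist k E r L)),
      weightedEnergy r V (DistSection.componentFourier (v.1 - u) Φ j φ) ≤ δ ^ 2 := by
    intro j
    have hT := uniformTails_of_WFc_subset hB h hV hVc hd j
    have hδ2 : 0 < δ ^ 2 / 2 := ENNReal.div_pos (pow_ne_zero 2 hδ.ne') (by simp)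
    -- The factor 4 is 2 + 2 from `weightedEnergy_sub_le`: the tails of v and of the limit u obey
    -- the same bound.
    have h4 : Tendsto (fun R : ℝ ↦ 4 * ⨆ v : B,
        weightedEnergy r (V ∩ {ξ | R < ‖ξ‖}) (v.1.componentFourier Φ j φ)) atTop (𝓝 0) := by
      simpa using ENNReal.Tendsto.const_mul (a := 4) hT (Or.inr (by simp))
    obtain ⟨R, hR⟩ := (ENNReal.tendsto_nhds_zero.1 h4 _ hδ2).exists
    have h5 := (tendsto_weightedEnergy_componentFourier_sub r u Φ j φ V R).mono_left hlim
    filter_upwards [ENNReal.tendsto_nhds_zero.1 h5 _ hδ2, h𝓤'] with v hv hvQ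
    rw [componentFourier_sub]
    refine (weightedEnergy_le_add r V _ R).trans ?_
    rw [← ENNReal.add_halves (δ ^ 2)]
    refine add_le_add hv (le_trans ?_ hR)
    refine (weightedEnergy_sub_le r _ (v.1.continuous_componentFourier Φ j φ).measurable).trans ?_
    calc _ ≤ 2 * (⨆ v : B, weightedEnergy r (V ∩ {ξ | R < ‖ξ‖}) (v.1.componentFourier Φ j φ)) +
          2 * ⨆ v : B, weightedEnergy r (V ∩ {ξ | R < ‖ξ‖}) (v.1.componentFourier Φ j φ) :=
          add_le_add (mul_le_mul_right (hvQ.2 Φ φ V hV hVc hd j R) _)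
            (mul_le_mul_right (htails Φ φ V hV hVc hd j R) _)
      _ = _ := by rw [← add_mul]; norm_num
  filter_upwards [Filter.eventually_all.2 h1] with v hv
  exact iSup_le fun j ↦ ENNReal.rpow_half_le_iff.2 (hv j)

/-- With q dominating B, the set B lies in the compact set `tailPolar r L q B`; finiteness of the
energies places it in D'^r_L first. -/
theorem isRelativelyCompactIn_of_WFc_subset [SecondCountableTopology M] (hL : IsClosed L)
    (hLc : IsConicSet L) (hB : Bornology.IsVonNBounded ℂ B) (h : WFc r B ⊆ L) :
    IsRelativelyCompactIn r L B := by
  obtain ⟨q, hq, hBq⟩ := exists_isLFSeminorm_of_isVonNBounded hB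
  refine ⟨fun u hu ↦ WF_subset_of_weightedEnergy_lt_top hL hLc fun Φ φ V hV hVc hd j ↦ ?_, ?_⟩
  · exact (uniformTails_of_WFc_subset hB h hV hVc hd j).weightedEnergy_lt_top ⟨u, hu⟩
      (u.continuous_componentFourier Φ j φ)
  · refine (isCompact_tailPolar hL hLc hB h hq).closure_of_subset fun u hu ↦ ⟨hBq _ hu, ?_⟩
    exact fun Φ φ V _ _ _ j R ↦ le_iSup (fun v : B ↦ weightedEnergy r (V ∩ {ξ | R < ‖ξ‖})
      (v.1.componentFourier Φ j φ)) ⟨u.1, hu⟩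

/-- Total boundedness in one Sobolev seminorm: up to a small error the tails of B are those of
finitely many centres, each of which has vanishing tails. -/
theorem WFc_subset_of_isRelativelyCompactIn (hL : IsClosed L) (hLc : IsConicSet L)
    (h : IsRelativelyCompactIn r L B) : WFc r B ⊆ L := by
  refine WFc_subset_of_uniformTails hL hLc fun Φ φ V hV hVc hd j ↦ ?_
  unfold UniformTails
  rw [ENNReal.tendsto_nhds_zero]
  intro δ hδ
  have hδ2 : 0 < δ / 2 := ENNReal.div_pos hδ.ne' (by simp)
  -- The constant 2 comes from `weightedEnergy_add_le`; δ/2 is reserved for the distance to a centre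
  -- and δ/2 for the tail of that centre.
  obtain ⟨ε, hε, hεδ⟩ := exists_pos_mul_ofReal_sq_le (C := 2) (by simp) hδ2
  obtain ⟨t, -, ht⟩ := h.2.elim_nhds_subcover _
    fun u _ ↦ sobolevBall_mem_nhds (r := r) hV hVc hd u hε
  have h1 : ∀ u ∈ t, ∀ᶠ R in atTop,
      2 * weightedEnergy r (V ∩ {ξ | R < ‖ξ‖}) (u.1.componentFourier Φ j φ) ≤ δ / 2 := by
    intro u _
    have hT := uniformTails_of_WFc_subset (Bornology.isVonNBounded_singleton u.1)
      ((WFc_singleton_subset r u.1).trans u.2) hV hVc hd j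
    have h2 := ENNReal.Tendsto.const_mul (a := 2) hT (Or.inr (by simp))
    rw [mul_zero] at h2
    filter_upwards [ENNReal.tendsto_nhds_zero.1 h2 _ hδ2] with R hR
    exact (mul_le_mul_right (le_iSup (fun v : ({u.1} : Set (DistSection m k E)) ↦
      weightedEnergy r (V ∩ {ξ | R < ‖ξ‖}) (v.1.componentFourier Φ j φ)) ⟨u.1, rfl⟩) _).trans hR
  filter_upwards [(Filter.eventually_all_finset t).2 h1] with R hR
  refine iSup_le fun v ↦ ?_
  obtain ⟨u, hut, hvu⟩ := mem_iUnion₂.1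
    (ht (subset_closure (show (⟨v.1, h.1 v.1 v.2⟩ : SobolevDist k E r L) ∈ _ from v.2)))
  have h3 : sobolevSeminorm r Φ φ V (v.1 - u.1) < ENNReal.ofReal ε := hvu
  have h4 : weightedEnergy r V (v.1.componentFourier Φ j φ - u.1.componentFourier Φ j φ) ≤
      ENNReal.ofReal ε ^ 2 := by
    rw [← componentFourier_sub, ← ENNReal.rpow_half_le_iff]
    exact (le_iSup (fun j ↦ weightedEnergy r V
      (localFourier ((v.1 - u.1).localize Φ j) φ) ^ (1 / 2 : ℝ)) j).trans h3.le
  have h5 := weightedEnergy_add_le r (V ∩ {ξ | R < ‖ξ‖})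
    ((v.1.continuous_componentFourier Φ j φ).sub (u.1.continuous_componentFourier Φ j φ)).measurable
    (u.1.componentFourier Φ j φ)
  rw [sub_add_cancel] at h5
  refine h5.trans ?_
  rw [← ENNReal.add_halves δ]
  refine add_le_add (le_trans ?_ hεδ) (hR u hut)
  exact mul_le_mul_right ((weightedEnergy_mono r inter_subset_left _).trans h4) _

end SobolevWaveFront

theorem mainTheorem2 (m k : ℕ) {M : Type*} [TopologicalSpace M]
    [ChartedSpace (EuclideanSpace ℝ (Fin m)) M] [IsManifold (𝓡 m) ∞ M]
    [T2Space M] [SecondCountableTopology M]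
    (E : M → Type*) [TopologicalSpace (TotalSpace (Fin k → ℂ) E)]
    [∀ p, AddCommGroup (E p)] [∀ p, Module ℂ (E p)] [∀ p, TopologicalSpace (E p)]
    [FiberBundle (Fin k → ℂ) E] [VectorBundle ℂ (Fin k → ℂ) E]
    [ContMDiffVectorBundle ∞ (Fin k → ℂ) E (𝓡 m)]
    (r : ℝ) (L : Set (CotangentMinusZero m M)) (hLclosed : IsClosed L) (hLconic : IsConicSet L)
    (B : Set (DistSection m k E)) (hB : Bornology.IsVonNBounded ℂ B) :
    WFc r B ⊆ L ↔ IsRelativelyCompactIn r L B := by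
  exact ⟨isRelativelyCompactIn_of_WFc_subset hLclosed hLconic hB,
    WFc_subset_of_isRelativelyCompactIn hLclosed hLconic⟩
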